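/- Let $N\in\mathbb N$, let $0<\lambda\le\Lambda$ satisfy $\tilde N_+:=\frac{\lambda}{\Lambda}(N-1)+1>2$, and let $\alpha>-1$, $0<\gamma<2+\alpha$. Write $B=B(0,1)\subset\mathbb R^N$ for the open unit ball and $r=|x|$. Let $F$ be a continuous real function on the symmetric $N\times N$ matrices such that $\lambda\,\mathrm{tr}(M')\le F(M+M')-F(M)\le\Lambda\,\mathrm{tr}(M')$ for all symmetric $M$ and all positive semidefinite $M'$, $F(tM)=tF(M)$ for all $t>0$, and $F(OMO^{T})=F(M)$ for all orthogonal $O$. Let $\mathcal C_{1,\alpha}$ be the set of radial functions $u$ on $B\setminus\{0\}$ such that $u$ and $|u'|^\alpha u'$ are of class $C^1$ on $B\setminus\{0\}$, where $u'$ is the radial derivative. A continuous function $u$ on an open set $\Omega$ is a viscosity subsolution of $|\nabla u|^\alpha F(D^2u)=g(x,u)$ in $\Omega$ if (a) $g(x,u(x))\le 0$ at every point $x$ of each open ball contained in $\Omega$ on which $u$ is constant, and (b) $|\nabla\varphi(x_0)|^\alpha F(D^2\varphi(x_0))\ge g(x_0,u(x_0))$ whenever $x_0\in\Omega$, $\varphi$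 is $C^2$ near $x_0$, $u-\varphi$ has a local maximum at $x_0$ and $\nabla\varphi(x_0)\neq0$; supersolutions are defined with the reversed inequalities and local minima, and a solution is both. Theorem. Let $f\in C(B)$ be radial and bounded, $\beta\ge0$ and $b\in\mathbb R$. Then there exists a bounded radial function $u\in C(\overline B)\cap\mathcal C_{1,\alpha}$ that is a viscosity solution of $$|\nabla u|^\alpha F(D^2u)-\beta|u|^\alpha u\,r^{-\gamma}=r^{-\gamma}f\ \text{ in }B\setminus\{0\},\qquad u=b\ \text{ on }\partial B.$$ Such a $u$ is unique if $\beta>0$, or if $\beta=0$ and $f\ge0$ in $B$ or $f\le0$ in $B$. Moreover, every such $u$ belongs to $C^1(\overline B)$ if $\gamma<1$, is Lipschitz continuous on $\overline B$ if $\gamma\le1$, and is Hölder continuous on $\overline B$ with exponent $\frac{2+\alpha-\gamma}{1+\alpha}$ if $\gamma>1$. -/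

import Mathlib

open Set Metric Topology

noncomputable section

/-- The space `ℝ^N` with its Euclidean norm. -/
abbrev RN (N : ℕ) : Type := EuclideanSpace ℝ (Fin N)

/-- The punctured open unit ball `B(0,1) \ {0}`. -/
def puncturedBall (N : ℕ) : Set (RN N) := ball 0 1 \ {0}

/-- The odd power `|s|^α s`; for `α > -1` it vanishes at `s = 0`. -/
def signedPow (α s : ℝ) : ℝ := |s| ^ α * s

/-- `u` is radial on `S`: `u(x) = U(|x|)` there, for some profile `U`. -/
def IsRadialOn {N : ℕ} (u : RN N → ℝ) (S : Set (RN N)) : Prop :=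
  ∃ U : ℝ → ℝ, ∀ x ∈ S, u x = U ‖x‖

/-- The Hessian matrix `D²φ(x)`, with entries `∂ᵢ∂ⱼφ(x)`. -/
def hessianMatrix {N : ℕ} (φ : RN N → ℝ) (x : RN N) : Matrix (Fin N) (Fin N) ℝ :=
  Matrix.of fun i j =>
    fderiv ℝ (fderiv ℝ φ) x (EuclideanSpace.single i 1) (EuclideanSpace.single j 1)

/-- Uniform ellipticity on symmetric matrices: for all symmetric `M` and all positive
semidefinite `M'`, `lam tr M' ≤ F (M + M') - F M ≤ Lam tr M'`. -/
def IsUniformlyElliptic {N : ℕ} (lam Lam : ℝ) (F : Matrix (Fin N) (Fin N) ℝ → ℝ) : Prop :=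
  ∀ M M' : Matrix (Fin N) (Fin N) ℝ, M.IsSymm → M'.PosSemidef →
    lam * M'.trace ≤ F (M + M') - F M ∧ F (M + M') - F M ≤ Lam * M'.trace

/-- Positive homogeneity of degree one on symmetric matrices. -/
def IsPosHomogeneous {N : ℕ} (F : Matrix (Fin N) (Fin N) ℝ → ℝ) : Prop :=
  ∀ (M : Matrix (Fin N) (Fin N) ℝ) (t : ℝ), M.IsSymm → 0 < t → F (t • M) = t * F M

/-- Rotational invariance on symmetric matrices: `F (O M Oᵀ) = F M` for orthogonal `O`. -/
def IsRotationInvariant {N : ℕ} (F : Matrix (Fin N) (Fin N) ℝ → ℝ) : Prop :=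
  ∀ O M : Matrix (Fin N) (Fin N) ℝ, O ∈ Matrix.orthogonalGroup (Fin N) ℝ → M.IsSymm →
    F (O * M * O.transpose) = F M

/-- Viscosity subsolutions of `|∇u|^α F(D²u) = g(x,u)` in the open set `Ω`, in the sense of
Birindelli and Demengel: only test functions with non-vanishing gradient at the touching
point are used, and where `u` is constant on a ball the inequality `0 ≥ g(x,u)` is required. -/
def IsViscSubsolution {N : ℕ} (α : ℝ) (F : Matrix (Fin N) (Fin N) ℝ → ℝ)
    (g : RN N → ℝ → ℝ) (Ω : Set (RN N)) (u : RN N → ℝ) : Prop :=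
  ContinuousOn u Ω ∧
  ∀ x₀ ∈ Ω,
    (∀ δ > 0, ball x₀ δ ⊆ Ω → (∀ x ∈ ball x₀ δ, u x = u x₀) →
      ∀ x ∈ ball x₀ δ, g x (u x₀) ≤ 0) ∧
    (∀ φ : RN N → ℝ, ContDiffAt ℝ 2 φ x₀ → IsLocalMax (fun x => u x - φ x) x₀ →
      gradient φ x₀ ≠ 0 →
      g x₀ (u x₀) ≤ ‖gradient φ x₀‖ ^ α * F (hessianMatrix φ x₀))

/-- Viscosity supersolutions of `|∇u|^α F(D²u) = g(x,u)` in the open set `Ω`, in the sense of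
Birindelli and Demengel. -/
def IsViscSupersolution {N : ℕ} (α : ℝ) (F : Matrix (Fin N) (Fin N) ℝ → ℝ)
    (g : RN N → ℝ → ℝ) (Ω : Set (RN N)) (u : RN N → ℝ) : Prop :=
  ContinuousOn u Ω ∧
  ∀ x₀ ∈ Ω,
    (∀ δ > 0, ball x₀ δ ⊆ Ω → (∀ x ∈ ball x₀ δ, u x = u x₀) →
      ∀ x ∈ ball x₀ δ, 0 ≤ g x (u x₀)) ∧
    (∀ φ : RN N → ℝ, ContDiffAt ℝ 2 φ x₀ → IsLocalMin (fun x => u x - φ x) x₀ →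
      gradient φ x₀ ≠ 0 →
      ‖gradient φ x₀‖ ^ α * F (hessianMatrix φ x₀) ≤ g x₀ (u x₀))

/-- Viscosity solutions: both sub- and supersolutions. -/
def IsViscSolution {N : ℕ} (α : ℝ) (F : Matrix (Fin N) (Fin N) ℝ → ℝ)
    (g : RN N → ℝ → ℝ) (Ω : Set (RN N)) (u : RN N → ℝ) : Prop :=
  IsViscSubsolution α F g Ω u ∧ IsViscSupersolution α F g Ω u

/-- The class `C_{1,α}`: radial functions on `B(0,1) \ {0}` whose profile `U` is such that
`U` and `|U'|^α U'` are of class `C¹` on `(0,1)`. -/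
def MemC1α {N : ℕ} (α : ℝ) (u : RN N → ℝ) : Prop :=
  ∃ U : ℝ → ℝ, (∀ x ∈ puncturedBall N, u x = U ‖x‖) ∧
    ContDiffOn ℝ 1 U (Ioo 0 1) ∧
    ContDiffOn ℝ 1 (fun r => signedPow α (deriv U r)) (Ioo 0 1)

/-- `u` is a bounded radial function in `C(closed ball) ∩ C_{1,α}` that solves
`|∇u|^α F(D²u) - β |u|^α u r^{-γ} = r^{-γ} f` in `B(0,1) \ {0}` in the viscosity sense,
with `u = b` on the unit sphere. -/
structure IsBoundedRadialSolution {N : ℕ} (α γ β b : ℝ) (F : Matrix (Fin N) (Fin N) ℝ → ℝ)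
    (f u : RN N → ℝ) : Prop where
  bounded : ∃ C : ℝ, ∀ x ∈ closedBall (0 : RN N) 1, |u x| ≤ C
  radial : IsRadialOn u (closedBall 0 1)
  continuousOn : ContinuousOn u (closedBall 0 1)
  memC1α : MemC1α α u
  solves : IsViscSolution α F
    (fun x s => β * signedPow α s * ‖x‖ ^ (-γ) + ‖x‖ ^ (-γ) * f x) (puncturedBall N) u
  boundary : ∀ x ∈ sphere (0 : RN N) 1, u x = b

end

/-! For a radial `u` the Hessian has the simple eigenvalue `u''` and the eigenvalue `u'/r` of
multiplicity `N - 1`. Put `w = |u'|^α u'`. By homogeneity and rotation invariance the equation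
becomes `G(w'/(1+α), w/r) = r^{-γ} k` with `k = β|u|^α u + f`, where `G` is the operator on axis
matrices. Put `z = r^{γ-1} w`, multiply by `r^γ` and solve for the first argument of `G`. The result
is the scalar system `r z' = -Q(z, k)`, `u' = r^{s-1} |z|^a z`, with `1 + a = 1/(1+α)` and `s =
(2+α-γ)/(1+α)`.

Ellipticity makes `Q` increase in `z` at rate at least `q = 1 - γ + (1+α)(N-1)λ/Λ`
(`IsRadialOperator.isDissipative`), and `Ñ₊ > 2` gives `q > 2+α-γ > 0`. Hence, for a given `k`, `r^q
|z₁ - z₂|` does not increase with `r`, and two distinct solutions separate like `r^{-q}` at the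
origin. An unbounded `z` would force `|u'| ≥ c/r`, so bounded `u` have bounded `z`
(`IsProfile.le_of_bounded`), and bounded `z` are ordered like their data (`IsProfile.z_mono`). This
replaces an initial condition at the singular point and yields a maximum principle
(`IsProfile.le_of_le`), hence uniqueness.

For existence, the variable `r^s` removes the singular weight from `u'`, and the equation for `z`
becomes a fixed point equation for a weighted average along rays, contracting in `z` because `Q` is
strongly monotone and Lipschitz. Shooting from the origin, approximation by Lipschitz nonlinearities
and compactness solve the truncated problem (`exists_integralSolution`); a priori bounds remove the
truncations (`exists_profile`).

The viscosity notion agrees with the radial equation (`IsC1αProfile.isViscSolution`,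
`IsC1αProfile.equation_of_isViscSolution`): `u` is `C²` where `w ≠ 0` and can test itself there.
Regularity is read off from `|u'| ≤ C r^{s-1}`. -/

noncomputable section

/-! ### The odd power -/

lemma signedPow_zero (a : ℝ) : signedPow a 0 = 0 := by simp [signedPow]

lemma signedPow_of_pos {a x : ℝ} (hx : 0 < x) : signedPow a x = x ^ (1 + a) := by
  rw [signedPow, abs_of_pos hx, Real.rpow_add hx, Real.rpow_one, mul_comm]

lemma signedPow_neg (a x : ℝ) : signedPow a (-x) = -signedPow a x := by
  simp [signedPow]

lemma signedPow_of_nonneg {a x : ℝ} (ha : -1 < a) (hx : 0 ≤ x) : signedPow a x = x ^ (1 + a) := by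
  rcases hx.eq_or_lt with rfl | hx
  · rw [signedPow_zero, Real.zero_rpow (by linarith)]
  · exact signedPow_of_pos hx

lemma signedPow_pos {a x : ℝ} (hx : 0 < x) : 0 < signedPow a x := by
  rw [signedPow_of_pos hx]; positivity

lemma signedPow_nonneg {a x : ℝ} (hx : 0 ≤ x) : 0 ≤ signedPow a x := by
  unfold signedPow; positivity

lemma abs_signedPow {a : ℝ} (ha : -1 < a) (x : ℝ) : |signedPow a x| = |x| ^ (1 + a) := by
  rw [← signedPow_of_nonneg ha (abs_nonneg x)]
  rcases abs_cases x with ⟨h, h0⟩ | ⟨h, h0⟩ <;> rw [h]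
  · exact abs_of_nonneg (signedPow_nonneg h0)
  · rw [signedPow_neg, abs_of_nonpos]
    have := signedPow_pos (a := a) (neg_pos.2 h0)
    rw [signedPow_neg] at this; linarith

lemma signedPow_eq_zero {a x : ℝ} : signedPow a x = 0 ↔ x = 0 := by
  constructor
  · intro h
    by_contra hx
    rcases lt_or_gt_of_ne hx with hx | hx
    · have := signedPow_pos (a := a) (neg_pos.2 hx)
      rw [signedPow_neg] at this; linarith
    · have := signedPow_pos (a := a) hx
      linarith
  · rintro rfl; exact signedPow_zero a

lemma signedPow_mul {a t : ℝ} (ht : 0 < t) (x : ℝ) :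
    signedPow a (t * x) = t ^ (1 + a) * signedPow a x := by
  simp only [signedPow, abs_mul, abs_of_pos ht]
  rw [Real.mul_rpow ht.le (abs_nonneg x), Real.rpow_add ht, Real.rpow_one]
  ring

lemma continuous_signedPow {a : ℝ} (ha : -1 < a) : Continuous (signedPow a) := by
  rw [continuous_iff_continuousAt]
  intro x
  by_cases hx : x = 0
  · subst hx
    have h : Filter.Tendsto (fun x : ℝ => |x| ^ (1 + a)) (𝓝 0) (𝓝 0) := by
      have : Continuous fun x : ℝ => |x| ^ (1 + a) :=
        continuous_abs.rpow_const fun _ => Or.inr (by linarith)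
      simpa [Real.zero_rpow (by linarith : 1 + a ≠ 0)] using this.tendsto 0
    rw [ContinuousAt, signedPow_zero]
    exact squeeze_zero_norm (fun x => (abs_signedPow ha x).le) h
  · exact (continuousAt_id.abs.rpow_const (Or.inl (by simpa using hx))).mul continuousAt_id

lemma strictMono_signedPow {a : ℝ} (ha : -1 < a) : StrictMono (signedPow a) := by
  have key : ∀ x y : ℝ, 0 ≤ x → x < y → signedPow a x < signedPow a y := fun x y hx hxy => by
    rw [signedPow_of_nonneg ha hx, signedPow_of_pos (hx.trans_lt hxy)]
    exact Real.rpow_lt_rpow hx hxy (by linarith)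
  intro x y hxy
  rcases le_or_gt 0 x with hx | hx
  · exact key x y hx hxy
  rcases le_or_gt 0 y with hy | hy
  · have h := signedPow_pos (a := a) (neg_pos.2 hx)
    rw [signedPow_neg] at h
    linarith [signedPow_nonneg (a := a) hy]
  · have h := key (-y) (-x) (by linarith) (by linarith)
    simp only [signedPow_neg] at h; linarith

/-- The exponents `1 + a` and `1 + b` are reciprocal. With `b = α` this passes between `u'` and `w =
|u'|^α u'` in both directions. -/
lemma signedPow_signedPow {a b : ℝ} (hab : (1 + a) * (1 + b) = 1) (x : ℝ) :
    signedPow b (signedPow a x) = x := by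
  have key : ∀ x : ℝ, 0 < x → signedPow b (signedPow a x) = x := fun x hx => by
    rw [signedPow_of_pos (signedPow_pos hx), signedPow_of_pos hx, ← Real.rpow_mul hx.le, hab,
      Real.rpow_one]
  rcases lt_trichotomy x 0 with hx | rfl | hx
  · have := key (-x) (by linarith)
    simp only [signedPow_neg] at this; linarith
  · simp [signedPow_zero]
  · exact key x hx

lemma contDiffAt_signedPow {a x : ℝ} (hx : x ≠ 0) {n : ℕ∞} :
    ContDiffAt ℝ n (signedPow a) x := by
  have h1 : ContDiffAt ℝ n (fun s : ℝ => |s|) x := contDiffAt_abs hx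
  exact (h1.rpow_const_of_ne (abs_ne_zero.2 hx)).mul contDiffAt_id

lemma hasDerivAt_signedPow {a x : ℝ} (hx : x ≠ 0) :
    HasDerivAt (signedPow a) ((1 + a) * |x| ^ a) x := by
  have key : ∀ x : ℝ, 0 < x → HasDerivAt (signedPow a) ((1 + a) * |x| ^ a) x := fun x hx => by
    have h := Real.hasDerivAt_rpow_const (x := x) (p := 1 + a) (Or.inl hx.ne')
    rw [add_sub_cancel_left] at h
    rw [abs_of_pos hx]
    refine h.congr_of_eventuallyEq ?_
    filter_upwards [lt_mem_nhds hx] with y hy using signedPow_of_pos hy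
  rcases lt_or_gt_of_ne hx with h | h
  · have h1 := (key (-x) (by linarith)).scomp x (hasDerivAt_neg x)
    have h2 := h1.neg
    simp only [smul_eq_mul, abs_neg, neg_mul, one_mul, neg_neg] at h2
    refine h2.congr_of_eventuallyEq (Filter.Eventually.of_forall fun y => ?_)
    simp [signedPow_neg]
  · exact key x h

/-! ### Comparison for the radial equation -/

/-- Structural conditions on the nonlinearity of the radial equation
`r z' = -Q(z, k)`: strong monotonicity and Lipschitz continuity in `z`, monotonicity and
Lipschitz continuity in `k`. -/
structure IsDissipative (q L C : ℝ) (Q : ℝ → ℝ → ℝ) : Prop where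
  lower : ∀ z₁ z₂ k, z₁ ≤ z₂ → q * (z₂ - z₁) ≤ Q z₂ k - Q z₁ k
  upper : ∀ z₁ z₂ k, z₁ ≤ z₂ → Q z₂ k - Q z₁ k ≤ L * (z₂ - z₁)
  strict : ∀ z k₁ k₂, k₁ < k₂ → Q z k₂ < Q z k₁
  lip : ∀ z k₁ k₂, |Q z k₁ - Q z k₂| ≤ C * |k₁ - k₂|
  zero : Q 0 0 = 0

/-- The pair `(U, z)` solves `U' = r^{s-1} |z|^a z`, `r z' = -Q(z, k)` on `(0,1)`. -/
def IsProfile (a s : ℝ) (Q : ℝ → ℝ → ℝ) (k U z : ℝ → ℝ) : Prop :=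
  ∀ r ∈ Ioo (0 : ℝ) 1, HasDerivAt U (r ^ (s - 1) * signedPow a (z r)) r ∧
    HasDerivAt z (-(Q (z r) (k r)) / r) r

lemma IsDissipative.anti {q L C : ℝ} {Q : ℝ → ℝ → ℝ} (hQ : IsDissipative q L C Q) (z : ℝ)
    {k₁ k₂ : ℝ} (h : k₁ ≤ k₂) : Q z k₂ ≤ Q z k₁ := by
  rcases h.eq_or_lt with rfl | h
  · exact le_rfl
  · exact (hQ.strict z _ _ h).le

/-- The class of nonlinearities is closed under `u ↦ -u`, so lower bounds follow from upper bounds.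
-/
lemma IsDissipative.reflect {q L C : ℝ} {Q : ℝ → ℝ → ℝ} (hQ : IsDissipative q L C Q) :
    IsDissipative q L C (fun z k => -Q (-z) (-k)) where
  lower z₁ z₂ k h := by have := hQ.lower (-z₂) (-z₁) (-k) (by linarith); linarith
  upper z₁ z₂ k h := by have := hQ.upper (-z₂) (-z₁) (-k) (by linarith); linarith
  strict z k₁ k₂ h := by have := hQ.strict (-z) (-k₂) (-k₁) (by linarith); linarith
  lip z k₁ k₂ := by
    have := hQ.lip (-z) (-k₂) (-k₁)
    rwa [show -Q (-z) (-k₁) - -Q (-z) (-k₂) = Q (-z) (-k₂) - Q (-z) (-k₁) by ring,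
      show k₁ - k₂ = -k₂ - -k₁ by ring]
  zero := by simp [hQ.zero]

lemma IsProfile.reflect {a s : ℝ} {Q : ℝ → ℝ → ℝ} {k U z : ℝ → ℝ} (h : IsProfile a s Q k U z) :
    IsProfile a s (fun z k => -Q (-z) (-k)) (fun r => -k r) (fun r => -U r) (fun r => -z r) := by
  intro r hr
  obtain ⟨h1, h2⟩ := h r hr
  refine ⟨?_, ?_⟩
  · rw [signedPow_neg, mul_neg]; exact h1.fun_neg
  · simp only [neg_neg]
    exact h2.fun_neg.congr_deriv (by ring)

/-- If `f` has nonpositive derivative wherever it is positive, then it does not grow from a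
positive value. -/
lemma le_of_deriv_nonpos_of_pos {f f' : ℝ → ℝ} {r s : ℝ} (hrs : r ≤ s)
    (hf : ∀ t ∈ Icc r s, HasDerivAt f (f' t) t) (hneg : ∀ t ∈ Icc r s, 0 < f t → f' t ≤ 0)
    (hs : 0 < f s) : f s ≤ f r := by
  by_contra! hlt
  -- The barrier is the line of slope `ε` starting at height `c`. It is positive, so `f' ≤ 0 < ε`
  -- wherever `f` meets it, and `ε` is small enough to keep it below `f s` at the end. The `+ 1`
  -- keeps the denominator nonzero when `r = s`.
  set c := max (f r) (f s / 2)
  have hc0 : 0 < c := lt_of_lt_of_le (by linarith) (le_max_right _ _)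
  have hcs : c < f s := max_lt hlt (by linarith)
  set ε := (f s - c) / (2 * (s - r + 1))
  have hε : 0 < ε := div_pos (by linarith) (by linarith)
  have h := image_le_of_deriv_right_lt_deriv_boundary (f := f) (f' := f') (a := r) (b := s)
    (B := fun t => c + ε * (t - r)) (B' := fun _ => ε)
    (fun t ht => (hf t ht).continuousAt.continuousWithinAt)
    (fun t ht => (hf t (Ico_subset_Icc_self ht)).hasDerivWithinAt)
    (by simp [c])
    (fun t => by
      have := (((hasDerivAt_id t).sub_const r).const_mul ε).const_add c
      simpa using this)
    (fun t ht hft => by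
      have : 0 < f t := by
        rw [hft]; have := mul_nonneg hε.le (sub_nonneg.2 ht.1); linarith
      exact (hneg t (Ico_subset_Icc_self ht) this).trans_lt hε)
    (right_mem_Icc.2 hrs)
  have h2 : ε * (s - r) ≤ (f s - c) / 2 := by
    have h3 : ε * (s - r + 1) = (f s - c) / 2 := by
      simp only [ε]; field_simp [show s - r + 1 ≠ 0 by linarith]
    nlinarith
  linarith

lemma hasDerivAt_rpow_mul {z : ℝ → ℝ} {z' q r : ℝ} (hr : 0 < r) (hz : HasDerivAt z (z' / r) r) :
    HasDerivAt (fun t => t ^ q * z t) (r ^ (q - 1) * (q * z r + z')) r := by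
  have h := (Real.hasDerivAt_rpow_const (x := r) (p := q) (Or.inl hr.ne')).mul hz
  refine h.congr_deriv ?_
  have : r ^ q = r ^ (q - 1) * r := by
    rw [← Real.rpow_add_one hr.ne']; ring_nf
  rw [this]; field_simp

/-- A function that solves `r D' ≤ -q D` where positive and is bounded near `0` is nonpositive. -/
lemma rpow_mul_le_of_dissipative {D D' : ℝ → ℝ} {q r t : ℝ} (hr : 0 < r) (hrt : r ≤ t)
    (hD : ∀ x ∈ Icc r t, HasDerivAt D (D' x / x) x)
    (hneg : ∀ x ∈ Icc r t, 0 < D x → D' x ≤ -(q * D x)) (ht : 0 < D t) :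
    t ^ q * D t ≤ r ^ q * D r := by
  refine le_of_deriv_nonpos_of_pos (f := fun x => x ^ q * D x) hrt
    (fun x hx => hasDerivAt_rpow_mul (hr.trans_le hx.1) (hD x hx)) (fun x hx hpos => ?_)
    (mul_pos (Real.rpow_pos_of_pos (hr.trans_le hrt) _) ht)
  have hx0 : 0 < x := hr.trans_le hx.1
  have hDx : 0 < D x := pos_of_mul_pos_right hpos (Real.rpow_nonneg hx0.le _)
  have := hneg x hx hDx
  exact mul_nonpos_of_nonneg_of_nonpos (Real.rpow_nonneg hx0.le _) (by linarith)

section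
variable {a s q L C : ℝ} {Q : ℝ → ℝ → ℝ}

/-- If `z` exceeds the constant supersolution `C K / q` at some `t`, dissipativity propagates the
excess towards the origin with growth `r^{-q}`. As `s ≤ q (1 + a)`, this makes `U' ≥ c / r`, and the
logarithm contradicts boundedness of `U`. -/
lemma IsProfile.le_of_bounded {k U z : ℝ → ℝ} (ha : -1 < a) (hq : 0 < q)
    (hsq : s ≤ q * (1 + a)) (hQ : IsDissipative q L C Q) (h : IsProfile a s Q k U z)
    {K B : ℝ} (hk : ∀ r ∈ Ioo (0 : ℝ) 1, |k r| ≤ K) (hU : ∀ r ∈ Ioo (0 : ℝ) 1, |U r| ≤ B)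
    (hC : 0 ≤ C) :
    ∀ r ∈ Ioo (0 : ℝ) 1, z r ≤ C * K / q := by
  intro t ht
  by_contra! hlt
  set Z := C * K / q
  -- `Z` is a supersolution: `Q(Z, k) ≥ q Z - C |k| ≥ 0`.
  have hZ : ∀ r ∈ Ioo (0 : ℝ) 1, 0 ≤ Q Z (k r) := fun r hr => by
    have h1 := hQ.lower 0 Z (k r) (div_nonneg (mul_nonneg hC ((abs_nonneg _).trans (hk r hr))) hq.le)
    have h2 := hQ.lip 0 (k r) 0
    rw [hQ.zero, sub_zero, sub_zero] at h2
    have h3 := neg_abs_le (Q 0 (k r))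
    have h4 : C * |k r| ≤ C * K := mul_le_mul_of_nonneg_left (hk r hr) hC
    have h5 : q * (Z - 0) = C * K := by simp only [Z]; field_simp; ring
    linarith
  set m := t ^ q * (z t - Z)
  have hm : 0 < m := mul_pos (Real.rpow_pos_of_pos ht.1 _) (by linarith)
  have hlow : ∀ r ∈ Ioc 0 t, m ≤ r ^ q * (z r - Z) := fun r hr =>
    rpow_mul_le_of_dissipative (D := fun x => z x - Z) (D' := fun x => -Q (z x) (k x)) hr.1 hr.2
      (fun x hx => (h x ⟨hr.1.trans_le hx.1, hx.2.trans_lt ht.2⟩).2.sub_const Z)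
      (fun x hx hpos => by
        have hx1 : x ∈ Ioo (0 : ℝ) 1 := ⟨hr.1.trans_le hx.1, hx.2.trans_lt ht.2⟩
        have := hQ.lower Z (z x) (k x) (by linarith)
        have := hZ x hx1
        linarith) (by linarith)
  have hz0 : 0 ≤ Z := div_nonneg (mul_nonneg hC ((abs_nonneg _).trans (hk t ht))) hq.le
  set c := m ^ (1 + a)
  have hc : 0 < c := Real.rpow_pos_of_pos hm _
  -- From `z ≥ m r^{-q}` one gets `U' ≥ c r^{s-1-q(1+a)}`, and the exponent is at most `-1`.
  have hder : ∀ r ∈ Ioc 0 t, c / r ≤ r ^ (s - 1) * signedPow a (z r) := fun r hr => by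
    have hr0 : 0 < r := hr.1
    have h1 : m * r ^ (-q) ≤ z r := by
      have := hlow r hr
      rw [Real.rpow_neg hr0.le, ← div_eq_mul_inv, div_le_iff₀ (Real.rpow_pos_of_pos hr0 _)]
      have h3 : 0 ≤ r ^ q * Z := mul_nonneg (Real.rpow_nonneg hr0.le _) hz0
      linarith
    have h2 : 0 < m * r ^ (-q) := mul_pos hm (Real.rpow_pos_of_pos hr0 _)
    have h3 := (strictMono_signedPow ha).monotone h1
    rw [signedPow_of_pos h2, Real.mul_rpow hm.le (Real.rpow_nonneg hr0.le _),
      ← Real.rpow_mul hr0.le] at h3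
    refine le_trans ?_ (mul_le_mul_of_nonneg_left h3 (Real.rpow_nonneg hr0.le _))
    rw [show r ^ (s - 1) * (m ^ (1 + a) * r ^ (-q * (1 + a)))
      = c * (r ^ (s - 1) * r ^ (-q * (1 + a))) by ring, ← Real.rpow_add hr0, div_eq_mul_inv,
      ← Real.rpow_neg_one]
    refine mul_le_mul_of_nonneg_left ?_ hc.le
    exact Real.rpow_le_rpow_of_exponent_ge hr0 (hr.2.trans ht.2.le) (by linarith)
  have hmono : ∀ r ∈ Ioc 0 t, U r - c * Real.log r ≤ U t - c * Real.log t := fun r hr => by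
    have hd : ∀ x ∈ Icc r t, HasDerivAt (fun x => U x - c * Real.log x)
        (x ^ (s - 1) * signedPow a (z x) - c * x⁻¹) x := fun x hx =>
      (h x ⟨hr.1.trans_le hx.1, hx.2.trans_lt ht.2⟩).1.sub
        ((Real.hasDerivAt_log (hr.1.trans_le hx.1).ne').const_mul c)
    refine monotoneOn_of_deriv_nonneg (convex_Icc r t)
      (fun x hx => (hd x hx).continuousAt.continuousWithinAt)
      (fun x hx => (hd x (interior_subset hx)).differentiableAt.differentiableWithinAt)
      (fun x hx => ?_) (left_mem_Icc.2 hr.2) (right_mem_Icc.2 hr.2) hr.2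
    rw [(hd x (interior_subset hx)).deriv]
    have hx' := interior_subset hx
    have := hder x ⟨hr.1.trans_le hx'.1, hx'.2⟩
    rw [div_eq_mul_inv] at this; linarith
  -- Such an `r` makes `c (log t - log r)` larger than `2B`, the maximal oscillation of `U`.
  have hlog := (Real.tendsto_log_nhdsGT_zero.eventually_lt_atBot
    (-(2 * B) / c + Real.log t - 1)).and (Ioc_mem_nhdsGT ht.1)
  obtain ⟨r, hr1, hr2⟩ := hlog.exists
  have h1 := hmono r hr2
  have h2 := abs_le.1 (hU r ⟨hr2.1, hr2.2.trans_lt ht.2⟩)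
  have h3 := abs_le.1 (hU t ht)
  have h4 : c * (-(2 * B) / c + Real.log t - 1) = -(2 * B) + c * Real.log t - c := by
    field_simp
  have h5 := mul_lt_mul_of_pos_left hr1 hc
  linarith

lemma IsProfile.abs_le_of_bounded {k U z : ℝ → ℝ} (ha : -1 < a) (hq : 0 < q)
    (hsq : s ≤ q * (1 + a)) (hQ : IsDissipative q L C Q) (h : IsProfile a s Q k U z)
    {K B : ℝ} (hk : ∀ r ∈ Ioo (0 : ℝ) 1, |k r| ≤ K) (hU : ∀ r ∈ Ioo (0 : ℝ) 1, |U r| ≤ B)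
    (hC : 0 ≤ C) :
    ∀ r ∈ Ioo (0 : ℝ) 1, |z r| ≤ C * K / q := by
  intro r hr
  refine abs_le'.2 ⟨h.le_of_bounded ha hq hsq hQ hk hU hC r hr, ?_⟩
  exact h.reflect.le_of_bounded ha hq hsq hQ.reflect (K := K) (B := B) (by simpa using hk)
    (by simpa using hU) hC r hr

/-- Bounded solutions of `r z' = -Q(z, k)` are ordered like their right-hand sides. -/
lemma IsProfile.z_mono {k₁ U₁ z₁ k₂ U₂ z₂ : ℝ → ℝ} (hq : 0 < q)
    (hQ : IsDissipative q L C Q) (h₁ : IsProfile a s Q k₁ U₁ z₁) (h₂ : IsProfile a s Q k₂ U₂ z₂)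
    {Z t : ℝ} (hz₁ : ∀ r ∈ Ioo (0 : ℝ) 1, |z₁ r| ≤ Z) (hz₂ : ∀ r ∈ Ioo (0 : ℝ) 1, |z₂ r| ≤ Z)
    (ht : t ∈ Ioo (0 : ℝ) 1) (hk : ∀ r ∈ Ioc 0 t, k₂ r ≤ k₁ r) :
    z₂ t ≤ z₁ t := by
  by_contra! hlt
  set m := t ^ q * (z₂ t - z₁ t)
  have hm : 0 < m := mul_pos (Real.rpow_pos_of_pos ht.1 _) (by linarith)
  have hlow : ∀ r ∈ Ioc 0 t, m ≤ r ^ q * (z₂ r - z₁ r) := fun r hr =>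
    rpow_mul_le_of_dissipative (D := fun x => z₂ x - z₁ x)
      (D' := fun x => -(Q (z₂ x) (k₂ x) - Q (z₁ x) (k₁ x))) hr.1 hr.2
      (fun x hx => by
        have hx1 : x ∈ Ioo (0 : ℝ) 1 := ⟨hr.1.trans_le hx.1, hx.2.trans_lt ht.2⟩
        exact ((h₂ x hx1).2.fun_sub (h₁ x hx1).2).congr_deriv (by ring))
      (fun x hx hpos => by
        have := hQ.lower (z₁ x) (z₂ x) (k₂ x) (by linarith)
        have := hQ.anti (z₁ x) (hk x ⟨hr.1.trans_le hx.1, hx.2⟩)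
        linarith) (by linarith)
  -- Boundedness of both `z₁` and `z₂` acts as the initial condition: it makes `r^q (z₂ - z₁)` small
  -- at the origin, against the lower bound `m`.
  have hlim : Filter.Tendsto (fun r : ℝ => r ^ q * (2 * Z)) (𝓝[>] 0) (𝓝 0) := by
    have h1 : Filter.Tendsto (fun r : ℝ => r ^ q) (𝓝[>] 0) (𝓝 0) := by
      have := (Real.continuousAt_rpow_const 0 q (Or.inr hq.le)).tendsto
      rw [Real.zero_rpow hq.ne'] at this
      exact this.mono_left nhdsWithin_le_nhds
    simpa using h1.mul_const (2 * Z)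
  obtain ⟨r, hr1, hr2⟩ := ((hlim.eventually_lt_const hm).and (Ioc_mem_nhdsGT ht.1)).exists
  have hr3 : r ∈ Ioo (0 : ℝ) 1 := ⟨hr2.1, hr2.2.trans_lt ht.2⟩
  have h1 := abs_le.1 (hz₁ r hr3)
  have h2 := abs_le.1 (hz₂ r hr3)
  have h3 : r ^ q * (z₂ r - z₁ r) ≤ r ^ q * (2 * Z) :=
    mul_le_mul_of_nonneg_left (by linarith) (Real.rpow_nonneg hr2.1.le _)
  linarith [hlow r hr2]

/-- Maximum principle for bounded solutions of the radial equation. -/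
lemma IsProfile.le_of_le {k₁ U₁ z₁ k₂ U₂ z₂ : ℝ → ℝ} (ha : -1 < a) (hq : 0 < q)
    (hQ : IsDissipative q L C Q) (h₁ : IsProfile a s Q k₁ U₁ z₁) (h₂ : IsProfile a s Q k₂ U₂ z₂)
    {Z : ℝ} (hz₁ : ∀ r ∈ Ioo (0 : ℝ) 1, |z₁ r| ≤ Z) (hz₂ : ∀ r ∈ Ioo (0 : ℝ) 1, |z₂ r| ≤ Z)
    (hU₁ : ContinuousOn U₁ (Icc 0 1)) (hU₂ : ContinuousOn U₂ (Icc 0 1))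
    (hb : U₁ 1 ≤ U₂ 1) (hk : ∀ r ∈ Ioo (0 : ℝ) 1, U₂ r < U₁ r → k₂ r < k₁ r) :
    ∀ r ∈ Icc (0 : ℝ) 1, U₁ r ≤ U₂ r := by
  have hDc : ContinuousOn (fun r => U₁ r - U₂ r) (Icc 0 1) := hU₁.sub hU₂
  obtain ⟨r₀, hr₀, hmax⟩ := isCompact_Icc.exists_isMaxOn (nonempty_Icc.2 zero_le_one) hDc
  have hmax' : ∀ r ∈ Icc (0 : ℝ) 1, U₁ r - U₂ r ≤ U₁ r₀ - U₂ r₀ := fun r hr => hmax hr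
  by_contra! hcon
  obtain ⟨x, hx, hxlt⟩ := hcon
  have hpos : 0 < U₁ r₀ - U₂ r₀ := by linarith [hmax' x hx]
  have hr1 : r₀ < 1 := lt_of_le_of_ne hr₀.2 (by rintro rfl; linarith)
  have hD : ∀ r ∈ Ioo (0 : ℝ) 1, HasDerivAt (fun r => U₁ r - U₂ r)
      (r ^ (s - 1) * (signedPow a (z₁ r) - signedPow a (z₂ r))) r := fun r hr => by
    rw [mul_sub]; exact (h₁ r hr).1.sub (h₂ r hr).1
  -- At a positive interior maximum `U₁' = U₂'`, so `z₁ = z₂`, while `k₂ < k₁` gives `z₁' > z₂'`.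
  -- Then `z₁ > z₂` just to the right, where `U₁ - U₂` would strictly increase.
  have hinterior : ∀ t ∈ Ioo (0 : ℝ) 1, 0 < U₁ t - U₂ t →
      (∀ r ∈ Icc (0 : ℝ) 1, U₁ r - U₂ r ≤ U₁ t - U₂ t) → False := by
    intro t ht hpos hmax
    have hloc : IsLocalMax (fun r => U₁ r - U₂ r) t := by
      filter_upwards [Ioo_mem_nhds ht.1 ht.2] with r hr using hmax r (Ioo_subset_Icc_self hr)
    have hz0 := hloc.hasDerivAt_eq_zero (hD t ht)
    have hz : z₁ t = z₂ t := by
      refine (strictMono_signedPow ha).injective ?_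
      have := (mul_eq_zero.1 hz0).resolve_left (Real.rpow_pos_of_pos ht.1 _).ne'
      linarith
    have hdz := (h₁ t ht).2.fun_sub (h₂ t ht).2
    have hdzpos : 0 < -Q (z₁ t) (k₁ t) / t - -Q (z₂ t) (k₂ t) / t := by
      rw [← sub_div, hz]
      refine div_pos ?_ ht.1
      have := hQ.strict (z₂ t) _ _ (hk t ht (by linarith))
      linarith
    have hev : ∀ᶠ r in 𝓝[>] t, 0 < z₁ r - z₂ r := by
      have h1 := (hasDerivAt_iff_tendsto_slope.1 hdz).mono_left
        (nhdsWithin_mono t (fun y (hy : t < y) => hy.ne'))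
      filter_upwards [h1.eventually_const_lt hdzpos, self_mem_nhdsWithin] with r hr hrt
      rw [slope_def_field, hz, sub_self, sub_zero] at hr
      exact (div_pos_iff_of_pos_right (sub_pos.2 hrt)).1 hr
    obtain ⟨u, hu, hu'⟩ := (mem_nhdsGT_iff_exists_Ioo_subset).1 hev
    set v := min u 1
    have hv : t < v := lt_min hu ht.2
    set y := (t + v) / 2
    have hty : t < y := by simp only [y]; linarith
    have hyv : y < v := by simp only [y]; linarith
    have hlt := strictMonoOn_of_deriv_pos (convex_Icc t y)
      (f := fun r => U₁ r - U₂ r)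
      (fun r hr => (hD r ⟨ht.1.trans_le hr.1, hr.2.trans_lt
        (hyv.trans_le (min_le_right _ _))⟩).continuousAt.continuousWithinAt)
      (fun r hr => by
        rw [interior_Icc] at hr
        have hr' : r ∈ Ioo (0 : ℝ) 1 :=
          ⟨ht.1.trans hr.1, hr.2.trans (hyv.trans_le (min_le_right _ _))⟩
        rw [(hD r hr').deriv]
        refine mul_pos (Real.rpow_pos_of_pos hr'.1 _) (sub_pos.2 (strictMono_signedPow ha ?_))
        have : 0 < z₁ r - z₂ r := hu' ⟨hr.1, hr.2.trans (hyv.trans_le (min_le_left _ _))⟩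
        linarith)
      (left_mem_Icc.2 hty.le) (right_mem_Icc.2 hty.le) hty
    have := hmax y ⟨by linarith [ht.1], (hyv.trans_le (min_le_right _ _)).le⟩
    simp only at hlt
    linarith
  rcases hr₀.1.eq_or_lt with h0 | h0
  -- No derivative is available at `0`. Near it `U₂ < U₁`, so the data are ordered and
  -- `IsProfile.z_mono` gives `z₂ ≤ z₁`. Thus `U₁ - U₂` is nondecreasing there and its maximum is
  -- also attained at the interior point `t`.
  · subst h0
    have hev : ∀ᶠ r in 𝓝[Icc (0 : ℝ) 1] 0, 0 < U₁ r - U₂ r :=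
      (hDc 0 hr₀).eventually_const_lt hpos
    rw [eventually_nhdsWithin_iff, Metric.eventually_nhds_iff_ball] at hev
    obtain ⟨ε, hε, hball⟩ := hev
    set t := min (ε / 2) (1 / 2)
    have ht0 : 0 < t := lt_min (by linarith) (by norm_num)
    have ht1 : t < 1 := (min_le_right _ _).trans_lt (by norm_num)
    have htε : t < ε := (min_le_left _ _).trans_lt (by linarith)
    have hpos' : ∀ r ∈ Icc 0 t, 0 < U₁ r - U₂ r := fun r hr =>
      hball r (by rw [mem_ball, Real.dist_eq, sub_zero, abs_of_nonneg hr.1]; exact hr.2.trans_lt htε)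
        ⟨hr.1, hr.2.trans ht1.le⟩
    have hz : ∀ r ∈ Ioc 0 t, z₂ r ≤ z₁ r := fun r hr =>
      h₁.z_mono hq hQ h₂ hz₁ hz₂ ⟨hr.1, hr.2.trans_lt ht1⟩ fun x hx =>
        (hk x ⟨hx.1, (hx.2.trans hr.2).trans_lt ht1⟩ (by
          linarith [hpos' x ⟨hx.1.le, hx.2.trans hr.2⟩])).le
    have hmono : MonotoneOn (fun r => U₁ r - U₂ r) (Icc 0 t) := by
      refine monotoneOn_of_deriv_nonneg (convex_Icc 0 t)
        (hDc.mono (Icc_subset_Icc_right ht1.le)) (fun r hr => ?_) (fun r hr => ?_)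
      · rw [interior_Icc] at hr
        exact (hD r ⟨hr.1, hr.2.trans ht1⟩).differentiableAt.differentiableWithinAt
      · rw [interior_Icc] at hr
        rw [(hD r ⟨hr.1, hr.2.trans ht1⟩).deriv]
        exact mul_nonneg (Real.rpow_nonneg hr.1.le _) (sub_nonneg.2
          ((strictMono_signedPow ha).monotone (hz r ⟨hr.1, hr.2.le⟩)))
    have hge := hmono (left_mem_Icc.2 ht0.le) (right_mem_Icc.2 ht0.le) ht0.le
    simp only at hge
    exact hinterior t ⟨ht0, ht1⟩ (by linarith) fun r hr => (hmax' r hr).trans hge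
  · exact hinterior r₀ ⟨h0, hr1⟩ hpos hmax'

end

/-! ### Averages along rays -/

/-- Bounded measurable functions on the line, continuous on `(-∞, 1)`. -/
structure IsAdmissible (h : ℝ → ℝ) : Prop where
  measurable : Measurable h
  bounded : ∃ B, ∀ x, |h x| ≤ B
  continuousOn : ContinuousOn h (Iio 1)

/-- The weighted average `∫₀¹ (n+1) τⁿ h(r τ) dτ`. -/
def rayAverage (n : ℕ) (h : ℝ → ℝ) (r : ℝ) : ℝ :=
  ∫ τ in (0 : ℝ)..1, ((n + 1) * τ ^ n) * h (r * τ)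

lemma integral_rayWeight (n : ℕ) : ∫ τ in (0 : ℝ)..1, ((n + 1) * τ ^ n : ℝ) = 1 := by
  rw [intervalIntegral.integral_const_mul, integral_pow]
  have : (n : ℝ) + 1 ≠ 0 := by positivity
  simp [this]

lemma IsAdmissible.intervalIntegrable {h : ℝ → ℝ} (hh : IsAdmissible h) (n : ℕ) (r : ℝ) :
    IntervalIntegrable (fun τ : ℝ => ((n + 1) * τ ^ n) * h (r * τ)) MeasureTheory.volume 0 1 := by
  obtain ⟨B, hB⟩ := hh.bounded
  have h1 : IntervalIntegrable (fun τ : ℝ => ((n + 1) * τ ^ n : ℝ)) MeasureTheory.volume 0 1 :=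
    (by fun_prop : Continuous fun τ : ℝ => ((n + 1) * τ ^ n : ℝ)).intervalIntegrable _ _
  refine (h1.mul_const B).mono_fun' ?_ ?_
  · exact ((by fun_prop : Continuous fun τ : ℝ => ((n + 1) * τ ^ n : ℝ)).measurable.mul
      (hh.measurable.comp (measurable_const_mul r))).aestronglyMeasurable
  · rw [uIoc_of_le zero_le_one]
    filter_upwards [MeasureTheory.ae_restrict_mem measurableSet_Ioc] with τ hτ
    rw [norm_mul, Real.norm_eq_abs, Real.norm_eq_abs, abs_of_nonneg]
    · exact mul_le_mul_of_nonneg_left (hB _) (by have := hτ.1; positivity)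
    · have := hτ.1; positivity

lemma abs_rayAverage_le {h : ℝ → ℝ} {n : ℕ} {r D : ℝ} (hr : 0 ≤ r)
    (hD : ∀ ρ ∈ Icc 0 r, |h ρ| ≤ D) : |rayAverage n h r| ≤ D := by
  have h1 : IntervalIntegrable (fun τ : ℝ => ((n + 1) * τ ^ n) * D) MeasureTheory.volume 0 1 :=
    (by fun_prop : Continuous fun τ : ℝ => ((n + 1) * τ ^ n) * D).intervalIntegrable _ _
  have h2 := intervalIntegral.norm_integral_le_of_norm_le zero_le_one
    (f := fun τ : ℝ => ((n + 1) * τ ^ n) * h (r * τ)) (Filter.Eventually.of_forall fun τ hτ => by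
      have h0 : (0 : ℝ) ≤ (n + 1) * τ ^ n := by have := hτ.1; positivity
      rw [norm_mul, Real.norm_eq_abs, Real.norm_eq_abs, abs_of_nonneg h0]
      exact mul_le_mul_of_nonneg_left (hD _ ⟨mul_nonneg hr hτ.1.le,
        mul_le_of_le_one_right hr hτ.2⟩) h0) h1
  rwa [intervalIntegral.integral_mul_const, integral_rayWeight, one_mul] at h2

lemma abs_rayAverage_sub_le {h₁ h₂ : ℝ → ℝ} (hh₁ : IsAdmissible h₁) (hh₂ : IsAdmissible h₂)
    {n : ℕ} {r D : ℝ} (hr : 0 ≤ r) (hD : ∀ ρ ∈ Icc 0 r, |h₁ ρ - h₂ ρ| ≤ D) :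
    |rayAverage n h₁ r - rayAverage n h₂ r| ≤ D := by
  have : rayAverage n h₁ r - rayAverage n h₂ r = rayAverage n (fun ρ => h₁ ρ - h₂ ρ) r := by
    unfold rayAverage
    rw [← intervalIntegral.integral_sub (hh₁.intervalIntegrable n r) (hh₂.intervalIntegrable n r)]
    simp only [mul_sub]
  rw [this]
  exact abs_rayAverage_le hr hD

lemma rayAverage_congr {h₁ h₂ : ℝ → ℝ} {n : ℕ} {r : ℝ} (hr : 0 ≤ r)
    (h : ∀ ρ ∈ Icc 0 r, h₁ ρ = h₂ ρ) : rayAverage n h₁ r = rayAverage n h₂ r := by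
  refine intervalIntegral.integral_congr fun τ hτ => ?_
  rw [uIcc_of_le zero_le_one] at hτ
  rw [h _ ⟨mul_nonneg hr hτ.1, mul_le_of_le_one_right hr hτ.2⟩]

/-- The projection of the line onto `[0,1]`. -/
def clamp01 (r : ℝ) : ℝ := max 0 (min r 1)

lemma continuous_clamp01 : Continuous clamp01 := by unfold clamp01; fun_prop

lemma clamp01_mem (r : ℝ) : clamp01 r ∈ Icc (0 : ℝ) 1 :=
  ⟨le_max_left _ _, max_le zero_le_one (min_le_right _ _)⟩

lemma clamp01_of_mem {r : ℝ} (hr : r ∈ Icc (0 : ℝ) 1) : clamp01 r = r := by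
  rw [clamp01, min_eq_left hr.2, max_eq_right hr.1]

lemma IsAdmissible.continuous_rayAverage {h : ℝ → ℝ} (hh : IsAdmissible h) (n : ℕ) :
    Continuous fun r => rayAverage n h (clamp01 r) := by
  obtain ⟨B, hB⟩ := hh.bounded
  refine intervalIntegral.continuous_of_dominated_interval
    (bound := fun τ : ℝ => ((n + 1) * |τ| ^ n : ℝ) * B) (fun r => ?_) (fun r => ?_) ?_ ?_
  · exact ((by fun_prop : Continuous fun τ : ℝ => ((n + 1) * τ ^ n : ℝ)).measurable.mul
      (hh.measurable.comp (measurable_const_mul _))).aestronglyMeasurable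
  · refine Filter.Eventually.of_forall fun τ _ => ?_
    rw [norm_mul, norm_mul, norm_pow, Real.norm_eq_abs, Real.norm_eq_abs, Real.norm_eq_abs,
      abs_of_nonneg (by positivity : (0 : ℝ) ≤ n + 1)]
    exact mul_le_mul_of_nonneg_left (hB _) (by positivity)
  · exact (by fun_prop : Continuous fun τ : ℝ => ((n + 1) * |τ| ^ n : ℝ) * B).intervalIntegrable _ _
  -- The argument `r τ` can reach the possible discontinuity at `1` only when `τ = 1`, a null set.
  · have hne : ∀ᵐ τ : ℝ, τ ≠ 1 := by
      simp [MeasureTheory.ae_iff]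
    filter_upwards [hne] with τ hτ1 hτ
    rw [uIoc_of_le zero_le_one] at hτ
    refine continuous_const.mul (hh.continuousOn.comp_continuous
      (continuous_clamp01.mul continuous_const) fun r => ?_)
    have h1 := clamp01_mem r
    have h2 : τ < 1 := lt_of_le_of_ne hτ.2 hτ1
    exact (mul_le_of_le_one_left hτ.1.le h1.2).trans_lt h2

/-- This turns the integral equation `z = rayAverage n h` back into `r z' = (n+1)(h - z)`. The
average form selects the solution that is regular at the origin. -/
lemma IsAdmissible.hasDerivAt_rayAverage {h : ℝ → ℝ} (hh : IsAdmissible h) (n : ℕ) {r : ℝ}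
    (hr : r ∈ Ioo (0 : ℝ) 1) :
    HasDerivAt (rayAverage n h) ((n + 1) * (h r - rayAverage n h r) / r) r := by
  obtain ⟨B, hB⟩ := hh.bounded
  set g : ℝ → ℝ := fun ρ => ((n + 1) * ρ ^ n) * h ρ
  have hrep : ∀ x : ℝ, 0 < x → rayAverage n h x = (∫ ρ in (0 : ℝ)..x, g ρ) / x ^ (n + 1) := by
    intro x hx
    have h1 := intervalIntegral.mul_integral_comp_mul_left (a := 0) (b := 1) (f := g) x
    rw [mul_zero, mul_one] at h1
    rw [← h1, rayAverage, eq_div_iff (by positivity), pow_succ', mul_comm, mul_assoc]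
    congr 1
    rw [← intervalIntegral.integral_const_mul]
    refine intervalIntegral.integral_congr fun τ _ => ?_
    simp only [g, mul_pow]; ring
  have hgm : Measurable g :=
    (by fun_prop : Continuous fun τ : ℝ => ((n + 1) * τ ^ n : ℝ)).measurable.mul hh.measurable
  have hgc : ContinuousAt g r :=
    (by fun_prop : Continuous fun τ : ℝ => ((n + 1) * τ ^ n : ℝ)).continuousAt.mul
      (hh.continuousOn.continuousAt (Iio_mem_nhds hr.2))
  have hgi : IntervalIntegrable g MeasureTheory.volume 0 r := by
    have h1 : IntervalIntegrable (fun τ : ℝ => |((n + 1) * τ ^ n : ℝ)| * B)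
        MeasureTheory.volume 0 r :=
      (by fun_prop : Continuous fun τ : ℝ => |((n + 1) * τ ^ n : ℝ)| * B).intervalIntegrable _ _
    refine h1.mono_fun' hgm.aestronglyMeasurable (Filter.Eventually.of_forall fun τ => ?_)
    change |((n + 1) * τ ^ n) * h τ| ≤ |(n + 1) * τ ^ n| * B
    rw [abs_mul]
    exact mul_le_mul_of_nonneg_left (hB _) (abs_nonneg _)
  have hI := intervalIntegral.integral_hasDerivAt_right hgi
    hgm.stronglyMeasurable.stronglyMeasurableAtFilter hgc
  have hr0 : r ≠ 0 := hr.1.ne'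
  have h2 := hI.div (hasDerivAt_pow (n + 1) r) (pow_ne_zero _ hr0)
  have h3 : HasDerivAt (rayAverage n h) _ r := h2.congr_of_eventuallyEq (by
    filter_upwards [lt_mem_nhds hr.1] with x hx using hrep x hx)
  refine h3.congr_deriv ?_
  rw [hrep r hr.1]
  simp only [g, add_tsub_cancel_right]
  push_cast
  field_simp
  ring

/-! ### The problem with Lipschitz nonlinearities -/

/-- `(U, z)` solves `U' = ψ(z)` and the integral form of
`r z' = (n+1) (R(z, S(U) + f) - z)` on `[0,1]`. -/
structure IsIntegralSolution (n : ℕ) (R : ℝ → ℝ → ℝ) (ψ S f U z : ℝ → ℝ) : Prop where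
  continuous : Continuous z
  bounded : ∃ B, ∀ x, |z x| ≤ B
  eq_average : ∀ r ∈ Icc (0 : ℝ) 1,
    z r = rayAverage n (fun ρ => R (z ρ) (S (U ρ) + f ρ)) r
  hasDerivAt : ∀ r, HasDerivAt U (ψ (z r)) r

lemma continuous_uncurry_of_lip {R : ℝ → ℝ → ℝ} {θ C : ℝ}
    (hR : ∀ z z' k k', |R z k - R z' k'| ≤ θ * |z - z'| + C * |k - k'|) :
    Continuous fun p : ℝ × ℝ => R p.1 p.2 := by
  rw [continuous_iff_continuousAt]
  rintro ⟨z, k⟩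
  rw [ContinuousAt, tendsto_iff_norm_sub_tendsto_zero]
  have h : Filter.Tendsto (fun p : ℝ × ℝ => θ * |p.1 - z| + C * |p.2 - k|) (𝓝 (z, k)) (𝓝 0) := by
    have : Continuous fun p : ℝ × ℝ => θ * |p.1 - z| + C * |p.2 - k| := by fun_prop
    simpa using this.tendsto (z, k)
  exact squeeze_zero (fun _ => norm_nonneg _) (fun p => hR _ _ _ _) h

lemma isAdmissible_comp {R : ℝ → ℝ → ℝ} {θ C : ℝ} (hC : 0 ≤ C) (hθ : 0 ≤ θ)
    (hR : ∀ z z' k k', |R z k - R z' k'| ≤ θ * |z - z'| + C * |k - k'|) {z k : ℝ → ℝ}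
    (hz : Continuous z) (hzB : ∃ B, ∀ x, |z x| ≤ B) (hk : IsAdmissible k) :
    IsAdmissible fun ρ => R (z ρ) (k ρ) := by
  have hRc := continuous_uncurry_of_lip hR
  refine ⟨hRc.measurable.comp (hz.measurable.prodMk hk.measurable), ?_, ?_⟩
  · obtain ⟨B, hB⟩ := hzB
    obtain ⟨B', hB'⟩ := hk.bounded
    refine ⟨θ * B + C * B' + |R 0 0|, fun x => ?_⟩
    have h1 := hR (z x) 0 (k x) 0
    rw [sub_zero, sub_zero] at h1
    have h2 := mul_le_mul_of_nonneg_left (hB x) hθ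
    have h3 := mul_le_mul_of_nonneg_left (hB' x) hC
    have h4 := abs_sub_abs_le_abs_sub (R (z x) (k x)) (R 0 0)
    linarith
  · exact hRc.comp_continuousOn (hz.continuousOn.prodMk hk.continuousOn)

lemma IsAdmissible.add_comp {f S U : ℝ → ℝ} (hf : IsAdmissible f) (hS : Continuous S)
    (hSB : ∃ B, ∀ x, |S x| ≤ B) (hU : Continuous U) : IsAdmissible fun ρ => S (U ρ) + f ρ := by
  refine ⟨(hS.comp hU).measurable.add hf.measurable, ?_, (hS.comp hU).continuousOn.add hf.continuousOn⟩
  obtain ⟨B, hB⟩ := hSB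
  obtain ⟨B', hB'⟩ := hf.bounded
  exact ⟨B + B', fun x => (abs_add_le _ _).trans (add_le_add (hB _) (hB' _))⟩

/-- Undoing the exponential weight. -/
def unweight (K : ℝ) (y : BoundedContinuousFunction ℝ ℝ) (ρ : ℝ) : ℝ :=
  Real.exp (K * clamp01 ρ) * y ρ

lemma continuous_unweight (K : ℝ) (y : BoundedContinuousFunction ℝ ℝ) :
    Continuous (unweight K y) := by
  have := continuous_clamp01
  unfold unweight; fun_prop

lemma abs_unweight_le {K : ℝ} (hK : 0 ≤ K) (y : BoundedContinuousFunction ℝ ℝ) (ρ : ℝ) :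
    |unweight K y ρ| ≤ Real.exp K * ‖y‖ := by
  rw [unweight, abs_mul, abs_of_pos (Real.exp_pos _)]
  exact mul_le_mul (Real.exp_le_exp.2 (mul_le_of_le_one_right hK (clamp01_mem ρ).2))
    (y.norm_coe_le_norm ρ) (abs_nonneg _) (Real.exp_pos _).le

lemma abs_unweight_sub_le (K : ℝ) (y y' : BoundedContinuousFunction ℝ ℝ) {ρ : ℝ}
    (hρ : ρ ∈ Icc (0 : ℝ) 1) :
    |unweight K y ρ - unweight K y' ρ| ≤ Real.exp (K * ρ) * dist y y' := by
  rw [unweight, unweight, ← mul_sub, abs_mul, abs_of_pos (Real.exp_pos _), clamp01_of_mem hρ]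
  exact mul_le_mul_of_nonneg_left (BoundedContinuousFunction.dist_coe_le_dist (f := y) (g := y') ρ)
    (Real.exp_pos _).le

/-- The primitive `a + ∫₀ʳ ψ(z)`. -/
def primitiveFrom (ψ : ℝ → ℝ) (a : ℝ) (z : ℝ → ℝ) (r : ℝ) : ℝ := a + ∫ ρ in (0 : ℝ)..r, ψ (z ρ)

lemma hasDerivAt_primitiveFrom {ψ z : ℝ → ℝ} (hψ : Continuous ψ) (hz : Continuous z) (a r : ℝ) :
    HasDerivAt (primitiveFrom ψ a z) (ψ (z r)) r :=
  ((hψ.comp hz).integral_hasStrictDerivAt 0 r).hasDerivAt.const_add a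

lemma continuous_primitiveFrom {ψ z : ℝ → ℝ} (hψ : Continuous ψ) (hz : Continuous z) (a : ℝ) :
    Continuous (primitiveFrom ψ a z) :=
  continuous_iff_continuousAt.2 fun r => (hasDerivAt_primitiveFrom hψ hz a r).continuousAt

/-- The integral of `e^{Kρ}` over `[0, r]` is at most `e^{Kr} / K`. In the weighted norm,
integration therefore gains the small factor `1 / K`. -/
lemma abs_primitiveFrom_sub_le {ψ z z' : ℝ → ℝ} {P : NNReal} (hψ : LipschitzWith P ψ)
    (hz : Continuous z) (hz' : Continuous z') {a a' r K D : ℝ} (hK : 0 < K) (hr : 0 ≤ r)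
    (hD : 0 ≤ D) (h : ∀ ρ ∈ Icc 0 r, |z ρ - z' ρ| ≤ Real.exp (K * ρ) * D) :
    |primitiveFrom ψ a z r - primitiveFrom ψ a' z' r| ≤
      |a - a'| + P * D / K * Real.exp (K * r) := by
  have hi : ∀ z : ℝ → ℝ, Continuous z → IntervalIntegrable (fun ρ => ψ (z ρ))
      MeasureTheory.volume 0 r := fun z hz => (hψ.continuous.comp hz).intervalIntegrable _ _
  have h1 : primitiveFrom ψ a z r - primitiveFrom ψ a' z' r =
      (a - a') + ∫ ρ in (0 : ℝ)..r, (ψ (z ρ) - ψ (z' ρ)) := by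
    rw [intervalIntegral.integral_sub (hi z hz) (hi z' hz'), primitiveFrom, primitiveFrom]; ring
  rw [h1]
  refine (abs_add_le _ _).trans (add_le_add le_rfl ?_)
  have h2 := intervalIntegral.norm_integral_le_of_norm_le (μ := MeasureTheory.volume) hr
    (f := fun ρ => ψ (z ρ) - ψ (z' ρ)) (g := fun ρ => (P * D) * Real.exp (K * ρ))
    (Filter.Eventually.of_forall fun ρ hρ => by
      have h3 := hψ.dist_le_mul (z ρ) (z' ρ)
      rw [Real.dist_eq, Real.dist_eq] at h3
      refine h3.trans ?_
      have := mul_le_mul_of_nonneg_left (h ρ (Ioc_subset_Icc_self hρ)) P.2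
      simp only [NNReal.val_eq_coe] at this
      linarith)
    ((by fun_prop : Continuous fun ρ : ℝ => (P * D : ℝ) * Real.exp (K * ρ)).intervalIntegrable _ _)
  refine h2.trans ?_
  rw [intervalIntegral.integral_const_mul, intervalIntegral.integral_comp_mul_left _ hK.ne',
    integral_exp, mul_zero, Real.exp_zero, smul_eq_mul]
  have h4 : 0 ≤ P * D / K := div_nonneg (mul_nonneg P.2 hD) hK.le
  calc P * D * (K⁻¹ * (Real.exp (K * r) - 1)) = P * D / K * (Real.exp (K * r) - 1) := by
        rw [div_eq_mul_inv]; ring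
    _ ≤ _ := mul_le_mul_of_nonneg_left (by linarith) h4

section
variable {n : ℕ} {R : ℝ → ℝ → ℝ} {θ C : ℝ} {ψ S f : ℝ → ℝ}

/-- The integrand of the fixed point problem. -/
def weightedIntegrand (R : ℝ → ℝ → ℝ) (ψ S f : ℝ → ℝ) (K a : ℝ)
    (y : BoundedContinuousFunction ℝ ℝ) (ρ : ℝ) : ℝ :=
  R (unweight K y ρ) (S (primitiveFrom ψ a (unweight K y) ρ) + f ρ)

lemma isAdmissible_weightedIntegrand (hC : 0 ≤ C) (hθ : 0 ≤ θ)
    (hR : ∀ z z' k k', |R z k - R z' k'| ≤ θ * |z - z'| + C * |k - k'|)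
    (hψ : Continuous ψ) (hS : Continuous S) (hSB : ∃ B, ∀ x, |S x| ≤ B) (hf : IsAdmissible f)
    {K : ℝ} (hK : 0 ≤ K) (a : ℝ) (y : BoundedContinuousFunction ℝ ℝ) :
    IsAdmissible (weightedIntegrand R ψ S f K a y) :=
  isAdmissible_comp hC hθ hR (continuous_unweight K y) ⟨_, abs_unweight_le hK y⟩
    (hf.add_comp hS hSB (continuous_primitiveFrom hψ (continuous_unweight K y) a))

/-- The direct dependence on `z` costs `θ`, which no weight improves; the dependence through `U` is
an integral and costs only `C P² / K`. -/
lemma abs_weightedIntegrand_sub_le (hC : 0 ≤ C) (hθ : 0 ≤ θ)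
    (hR : ∀ z z' k k', |R z k - R z' k'| ≤ θ * |z - z'| + C * |k - k'|)
    {P : NNReal} (hψ : LipschitzWith P ψ) (hS : LipschitzWith P S) {K : ℝ} (hK : 0 < K)
    (a a' : ℝ) (y y' : BoundedContinuousFunction ℝ ℝ) {ρ : ℝ} (hρ : ρ ∈ Icc (0 : ℝ) 1) :
    |weightedIntegrand R ψ S f K a y ρ - weightedIntegrand R ψ S f K a' y' ρ| ≤
      C * P * |a - a'| + (θ + C * P * P / K) * dist y y' * Real.exp (K * ρ) := by
  refine (hR _ _ _ _).trans ?_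
  have h1 := mul_le_mul_of_nonneg_left (abs_unweight_sub_le K y y' hρ) hθ
  have h2 := abs_primitiveFrom_sub_le hψ (continuous_unweight K y) (continuous_unweight K y')
    (a := a) (a' := a') hK hρ.1 dist_nonneg
    (fun x hx => abs_unweight_sub_le K y y' ⟨hx.1, hx.2.trans hρ.2⟩)
  have h3 := hS.dist_le_mul (primitiveFrom ψ a (unweight K y) ρ)
    (primitiveFrom ψ a' (unweight K y') ρ)
  rw [Real.dist_eq, Real.dist_eq] at h3
  rw [add_sub_add_right_eq_sub]
  have h4 := mul_le_mul_of_nonneg_left (h3.trans (mul_le_mul_of_nonneg_left h2 P.2)) hC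
  refine (add_le_add h1 h4).trans (le_of_eq ?_)
  ring

/-- The weighted fixed point map. -/
def weightedMap (n : ℕ) {h : ℝ → ℝ} (K : ℝ) (hK : 0 ≤ K) (hh : IsAdmissible h) :
    BoundedContinuousFunction ℝ ℝ :=
  BoundedContinuousFunction.ofNormedAddCommGroup
    (fun r => Real.exp (-(K * clamp01 r)) * rayAverage n h (clamp01 r))
    ((Real.continuous_exp.comp (continuous_const.mul continuous_clamp01).neg).mul
      (hh.continuous_rayAverage n))
    (Classical.choose hh.bounded) (fun r => by
      have h1 := abs_rayAverage_le (n := n) (clamp01_mem r).1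
        (fun ρ _ => Classical.choose_spec hh.bounded ρ)
      rw [norm_mul, Real.norm_eq_abs, Real.norm_eq_abs, abs_of_pos (Real.exp_pos _)]
      refine (mul_le_of_le_one_left (abs_nonneg _) ?_).trans h1
      rw [Real.exp_le_one_iff]
      have := mul_nonneg hK (clamp01_mem r).1
      linarith)

/-- Solvability of the boundary value problem for Lipschitz nonlinearities, by shooting from the
origin. -/
lemma exists_integralSolution_of_lipschitz (n : ℕ) (hC : 0 ≤ C) (hθ : 0 ≤ θ) (hθ1 : θ < 1)
    (hR : ∀ z z' k k', |R z k - R z' k'| ≤ θ * |z - z'| + C * |k - k'|)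
    {P : NNReal} (hψ : LipschitzWith P ψ) (hS : LipschitzWith P S)
    {B : ℝ} (hψB : ∀ x, |ψ x| ≤ B) (hSB : ∃ B, ∀ x, |S x| ≤ B) (hf : IsAdmissible f) (b : ℝ) :
    ∃ U z, IsIntegralSolution n R ψ S f U z ∧ U 1 = b := by
  -- A large `K` absorbs the integral term into the gap `1 - θ`.
  obtain ⟨K, hK, hK1⟩ : ∃ K : ℝ, 0 < K ∧ θ + C * P * P / K < 1 := by
    have h0 : 0 ≤ C * P * P := by positivity
    refine ⟨(C * P * P + 1) / (1 - θ), div_pos (by linarith) (by linarith), ?_⟩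
    have h1 : 0 < 1 - θ := by linarith
    have : C * P * P / ((C * P * P + 1) / (1 - θ)) < 1 - θ := by
      rw [div_div_eq_mul_div, div_lt_iff₀ (by linarith)]
      nlinarith
    linarith
  set η := θ + C * P * P / K
  have hη : 0 ≤ η := by positivity
  have hadm := fun a y => isAdmissible_weightedIntegrand hC hθ hR hψ.continuous hS.continuous hSB
    hf hK.le a y
  let T : ℝ → BoundedContinuousFunction ℝ ℝ → BoundedContinuousFunction ℝ ℝ := fun a y =>
    weightedMap n K hK.le (hadm a y)
  have hT : ∀ a a' y y', dist (T a y) (T a' y') ≤ C * P * |a - a'| + η * dist y y' := by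
    intro a a' y y'
    refine (BoundedContinuousFunction.dist_le (by positivity)).2 fun r => ?_
    have hc := clamp01_mem r
    have h1 := abs_rayAverage_sub_le (n := n) (hadm a y) (hadm a' y') hc.1
      (D := (C * P * |a - a'| + η * dist y y') * Real.exp (K * clamp01 r)) (fun ρ hρ => by
        refine (abs_weightedIntegrand_sub_le hC hθ hR hψ hS hK a a' y y'
          ⟨hρ.1, hρ.2.trans hc.2⟩).trans ?_
        have h2 : Real.exp (K * ρ) ≤ Real.exp (K * clamp01 r) :=
          Real.exp_le_exp.2 (mul_le_mul_of_nonneg_left hρ.2 hK.le)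
        have h3 : 1 ≤ Real.exp (K * clamp01 r) := Real.one_le_exp (mul_nonneg hK.le hc.1)
        have h4 := mul_le_mul_of_nonneg_left h2 (mul_nonneg hη (dist_nonneg (x := y) (y := y')))
        have h5 := mul_le_mul_of_nonneg_left h3
          (by positivity : 0 ≤ C * P * |a - a'|)
        linarith)
    change dist (Real.exp (-(K * clamp01 r)) * _) (Real.exp (-(K * clamp01 r)) * _) ≤ _
    rw [Real.dist_eq, ← mul_sub, abs_mul, abs_of_pos (Real.exp_pos _)]
    refine (mul_le_mul_of_nonneg_left h1 (Real.exp_pos _).le).trans (le_of_eq ?_)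
    rw [mul_comm, mul_assoc, ← Real.exp_add, add_neg_cancel, Real.exp_zero, mul_one]
  have hcontr : ∀ a, ContractingWith ⟨η, hη⟩ (T a) := fun a =>
    ⟨by exact_mod_cast hK1, LipschitzWith.of_dist_le_mul fun y y' => by
      have := hT a a y y'
      rwa [sub_self, abs_zero, mul_zero, zero_add] at this⟩
  let y : ℝ → BoundedContinuousFunction ℝ ℝ := fun a => (hcontr a).fixedPoint (T a)
  have hy : ∀ a, T a (y a) = y a := fun a => (hcontr a).fixedPoint_isFixedPt
  -- The contraction constant is uniform in the shooting parameter `a`, so the fixed points depend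
  -- on it in a Lipschitz way.
  have hyl : ∀ a a', dist (y a) (y a') ≤ C * P * |a - a'| / (1 - η) := fun a a' =>
    (hcontr a).fixedPoint_lipschitz_in_map (hcontr a') fun w => by
      simpa using hT a a' w w
  -- The shooting map sends `U 0 = a` to `U 1`. It is continuous and stays within `B` of the
  -- identity, so it is onto by the intermediate value theorem.
  let g : ℝ → ℝ := fun a => primitiveFrom ψ a (unweight K (y a)) 1
  have hg : Continuous g := by
    rw [continuous_iff_continuousAt]
    intro a
    rw [ContinuousAt, tendsto_iff_norm_sub_tendsto_zero]
    have hlim : Filter.Tendsto (fun a' => |a' - a| + P * (C * P * |a' - a| / (1 - η)) / K *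
        Real.exp (K * 1)) (𝓝 a) (𝓝 0) := by
      have : Continuous fun a' => |a' - a| + P * (C * P * |a' - a| / (1 - η)) / K *
        Real.exp (K * 1) := by fun_prop
      simpa using this.tendsto a
    refine squeeze_zero (fun _ => norm_nonneg _) (fun a' => ?_) hlim
    refine abs_primitiveFrom_sub_le hψ (continuous_unweight K _) (continuous_unweight K _) hK
      zero_le_one (div_nonneg (by positivity) (by linarith)) fun ρ hρ => ?_
    exact (abs_unweight_sub_le K _ _ hρ).trans
      (mul_le_mul_of_nonneg_left (hyl a' a) (Real.exp_pos _).le)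
  have hgB : ∀ a, |g a - a| ≤ B := fun a => by
    have := intervalIntegral.norm_integral_le_of_norm_le_const (a := 0) (b := 1) (C := B)
      (f := fun ρ => ψ (unweight K (y a) ρ)) (fun ρ _ => hψB _)
    simpa [g, primitiveFrom] using this
  obtain ⟨a, ha⟩ : b ∈ range g := mem_range_of_exists_le_of_exists_ge hg
    ⟨b - B, by linarith [(abs_le.1 (hgB (b - B))).2]⟩
    ⟨b + B, by linarith [(abs_le.1 (hgB (b + B))).1]⟩
  refine ⟨primitiveFrom ψ a (unweight K (y a)), unweight K (y a),
    ⟨continuous_unweight K _, ⟨_, abs_unweight_le hK.le _⟩, fun r hr => ?_,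
    fun r => hasDerivAt_primitiveFrom hψ.continuous (continuous_unweight K _) a r⟩, ha⟩
  have h1 : y a r = Real.exp (-(K * clamp01 r)) *
      rayAverage n (weightedIntegrand R ψ S f K a (y a)) (clamp01 r) := by
    conv_lhs => rw [← hy a]
    rfl
  rw [clamp01_of_mem hr] at h1
  rw [unweight, h1, clamp01_of_mem hr, ← mul_assoc, ← Real.exp_add, add_neg_cancel, Real.exp_zero,
    one_mul]
  rfl

end

/-! ### Passage to the limit -/

/-- Forward means over `[x, x + δ]` keep the bound `B`, have derivative at most `2B / δ` in absolute
value, and differ from `g` by at most its oscillation at scale `δ`. -/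
lemma exists_lipschitz_approx {g : ℝ → ℝ} (hg : UniformContinuous g) {B : ℝ}
    (hB : ∀ x, |g x| ≤ B) {ε : ℝ} (hε : 0 < ε) :
    ∃ (P : NNReal) (g' : ℝ → ℝ), LipschitzWith P g' ∧ (∀ x, |g' x| ≤ B) ∧
      ∀ x, |g' x - g x| ≤ ε := by
  obtain ⟨δ₀, hδ₀, hδε⟩ := Metric.uniformContinuous_iff.1 hg ε hε
  set δ := δ₀ / 2
  have hδ : 0 < δ := by positivity
  have hδδ : δ < δ₀ := by simp only [δ]; linarith
  have hgc := hg.continuous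
  have hgi : ∀ x y, IntervalIntegrable g MeasureTheory.volume x y :=
    fun x y => hgc.intervalIntegrable _ _
  have hrep : ∀ x, ∫ t in x..x + δ, g t = (∫ t in (0 : ℝ)..x + δ, g t) - ∫ t in (0 : ℝ)..x, g t :=
    fun x => (intervalIntegral.integral_interval_sub_left (hgi _ _) (hgi _ _)).symm
  have hder : ∀ x, HasDerivAt (fun x => δ⁻¹ * ∫ t in x..x + δ, g t)
      (δ⁻¹ * (g (x + δ) - g x)) x := fun x => by
    simp only [hrep]
    exact (((hgc.integral_hasStrictDerivAt 0 (x + δ)).hasDerivAt.comp_add_const x δ).sub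
      (hgc.integral_hasStrictDerivAt 0 x).hasDerivAt).const_mul _
  have hB0 : 0 ≤ B := (abs_nonneg _).trans (hB 0)
  refine ⟨Real.toNNReal (δ⁻¹ * (B + B)), fun x => δ⁻¹ * ∫ t in x..x + δ, g t, ?_, fun x => ?_,
    fun x => ?_⟩
  · refine lipschitzWith_of_nnnorm_deriv_le (fun x => (hder x).differentiableAt) fun x => ?_
    rw [← NNReal.coe_le_coe, coe_nnnorm, (hder x).deriv, norm_mul, Real.norm_eq_abs,
      Real.coe_toNNReal _ (by positivity), abs_of_pos (inv_pos.2 hδ)]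
    exact mul_le_mul_of_nonneg_left ((abs_sub _ _).trans (add_le_add (hB _) (hB _)))
      (inv_pos.2 hδ).le
  · have h1 := intervalIntegral.norm_integral_le_of_norm_le_const (a := x) (b := x + δ) (f := g)
      (fun t _ => hB t)
    rw [add_sub_cancel_left, abs_of_pos hδ, Real.norm_eq_abs] at h1
    rw [abs_mul, abs_of_pos (inv_pos.2 hδ), inv_mul_le_iff₀ hδ, mul_comm]
    exact h1
  · have h1 := intervalIntegral.norm_integral_le_of_norm_le_const (a := x) (b := x + δ)
      (f := fun t => g t - g x) (C := ε) (fun t ht => by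
        rw [uIoc_of_le (by linarith)] at ht
        refine (hδε (a := t) (b := x) ?_).le
        rw [Real.dist_eq, abs_of_nonneg (by linarith [ht.1])]
        linarith [ht.2])
    rw [intervalIntegral.integral_sub (hgi _ _) intervalIntegrable_const,
      intervalIntegral.integral_const, add_sub_cancel_left, abs_of_pos hδ, Real.norm_eq_abs,
      smul_eq_mul] at h1
    rw [show δ⁻¹ * (∫ t in x..x + δ, g t) - g x = δ⁻¹ * ((∫ t in x..x + δ, g t) - δ * g x) by
      field_simp, abs_mul, abs_of_pos (inv_pos.2 hδ), inv_mul_le_iff₀ hδ, mul_comm δ ε]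
    exact h1

section
variable {n : ℕ} {R : ℝ → ℝ → ℝ} {θ C : ℝ}

/-- At a maximum point of `|z - z'|` on `[0, 1]` the averaged equations give `max ≤ θ max + C e`.
This yields both stability under perturbation of the data and, by comparison with the zero solution,
an a priori bound on `z`. -/
lemma abs_average_sub_le (hC : 0 ≤ C) (hθ : 0 ≤ θ) (hθ1 : θ < 1)
    (hR : ∀ z z' k k', |R z k - R z' k'| ≤ θ * |z - z'| + C * |k - k'|) {z z' k k' : ℝ → ℝ}
    (hz : Continuous z) (hz' : Continuous z') (hzB : ∃ B, ∀ x, |z x| ≤ B)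
    (hzB' : ∃ B, ∀ x, |z' x| ≤ B) (hk : IsAdmissible k) (hk' : IsAdmissible k')
    (h : ∀ r ∈ Icc (0 : ℝ) 1, z r = rayAverage n (fun ρ => R (z ρ) (k ρ)) r)
    (h' : ∀ r ∈ Icc (0 : ℝ) 1, z' r = rayAverage n (fun ρ => R (z' ρ) (k' ρ)) r)
    {e : ℝ} (he : ∀ r ∈ Icc (0 : ℝ) 1, |k r - k' r| ≤ e) :
    ∀ r ∈ Icc (0 : ℝ) 1, |z r - z' r| ≤ C * e / (1 - θ) := by
  obtain ⟨r₀, hr₀, hmax⟩ := isCompact_Icc.exists_isMaxOn (nonempty_Icc.2 (zero_le_one' ℝ))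
    (hz.sub hz').abs.continuousOn
  have hmax' : ∀ r ∈ Icc (0 : ℝ) 1, |z r - z' r| ≤ |z r₀ - z' r₀| := fun r hr => hmax hr
  have h1 : |z r₀ - z' r₀| ≤ θ * |z r₀ - z' r₀| + C * e := by
    conv_lhs => rw [h r₀ hr₀, h' r₀ hr₀]
    refine abs_rayAverage_sub_le (isAdmissible_comp hC hθ hR hz hzB hk)
      (isAdmissible_comp hC hθ hR hz' hzB' hk') hr₀.1 fun ρ hρ => ?_
    have hρ' : ρ ∈ Icc (0 : ℝ) 1 := ⟨hρ.1, hρ.2.trans hr₀.2⟩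
    exact (hR _ _ _ _).trans (add_le_add (mul_le_mul_of_nonneg_left (hmax' ρ hρ') hθ)
      (mul_le_mul_of_nonneg_left (he ρ hρ') hC))
  intro r hr
  refine (hmax' r hr).trans ?_
  rw [le_div_iff₀ (by linarith)]
  linarith

/-- Solvability of the boundary value problem for uniformly continuous bounded nonlinearities. -/
lemma exists_integralSolution (n : ℕ) (hC : 0 ≤ C) (hθ : 0 ≤ θ) (hθ1 : θ < 1)
    (hR : ∀ z z' k k', |R z k - R z' k'| ≤ θ * |z - z'| + C * |k - k'|) {ψ S f : ℝ → ℝ}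
    (hψ : UniformContinuous ψ) (hS : UniformContinuous S)
    (hψB : ∃ B, ∀ x, |ψ x| ≤ B) (hSB : ∃ B, ∀ x, |S x| ≤ B) (hf : IsAdmissible f) (b : ℝ) :
    ∃ U z, IsIntegralSolution n R ψ S f U z ∧ U 1 = b := by
  obtain ⟨B, hB⟩ : ∃ B : NNReal, ∀ x, |ψ x| ≤ B := by
    obtain ⟨B, hB⟩ := hψB
    exact ⟨B.toNNReal, fun x => (hB x).trans (Real.le_coe_toNNReal B)⟩
  obtain ⟨B', hB'⟩ := hSB
  have hB0 : 0 ≤ (B : ℝ) := B.2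
  have hε : ∀ m : ℕ, 0 < 1 / ((m : ℝ) + 1) := fun m => by positivity
  choose P ψ' hψ'l hψ'B hψ' using fun m : ℕ => exists_lipschitz_approx hψ hB (hε m)
  choose P' S' hS'l hS'B hS' using fun m : ℕ => exists_lipschitz_approx hS hB' (hε m)
  have hex : ∀ m : ℕ, ∃ U z, IsIntegralSolution n R (ψ' m) (S' m) f U z ∧ U 1 = b := fun m =>
    exists_integralSolution_of_lipschitz n hC hθ hθ1 hR ((hψ'l m).weaken (le_max_left _ (P' m)))
      ((hS'l m).weaken (le_max_right (P m) _)) (hψ'B m) ⟨_, hS'B m⟩ hf b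
  choose V y hVy hVb using hex
  have hVl : ∀ m, LipschitzWith B (V m) := fun m =>
    lipschitzWith_of_nnnorm_deriv_le (fun x => ((hVy m).hasDerivAt x).differentiableAt) fun x => by
      rw [← NNReal.coe_le_coe, coe_nnnorm, ((hVy m).hasDerivAt x).deriv]
      exact hψ'B m _
  have hVc : ∀ m, Continuous (V m) := fun m => (hVl m).continuous
  -- The bound on the `ψ' m` is uniform even though their Lipschitz constants are not, so the `V m`
  -- are equi-Lipschitz with a common value at `1`, and Arzelà–Ascoli applies.
  let A : Set (BoundedContinuousFunction (Icc (0 : ℝ) 1) ℝ) :=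
    {g | LipschitzWith B g ∧ g ⟨1, right_mem_Icc.2 zero_le_one⟩ = b}
  let W : ℕ → BoundedContinuousFunction (Icc (0 : ℝ) 1) ℝ := fun m =>
    BoundedContinuousFunction.mkOfCompact ⟨fun x => V m x, (hVc m).comp continuous_subtype_val⟩
  have hWA : ∀ m, W m ∈ A := fun m => ⟨by
    have := (hVl m).comp (LipschitzWith.subtype_val (Icc (0 : ℝ) 1))
    rw [mul_one] at this
    exact this, hVb m⟩
  have hcomp : IsCompact (closure A) := by
    refine BoundedContinuousFunction.arzela_ascoli (closedBall b B) (isCompact_closedBall b B) A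
      (fun g x hg => ?_) ?_
    · have h1 := hg.1.dist_le_mul x ⟨1, right_mem_Icc.2 zero_le_one⟩
      rw [hg.2] at h1
      refine mem_closedBall.2 (h1.trans (mul_le_of_le_one_right hB0 ?_))
      rw [Subtype.dist_eq, Real.dist_eq, abs_sub_comm, abs_of_nonneg (by linarith [x.2.2])]
      linarith [x.2.1]
    · exact (LipschitzWith.uniformEquicontinuous (fun g : A => ((g : _) : Icc (0 : ℝ) 1 → ℝ))
        B (fun g => g.2.1)).equicontinuous
  obtain ⟨g, -, φ, hφ, hlim⟩ := hcomp.tendsto_subseq (fun m => subset_closure (hWA m))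
  let U₀ : ℝ → ℝ := fun r => g (projIcc 0 1 zero_le_one r)
  have hU₀ : Continuous U₀ := g.continuous.comp continuous_projIcc
  have hVlim : ∀ ε > 0, ∀ᶠ m in Filter.atTop, ∀ r ∈ Icc (0 : ℝ) 1, |V (φ m) r - U₀ r| < ε := by
    intro ε hε
    filter_upwards [(Metric.tendsto_nhds.1 hlim) ε hε] with m hm r hr
    have h1 := (BoundedContinuousFunction.dist_coe_le_dist (f := W (φ m)) (g := g) ⟨r, hr⟩).trans_lt hm
    simp only [U₀, projIcc_of_mem zero_le_one hr]
    exact h1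
  have hεlim : ∀ ε > 0, ∀ᶠ m : ℕ in Filter.atTop, 1 / ((φ m : ℝ) + 1) < ε := fun ε hε =>
    hφ.tendsto_atTop.eventually (tendsto_one_div_add_atTop_nhds_zero_nat.eventually_lt_const hε)
  have hk : IsAdmissible fun ρ => S (U₀ ρ) + f ρ := hf.add_comp hS.continuous ⟨_, hB'⟩ hU₀
  -- The equation for `z` alone, with the limit `U₀` frozen in the data: the coupling is switched
  -- off by taking both nonlinearities zero and putting `S(U₀) + f` in the source.
  obtain ⟨_, z, hz, _⟩ := exists_integralSolution_of_lipschitz (P := 0) n hC hθ hθ1 hR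
    (LipschitzWith.const (0 : ℝ)) (LipschitzWith.const (0 : ℝ)) (B := 0) (by simp)
    ⟨0, by simp⟩ hk 0
  have hzlim : ∀ ε > 0, ∀ᶠ m in Filter.atTop, ∀ r ∈ Icc (0 : ℝ) 1, |y (φ m) r - z r| < ε := by
    intro ε hε
    -- Chosen so that `C e / (1 - θ) < ε`; the `+ 1` covers `C = 0`.
    set e := ε * (1 - θ) / (2 * (C + 1))
    have h1θ : 0 < 1 - θ := by linarith
    have he : 0 < e := by positivity
    obtain ⟨δ, hδ, hSδ⟩ := Metric.uniformContinuous_iff.1 hS (e / 2) (by positivity)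
    filter_upwards [hVlim δ hδ, hεlim (e / 2) (by positivity)] with m h1 h2 r hr
    have h3 := abs_average_sub_le (e := e) hC hθ hθ1 hR (hVy (φ m)).continuous hz.continuous
      (hVy (φ m)).bounded hz.bounded
      (hf.add_comp (hS'l (φ m)).continuous ⟨_, hS'B (φ m)⟩ (hVc (φ m)))
      (by simpa using hk) (hVy (φ m)).eq_average (by simpa using hz.eq_average) (fun r hr => by
        rw [add_sub_add_right_eq_sub]
        have h4 := hS' (φ m) (V (φ m) r)
        have h5 := (hSδ (a := V (φ m) r) (b := U₀ r) (h1 r hr)).le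
        rw [Real.dist_eq] at h5
        have h6 := abs_sub_le (S' (φ m) (V (φ m) r)) (S (V (φ m) r)) (S (U₀ r))
        linarith) r hr
    refine h3.trans_lt ?_
    have h7 : C * e / (1 - θ) = ε * (C / (2 * (C + 1))) := by
      simp only [e]; field_simp
    rw [h7]
    have h8 : C / (2 * (C + 1)) < 1 := by rw [div_lt_one (by positivity)]; linarith
    nlinarith
  -- The limit `U₀` is meaningful only on `[0, 1]`; this primitive is differentiable on the whole
  -- line and is shown to agree with it there.
  let U : ℝ → ℝ := fun r => b + ∫ ρ in (1 : ℝ)..r, ψ (z ρ)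
  have hψz : Continuous fun ρ => ψ (z ρ) := hψ.continuous.comp hz.continuous
  have hUd : ∀ r, HasDerivAt U (ψ (z r)) r := fun r =>
    (hψz.integral_hasStrictDerivAt 1 r).hasDerivAt.const_add b
  have hUU₀ : ∀ r ∈ Icc (0 : ℝ) 1, U r = U₀ r := by
    intro r hr
    have key : ∀ ε > 0, |U r - U₀ r| ≤ ε + ε := by
      intro ε hε
      obtain ⟨δ, hδ, hψδ⟩ := Metric.uniformContinuous_iff.1 hψ (ε / 2) (by positivity)
      obtain ⟨m, h1, h2, h3⟩ :=
        ((hVlim ε hε).and ((hεlim (ε / 2) (by positivity)).and (hzlim δ hδ))).exists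
      have h4 : V (φ m) r = b + ∫ ρ in (1 : ℝ)..r, ψ' (φ m) (y (φ m) ρ) := by
        rw [intervalIntegral.integral_eq_sub_of_hasDerivAt
          (fun x _ => (hVy (φ m)).hasDerivAt x)
          (((hψ'l (φ m)).continuous.comp (hVy (φ m)).continuous).intervalIntegrable _ _), hVb]
        ring
      have h5 : |U r - V (φ m) r| ≤ ε := by
        rw [h4]
        simp only [U]
        have hi : IntervalIntegrable (fun ρ => ψ' (φ m) (y (φ m) ρ)) MeasureTheory.volume 1 r :=
          ((hψ'l (φ m)).continuous.comp (hVy (φ m)).continuous).intervalIntegrable _ _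
        rw [add_sub_add_left_eq_sub, ← intervalIntegral.integral_sub (hψz.intervalIntegrable _ _)
          hi]
        have h6 := intervalIntegral.norm_integral_le_of_norm_le_const (a := 1) (b := r) (C := ε)
          (f := fun ρ => ψ (z ρ) - ψ' (φ m) (y (φ m) ρ)) (fun ρ hρ => by
            rw [uIoc_of_ge hr.2] at hρ
            have hρ' : ρ ∈ Icc (0 : ℝ) 1 := ⟨hr.1.trans hρ.1.le, hρ.2⟩
            have h7 := hψ' (φ m) (y (φ m) ρ)
            have h8 := (hψδ (a := y (φ m) ρ) (b := z ρ) (h3 ρ hρ')).le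
            rw [Real.dist_eq] at h8
            have h9 := abs_sub_le (ψ' (φ m) (y (φ m) ρ)) (ψ (y (φ m) ρ)) (ψ (z ρ))
            rw [Real.norm_eq_abs, abs_sub_comm]
            linarith)
        refine h6.trans (mul_le_of_le_one_right hε.le ?_)
        rw [abs_sub_comm, abs_of_nonneg (by linarith [hr.2])]
        linarith [hr.1]
      exact (abs_sub_le _ (V (φ m) r) _).trans (add_le_add h5 (h1 r hr).le)
    have : |U r - U₀ r| ≤ 0 := le_of_forall_pos_le_add fun ε hε => by
      have := key (ε / 2) (by positivity); linarith
    exact sub_eq_zero.1 (abs_eq_zero.1 (le_antisymm this (abs_nonneg _)))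
  refine ⟨U, z, ⟨hz.continuous, hz.bounded, fun r hr => ?_, hUd⟩, by simp [U]⟩
  rw [hz.eq_average r hr]
  refine rayAverage_congr hr.1 fun ρ hρ => ?_
  simp only [zero_add]
  rw [hUU₀ ρ ⟨hρ.1, hρ.2.trans hr.2⟩]

end

/-! ### Existence for the radial equation -/

lemma uniformContinuous_comp_projIcc {g : ℝ → ℝ} (hg : Continuous g) {M : ℝ} (hM : -M ≤ M) :
    UniformContinuous fun x => g (projIcc (-M) M hM x) :=
  (CompactSpace.uniformContinuous_of_continuous
    (hg.comp (continuous_subtype_val (p := fun x => x ∈ Icc (-M) M)))).comp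
    (LipschitzWith.projIcc hM).uniformContinuous

lemma coe_projIcc_of_abs_le {M x : ℝ} (hM : -M ≤ M) (hx : |x| ≤ M) :
    (projIcc (-M) M hM x : ℝ) = x := by
  rw [projIcc_of_mem hM (abs_le.1 hx)]

lemma abs_signedPow_projIcc_le {a M : ℝ} (ha : -1 < a) (hM : -M ≤ M) (x : ℝ) :
    |signedPow a (projIcc (-M) M hM x)| ≤ M ^ (1 + a) := by
  rw [abs_signedPow ha]
  exact Real.rpow_le_rpow (abs_nonneg _) (abs_le.2 (projIcc (-M) M hM x).2) (by linarith)

lemma isAdmissible_piecewise {g : ℝ → ℝ} (hg : ContinuousOn g (Iio 1)) {B : ℝ} (hB0 : 0 ≤ B)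
    (hB : ∀ x < 1, |g x| ≤ B) [∀ x, Decidable (x ∈ Iio (1 : ℝ))] :
    IsAdmissible ((Iio 1).piecewise g 0) := by
  refine ⟨hg.measurable_piecewise continuousOn_const measurableSet_Iio, ⟨B, fun x => ?_⟩,
    hg.congr (piecewise_eqOn _ _ _)⟩
  by_cases hx : x ∈ Iio (1 : ℝ)
  · rw [piecewise_eq_of_mem _ _ _ hx]; exact hB x hx
  · rw [piecewise_eq_of_notMem _ _ _ hx]; simpa using hB0

section
variable {a s q L C : ℝ} {Q : ℝ → ℝ → ℝ}

lemma IsDissipative.q_le_L (hQ : IsDissipative q L C Q) : q ≤ L := by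
  have h1 := hQ.lower 0 1 0 zero_le_one
  have h2 := hQ.upper 0 1 0 zero_le_one
  linarith

/-- An explicit step of length `1/m ≤ 1/L` for the flow of `-Q`: the slope of `Q / m` in `z` lies
between `q / m` and `1`, so the slope of `z - Q / m` lies between `0` and `1 - q / m`. -/
lemma IsDissipative.contraction (hQ : IsDissipative q L C Q) {m : ℝ} (hm : 0 < m) (hmL : L ≤ m)
    (z z' k k' : ℝ) :
    |(z - Q z k / m) - (z' - Q z' k' / m)| ≤ (1 - q / m) * |z - z'| + C / m * |k - k'| := by
  have key : ∀ z z' k, z ≤ z' →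
      |(z' - Q z' k / m) - (z - Q z k / m)| ≤ (1 - q / m) * (z' - z) := fun z z' k h => by
    have h1 := hQ.lower z z' k h
    have h2 := hQ.upper z z' k h
    have h3 : (z' - Q z' k / m) - (z - Q z k / m) = (z' - z) - (Q z' k - Q z k) / m := by ring
    have h4 : (1 - q / m) * (z' - z) = (z' - z) - q * (z' - z) / m := by ring
    rw [h3, h4, abs_of_nonneg]
    · exact sub_le_sub_left (div_le_div_of_nonneg_right h1 hm.le) _
    · rw [sub_nonneg, div_le_iff₀ hm]
      nlinarith
  have h1 : |(z - Q z k / m) - (z' - Q z' k / m)| ≤ (1 - q / m) * |z - z'| := by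
    rcases le_total z z' with h | h
    · rw [abs_sub_comm, abs_sub_comm z z', abs_of_nonneg (sub_nonneg.2 h)]; exact key z z' k h
    · rw [abs_of_nonneg (sub_nonneg.2 h)]; exact key z' z k h
  have h2 : |(z' - Q z' k / m) - (z' - Q z' k' / m)| ≤ C / m * |k - k'| := by
    rw [show (z' - Q z' k / m) - (z' - Q z' k' / m) = -(Q z' k - Q z' k') / m by ring, abs_div,
      abs_neg, abs_of_pos hm, div_mul_eq_mul_div]
    exact div_le_div_of_nonneg_right (hQ.lip z' k k') hm.le
  exact (abs_sub_le _ _ _).trans (add_le_add h1 h2)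

/-- Existence for the boundary value problem with a bounded zero order term. -/
lemma exists_profile_of_bounded (ha : -1 < a) (hs : 0 < s) (hq : 0 < q) (hC : 0 ≤ C)
    (hQ : IsDissipative q L C Q) {S f : ℝ → ℝ} (hS : UniformContinuous S)
    (hSB : ∃ B, ∀ x, |S x| ≤ B) (hf : ContinuousOn f (Ico 0 1))
    (hfB : ∃ B, ∀ r ∈ Ico (0 : ℝ) 1, |f r| ≤ B) (b : ℝ) :
    ∃ U z, ContinuousOn U (Icc 0 1) ∧ U 1 = b ∧
      IsProfile a s Q (fun r => S (U r) + f r) U z ∧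
      ∃ Z, ∀ r ∈ Ioo (0 : ℝ) 1, |z r| ≤ Z := by
  classical
  -- In the variable `y = r^s` the equation is `s y dz/dy = -Q`. With `m = s (n+1)` it reads `y
  -- dz/dy = (n+1)(R - z)`, `R = z - Q / m`, and `n` is taken large enough that `m ≥ L`.
  obtain ⟨n, hn⟩ := exists_nat_ge (L / s)
  set m : ℝ := s * (n + 1)
  have hm : 0 < m := by positivity
  have hmL : L ≤ m := by
    rw [div_le_iff₀ hs] at hn
    simp only [m]; nlinarith
  set θ := 1 - q / m
  have hθ1 : θ < 1 := by have := div_pos hq hm; simp only [θ]; linarith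
  have hθ : 0 ≤ θ := by
    have : q / m ≤ 1 := (div_le_one hm).2 (hQ.q_le_L.trans hmL)
    simp only [θ]; linarith
  set R : ℝ → ℝ → ℝ := fun z k => z - Q z k / m
  have hR : ∀ z z' k k', |R z k - R z' k'| ≤ θ * |z - z'| + C / m * |k - k'| :=
    hQ.contraction hm hmL
  obtain ⟨Kf, hKf⟩ := hfB
  obtain ⟨KS, hKS⟩ := hSB
  have hKf0 : 0 ≤ Kf := (abs_nonneg _).trans (hKf 0 ⟨le_rfl, zero_lt_one⟩)
  have hmap : ∀ y ∈ Iio (1 : ℝ), (max y 0) ^ s⁻¹ ∈ Ico (0 : ℝ) 1 := fun y hy =>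
    ⟨Real.rpow_nonneg (le_max_right _ _) _,
      Real.rpow_lt_one (le_max_right _ _) (max_lt hy zero_lt_one) (inv_pos.2 hs)⟩
  -- The source in the variable `y`, extended by zero beyond `1`: `f` is bounded and continuous on
  -- `[0, 1)` but need not have a limit at `1`.
  set F : ℝ → ℝ := (Iio 1).piecewise (fun y => f ((max y 0) ^ s⁻¹)) 0
  have hF : IsAdmissible F := by
    refine isAdmissible_piecewise (hf.comp ?_ hmap) hKf0 fun y hy => hKf _ (hmap y hy)
    exact ((continuous_id.max continuous_const).rpow_const
      fun _ => Or.inr (inv_nonneg.2 hs.le)).continuousOn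
  -- This is the a priori bound on `z`. It does not involve `ψ`, so truncating `ψ` at `Z` leaves the
  -- solution unaffected.
  set Z := C / m * (KS + Kf) / (1 - θ)
  have hZ : -Z ≤ Z := by
    have : 0 ≤ Z := div_nonneg (mul_nonneg (div_nonneg hC hm.le)
      (add_nonneg ((abs_nonneg _).trans (hKS 0)) hKf0)) (by linarith)
    linarith
  set ψ : ℝ → ℝ := fun x => signedPow a (projIcc (-Z) Z hZ x) / s
  have hψ : UniformContinuous ψ :=
    uniformContinuous_comp_projIcc ((continuous_signedPow ha).div_const s) hZ
  have hψB : ∀ x, |ψ x| ≤ Z ^ (1 + a) / s := fun x => by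
    simp only [ψ]
    rw [abs_div, abs_of_pos hs]
    exact div_le_div_of_nonneg_right (abs_signedPow_projIcc_le ha hZ x) hs.le
  obtain ⟨U, z, h, hU1⟩ := exists_integralSolution n (div_nonneg hC hm.le) hθ hθ1 hR hψ hS
    ⟨_, hψB⟩ ⟨KS, hKS⟩ hF b
  have hUc : Continuous U := continuous_iff_continuousAt.2 fun r => (h.hasDerivAt r).continuousAt
  have hk : IsAdmissible fun ρ => S (U ρ) + F ρ := hF.add_comp hS.continuous ⟨KS, hKS⟩ hUc
  have hFB : ∀ y, |F y| ≤ Kf := fun y => by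
    by_cases hy : y ∈ Iio (1 : ℝ)
    · simp only [F]; rw [piecewise_eq_of_mem _ _ _ hy]; exact hKf _ (hmap y hy)
    · simp only [F]; rw [piecewise_eq_of_notMem _ _ _ hy]; simpa using hKf0
  have hzZ : ∀ r ∈ Icc (0 : ℝ) 1, |z r| ≤ Z := by
    have h1 := abs_average_sub_le (n := n) (z := z) (z' := fun _ => 0)
      (k := fun ρ => S (U ρ) + F ρ) (k' := fun _ => 0) (e := KS + Kf)
      (div_nonneg hC hm.le) hθ hθ1 hR h.continuous continuous_const h.bounded ⟨0, by simp⟩ hk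
      ⟨measurable_const, ⟨0, by simp⟩, continuousOn_const⟩ h.eq_average
      (fun r _ => by simp [R, hQ.zero, rayAverage])
      (fun r _ => by
        rw [sub_zero]
        exact (abs_add_le _ _).trans (add_le_add (hKS _) (hFB _)))
    simpa using h1
  have hpow : ∀ r ∈ Ioo (0 : ℝ) 1, r ^ s ∈ Ioo (0 : ℝ) 1 := fun r hr =>
    ⟨Real.rpow_pos_of_pos hr.1 _, Real.rpow_lt_one hr.1.le hr.2 hs⟩
  have hFr : ∀ r ∈ Ioo (0 : ℝ) 1, F (r ^ s) = f r := fun r hr => by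
    simp only [F]
    rw [piecewise_eq_of_mem (Iio 1) _ _ (show r ^ s ∈ Iio 1 from (hpow r hr).2), max_eq_left (hpow r hr).1.le,
      Real.rpow_rpow_inv hr.1.le hs.ne']
  have hadm := isAdmissible_comp (div_nonneg hC hm.le) hθ hR h.continuous h.bounded hk
  refine ⟨fun r => U (r ^ s), fun r => z (r ^ s), ?_, by simpa using hU1, fun r hr => ?_, Z,
    fun r hr => hzZ _ (Ioo_subset_Icc_self (hpow r hr))⟩
  · exact (hUc.comp (continuous_id.rpow_const fun _ => Or.inr hs.le)).continuousOn
  · have hrs := hpow r hr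
    have hd := Real.hasDerivAt_rpow_const (x := r) (p := s) (Or.inl hr.1.ne')
    refine ⟨((h.hasDerivAt (r ^ s)).comp r hd).congr_deriv ?_, ?_⟩
    · simp only [ψ]
      rw [coe_projIcc_of_abs_le hZ (hzZ _ (Ioo_subset_Icc_self hrs))]
      field_simp
    · have h1 : HasDerivAt z ((n + 1) * (R (z (r ^ s)) (S (U (r ^ s)) + F (r ^ s)) - z (r ^ s)) /
          r ^ s) (r ^ s) := by
        have h2 := hadm.hasDerivAt_rayAverage n hrs
        rw [← h.eq_average _ (Ioo_subset_Icc_self hrs)] at h2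
        refine h2.congr_of_eventuallyEq ?_
        filter_upwards [Ioo_mem_nhds hrs.1 hrs.2] with y hy
        exact h.eq_average y (Ioo_subset_Icc_self hy)
      refine (h1.comp r hd).congr_deriv ?_
      rw [hFr r hr]
      have hr0 : r ≠ 0 := hr.1.ne'
      have hrs0 : r ^ s ≠ 0 := hrs.1.ne'
      rw [Real.rpow_sub_one hr0]
      simp only [R, m]
      have hn0 : (n : ℝ) + 1 ≠ 0 := by positivity
      have hs0 : s ≠ 0 := hs.ne'
      field_simp
      ring

/-- Constants solve the system with zero data and serve as barriers. -/
lemma isProfile_const (hQ : IsDissipative q L C Q) (M : ℝ) :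
    IsProfile a s Q (fun _ => 0) (fun _ => M) (fun _ => 0) := by
  intro r _
  rw [signedPow_zero, mul_zero, hQ.zero, neg_zero, zero_div]
  exact ⟨hasDerivAt_const _ _, hasDerivAt_const _ _⟩

/-- Existence for the boundary value problem with the zero order term `β |U|^α U`. -/
lemma exists_profile {α β : ℝ} (hα : -1 < α) (hβ : 0 ≤ β) (ha : -1 < a) (hs : 0 < s) (hq : 0 < q)
    (hC : 0 ≤ C) (hQ : IsDissipative q L C Q) {f : ℝ → ℝ} (hf : ContinuousOn f (Ico 0 1))
    (hfB : ∃ B, ∀ r ∈ Ico (0 : ℝ) 1, |f r| ≤ B) (b : ℝ) :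
    ∃ U z, ContinuousOn U (Icc 0 1) ∧ U 1 = b ∧
      IsProfile a s Q (fun r => β * signedPow α (U r) + f r) U z := by
  obtain ⟨B, hB⟩ := hfB
  -- For `β > 0` the zero order term at height `M` dominates the source, so `±M` are barriers. For
  -- `β = 0` there is nothing to truncate and only `|b| ≤ M` is asked.
  obtain ⟨M, hMb, hMβ⟩ : ∃ M, |b| ≤ M ∧ (0 < β → B < β * M ^ (1 + α)) := by
    rcases hβ.eq_or_lt with rfl | hβ
    · exact ⟨|b|, le_rfl, fun h => absurd h (lt_irrefl _)⟩
    · have h1 := (tendsto_rpow_atTop (by linarith : 0 < 1 + α)).const_mul_atTop hβ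
      obtain ⟨M, h2, h3⟩ := ((h1.eventually_gt_atTop B).and
        (Filter.eventually_ge_atTop |b|)).exists
      exact ⟨M, h3, fun _ => h2⟩
  have hM0 : 0 ≤ M := (abs_nonneg b).trans hMb
  have hM : -M ≤ M := by linarith
  set S : ℝ → ℝ := fun x => β * signedPow α (projIcc (-M) M hM x)
  have hS : UniformContinuous S :=
    uniformContinuous_comp_projIcc (continuous_const.mul (continuous_signedPow hα)) hM
  obtain ⟨U, z, hUc, hU1, hp, Z, hZ⟩ := exists_profile_of_bounded ha hs hq hC hQ hS
    ⟨β * M ^ (1 + α), fun x => by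
      simp only [S]
      rw [abs_mul, abs_of_nonneg hβ]
      exact mul_le_mul_of_nonneg_left (abs_signedPow_projIcc_le hα hM x) hβ⟩ hf ⟨B, hB⟩ b
  refine ⟨U, z, hUc, hU1, ?_⟩
  suffices h : ∀ r ∈ Ioo (0 : ℝ) 1, S (U r) = β * signedPow α (U r) by
    intro r hr
    have h1 := hp r hr
    simp only [h r hr] at h1
    exact h1
  rcases hβ.eq_or_lt with rfl | hβ
  · simp [S]
  have hf' : ∀ r ∈ Ioo (0 : ℝ) 1, |f r| < β * M ^ (1 + α) := fun r hr =>
    (hB r (Ioo_subset_Ico_self hr)).trans_lt (hMβ hβ)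
  have hZ0 : ∀ r ∈ Ioo (0 : ℝ) 1, |(0 : ℝ)| ≤ Z := fun r hr => by
    rw [abs_zero]; exact (abs_nonneg _).trans (hZ r hr)
  -- Where `U > M` the truncated data equal `β M^{1+α} + f > 0`, the strict inequality that the
  -- maximum principle needs against the constant `M`.
  have hup := hp.le_of_le ha hq hQ (isProfile_const hQ M) hZ hZ0 hUc continuousOn_const
    (by rw [hU1]; exact (abs_le.1 hMb).2) (fun r hr hlt => by
      have h1 : S (U r) = β * M ^ (1 + α) := by
        simp only [S]
        rw [projIcc_of_right_le hM hlt.le, signedPow_of_nonneg hα hM0]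
      rw [h1]
      linarith [(abs_lt.1 (hf' r hr)).1])
  have hlow := (isProfile_const hQ (-M)).le_of_le ha hq hQ hp hZ0 hZ continuousOn_const hUc
    (by rw [hU1]; exact (abs_le.1 hMb).1) (fun r hr hlt => by
      have h1 : S (U r) = -(β * M ^ (1 + α)) := by
        simp only [S]
        rw [projIcc_of_le_left hM hlt.le, signedPow_neg, signedPow_of_nonneg hα hM0, mul_neg]
      rw [h1]
      linarith [(abs_lt.1 (hf' r hr)).2])
  intro r hr
  have hr' := Ioo_subset_Icc_self hr
  simp only [S]
  rw [coe_projIcc_of_abs_le hM (abs_le.2 ⟨hlow r hr', hup r hr'⟩)]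

end

/-! ### The operator on radial Hessians -/

/-- The symmetric matrix with eigenvalue `m` in the direction of the unit vector `v` and
eigenvalue `p` on its orthogonal complement. -/
def radialMatrix {N : ℕ} (v : Fin N → ℝ) (m p : ℝ) : Matrix (Fin N) (Fin N) ℝ :=
  p • (1 : Matrix (Fin N) (Fin N) ℝ) + (m - p) • Matrix.vecMulVec v v

/-- The diagonal matrix with entry `m` at `i` and `p` elsewhere. -/
def axisMatrix {N : ℕ} (i : Fin N) (m p : ℝ) : Matrix (Fin N) (Fin N) ℝ :=
  Matrix.diagonal fun j => if j = i then m else p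

section
variable {N : ℕ}

lemma radialMatrix_single (i : Fin N) (m p : ℝ) :
    radialMatrix (Pi.single i 1) m p = axisMatrix i m p := by
  ext j k
  by_cases hjk : j = k
  · subst hjk
    by_cases hj : j = i
    · subst hj; simp [radialMatrix, axisMatrix, Matrix.vecMulVec_apply]
    · simp [radialMatrix, axisMatrix, Matrix.vecMulVec_apply, hj]
  · by_cases hj : j = i
    · subst hj
      simp [radialMatrix, axisMatrix, Matrix.vecMulVec_apply, hjk, Ne.symm hjk]
    · simp [radialMatrix, axisMatrix, Matrix.vecMulVec_apply, hjk, hj]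

lemma isSymm_radialMatrix (v : Fin N → ℝ) (m p : ℝ) : (radialMatrix v m p).IsSymm := by
  unfold radialMatrix Matrix.IsSymm
  simp [Matrix.transpose_vecMulVec]

lemma isSymm_axisMatrix (i : Fin N) (m p : ℝ) : (axisMatrix i m p).IsSymm :=
  Matrix.isSymm_diagonal _

/-- The Householder reflection that exchanges two unit vectors, as an orthogonal matrix. -/
lemma exists_orthogonal_mulVec_eq (u v : Fin N → ℝ) (hu : u ⬝ᵥ u = 1) (hv : v ⬝ᵥ v = 1) :
    ∃ O ∈ Matrix.orthogonalGroup (Fin N) ℝ, O.mulVec u = v := by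
  by_cases huv : u = v
  · exact ⟨1, one_mem _, by rw [Matrix.one_mulVec, huv]⟩
  set w := v - u
  have hw : w ⬝ᵥ w = 2 - 2 * (v ⬝ᵥ u) := by
    simp only [w, sub_dotProduct, dotProduct_sub, hu, hv, dotProduct_comm u v]; ring
  have hwu : w ⬝ᵥ u = (v ⬝ᵥ u) - 1 := by simp only [w, sub_dotProduct, hu]
  have hw0 : w ⬝ᵥ w ≠ 0 := by
    rw [Ne, dotProduct_self_eq_zero, sub_eq_zero]
    exact fun h => huv h.symm
  set c := 2 / (w ⬝ᵥ w)
  have hc : c * (w ⬝ᵥ w) = 2 := by simp only [c]; field_simp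
  set O : Matrix (Fin N) (Fin N) ℝ := 1 - c • Matrix.vecMulVec w w
  have hOt : O.transpose = O := by simp [O, Matrix.transpose_vecMulVec]
  have hww : Matrix.vecMulVec w w * Matrix.vecMulVec w w = (w ⬝ᵥ w) • Matrix.vecMulVec w w := by
    rw [Matrix.vecMulVec_mul_vecMulVec, Matrix.vecMulVec_smul]
  refine ⟨O, ?_, ?_⟩
  · rw [Matrix.mem_orthogonalGroup_iff, hOt]
    simp only [O]
    rw [sub_mul, mul_sub, mul_sub, one_mul, mul_one, one_mul, smul_mul_smul_comm, hww, smul_smul]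
    rw [show c * c * (w ⬝ᵥ w) = 2 * c by rw [mul_assoc, hc, mul_comm]]
    rw [two_mul, add_smul]; abel
  · simp only [O]
    rw [Matrix.sub_mulVec, Matrix.one_mulVec, Matrix.smul_mulVec, Matrix.vecMulVec_mulVec]
    have h1 : c * (w ⬝ᵥ u) = -1 := by
      rw [hwu]
      rw [hw] at hc
      linarith
    rw [op_smul_eq_smul, smul_smul, h1]
    simp [w]

/-- A rotation taking a coordinate axis to `v` conjugates the two matrices, so the operator on
radial Hessians depends only on the two eigenvalues. -/
lemma IsRotationInvariant.apply_radialMatrix {F : Matrix (Fin N) (Fin N) ℝ → ℝ}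
    (hF : IsRotationInvariant F) (i : Fin N) {v : Fin N → ℝ} (hv : v ⬝ᵥ v = 1) (m p : ℝ) :
    F (radialMatrix v m p) = F (axisMatrix i m p) := by
  obtain ⟨O, hO, hOv⟩ := exists_orthogonal_mulVec_eq (Pi.single i 1) v (by simp) hv
  rw [← radialMatrix_single, ← hF O (radialMatrix (Pi.single i 1) m p) hO
    (isSymm_radialMatrix _ m p)]
  congr 1
  have hO' := (Matrix.mem_orthogonalGroup_iff (Fin N) ℝ).1 hO
  unfold radialMatrix
  rw [Matrix.mul_add, Matrix.add_mul, Matrix.mul_smul, Matrix.mul_one, Matrix.smul_mul, hO',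
    Matrix.mul_smul, Matrix.smul_mul, Matrix.mul_vecMulVec, Matrix.vecMulVec_mul,
    Matrix.vecMul_transpose, hOv]

/-- Structural conditions on the restriction of the operator to radial Hessians. -/
structure IsRadialOperator (lam Lam d : ℝ) (G : ℝ → ℝ → ℝ) : Prop where
  fst_lower : ∀ m₁ m₂ p, m₁ ≤ m₂ → lam * (m₂ - m₁) ≤ G m₂ p - G m₁ p
  fst_upper : ∀ m₁ m₂ p, m₁ ≤ m₂ → G m₂ p - G m₁ p ≤ Lam * (m₂ - m₁)
  snd_lower : ∀ m p₁ p₂, p₁ ≤ p₂ → d * lam * (p₂ - p₁) ≤ G m p₂ - G m p₁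
  snd_upper : ∀ m p₁ p₂, p₁ ≤ p₂ → G m p₂ - G m p₁ ≤ d * Lam * (p₂ - p₁)
  homogeneous : ∀ m p t, 0 < t → G (t * m) (t * p) = t * G m p

lemma axisMatrix_sub_fst (i : Fin N) (m₁ m₂ p : ℝ) :
    axisMatrix i m₂ p = axisMatrix i m₁ p + axisMatrix i (m₂ - m₁) 0 := by
  simp only [axisMatrix, Matrix.diagonal_add]
  congr 1; ext j; split_ifs <;> ring

lemma axisMatrix_sub_snd (i : Fin N) (m p₁ p₂ : ℝ) :
    axisMatrix i m p₂ = axisMatrix i m p₁ + axisMatrix i 0 (p₂ - p₁) := by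
  simp only [axisMatrix, Matrix.diagonal_add]
  congr 1; ext j; split_ifs <;> ring

lemma trace_axisMatrix (i : Fin N) (m p : ℝ) :
    (axisMatrix i m p).trace = m + (N - 1) * p := by
  have h : ∀ j : Fin N, (if j = i then m else p) = (if j = i then m - p else 0) + p := fun j => by
    split_ifs <;> ring
  rw [axisMatrix, Matrix.trace_diagonal, Finset.sum_congr rfl fun j _ => h j,
    Finset.sum_add_distrib]
  simp
  ring

lemma posSemidef_axisMatrix (i : Fin N) {m p : ℝ} (hm : 0 ≤ m) (hp : 0 ≤ p) :
    (axisMatrix i m p).PosSemidef :=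
  Matrix.PosSemidef.diagonal fun j => by
    simp only [Pi.zero_apply]; split_ifs <;> assumption

lemma isRadialOperator {lam Lam : ℝ} {F : Matrix (Fin N) (Fin N) ℝ → ℝ}
    (hFell : IsUniformlyElliptic lam Lam F) (hFhom : IsPosHomogeneous F) (i : Fin N) :
    IsRadialOperator lam Lam (N - 1) fun m p => F (axisMatrix i m p) where
  fst_lower m₁ m₂ p h := by
    have := (hFell _ _ (isSymm_axisMatrix i m₁ p)
      (posSemidef_axisMatrix i (sub_nonneg.2 h) le_rfl)).1
    rw [← axisMatrix_sub_fst, trace_axisMatrix] at this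
    linarith
  fst_upper m₁ m₂ p h := by
    have := (hFell _ _ (isSymm_axisMatrix i m₁ p)
      (posSemidef_axisMatrix i (sub_nonneg.2 h) le_rfl)).2
    rw [← axisMatrix_sub_fst, trace_axisMatrix] at this
    linarith
  snd_lower m p₁ p₂ h := by
    have := (hFell _ _ (isSymm_axisMatrix i m p₁)
      (posSemidef_axisMatrix i le_rfl (sub_nonneg.2 h))).1
    rw [← axisMatrix_sub_snd, trace_axisMatrix] at this
    linarith
  snd_upper m p₁ p₂ h := by
    have := (hFell _ _ (isSymm_axisMatrix i m p₁)
      (posSemidef_axisMatrix i le_rfl (sub_nonneg.2 h))).2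
    rw [← axisMatrix_sub_snd, trace_axisMatrix] at this
    linarith
  homogeneous m p t ht := by
    rw [← hFhom _ t (isSymm_axisMatrix i m p) ht]
    congr 1
    simp only [axisMatrix, ← Matrix.diagonal_smul]
    congr 1; ext j
    simp only [Pi.smul_apply, smul_eq_mul]
    split_ifs <;> rfl

end

section
variable {lam Lam d : ℝ} {G : ℝ → ℝ → ℝ}

lemma IsRadialOperator.zero (hG : IsRadialOperator lam Lam d G) : G 0 0 = 0 := by
  have := hG.homogeneous 0 0 2 two_pos
  simp only [mul_zero] at this
  linarith

lemma IsRadialOperator.strictMono_fst (hG : IsRadialOperator lam Lam d G) (hlam : 0 < lam)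
    (p : ℝ) : StrictMono fun m => G m p := fun m₁ m₂ h => by
  have := hG.fst_lower m₁ m₂ p h.le
  have := mul_pos hlam (sub_pos.2 h)
  simp only; linarith

lemma IsRadialOperator.continuous (hG : IsRadialOperator lam Lam d G) (hlam : 0 < lam)
    (hd : 0 ≤ d) : Continuous fun x : ℝ × ℝ => G x.1 x.2 := by
  have hlip : ∀ m m' p p', |G m p - G m' p'| ≤ Lam * |m - m'| + (d * Lam) * |p - p'| := by
    intro m m' p p'
    have h1 : |G m p - G m' p| ≤ Lam * |m - m'| := by
      rcases le_total m m' with h | h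
      · rw [abs_sub_comm, abs_sub_comm m, abs_of_nonneg (sub_nonneg.2 h), abs_of_nonneg]
        · exact hG.fst_upper _ _ _ h
        · exact (mul_nonneg hlam.le (sub_nonneg.2 h)).trans (hG.fst_lower _ _ _ h)
      · rw [abs_of_nonneg (sub_nonneg.2 h), abs_of_nonneg]
        · exact hG.fst_upper _ _ _ h
        · exact (mul_nonneg hlam.le (sub_nonneg.2 h)).trans (hG.fst_lower _ _ _ h)
    have h2 : |G m' p - G m' p'| ≤ (d * Lam) * |p - p'| := by
      rcases le_total p p' with h | h
      · rw [abs_sub_comm, abs_sub_comm p, abs_of_nonneg (sub_nonneg.2 h), abs_of_nonneg]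
        · exact hG.snd_upper _ _ _ h
        · exact (mul_nonneg (mul_nonneg hd hlam.le) (sub_nonneg.2 h)).trans (hG.snd_lower _ _ _ h)
      · rw [abs_of_nonneg (sub_nonneg.2 h), abs_of_nonneg]
        · exact hG.snd_upper _ _ _ h
        · exact (mul_nonneg (mul_nonneg hd hlam.le) (sub_nonneg.2 h)).trans (hG.snd_lower _ _ _ h)
    exact (abs_sub_le _ _ _).trans (add_le_add h1 h2)
  exact continuous_uncurry_of_lip hlip

/-- Ellipticity gives growth at rate at least `lam` in `m`, so `G(·, p)` takes values on both sides
of `k` within distance `|k - G 0 p| / lam` of `0`. -/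
lemma IsRadialOperator.exists_eq (hG : IsRadialOperator lam Lam d G) (hlam : 0 < lam)
    (hd : 0 ≤ d) (p k : ℝ) : ∃ m, G m p = k := by
  have hc : Continuous fun m => G m p :=
    (hG.continuous hlam hd).comp (continuous_id.prodMk continuous_const)
  set t := |k - G 0 p| / lam
  have ht : 0 ≤ t := div_nonneg (abs_nonneg _) hlam.le
  have htl : lam * t = |k - G 0 p| := by simp only [t]; field_simp
  refine mem_range_of_exists_le_of_exists_ge hc ⟨-t, ?_⟩ ⟨t, ?_⟩
  · have := hG.fst_lower (-t) 0 p (by linarith)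
    have := neg_abs_le (k - G 0 p)
    linarith
  · have := hG.fst_lower 0 t p ht
    have := le_abs_self (k - G 0 p)
    linarith

open Classical in
/-- The solution `m` of `G(m, p) = k`. -/
def radialInverse (G : ℝ → ℝ → ℝ) (p k : ℝ) : ℝ :=
  if h : ∃ m, G m p = k then h.choose else 0

lemma IsRadialOperator.apply_radialInverse (hG : IsRadialOperator lam Lam d G) (hlam : 0 < lam)
    (hd : 0 ≤ d) (p k : ℝ) : G (radialInverse G p k) p = k := by
  have h := hG.exists_eq hlam hd p k
  rw [radialInverse, dif_pos h]
  exact h.choose_spec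

lemma IsRadialOperator.radialInverse_eq (hG : IsRadialOperator lam Lam d G) (hlam : 0 < lam)
    (hd : 0 ≤ d) {m p k : ℝ} (h : G m p = k) : radialInverse G p k = m :=
  (hG.strictMono_fst hlam p).injective ((hG.apply_radialInverse hlam hd p k).trans h.symm)

/-- The nonlinearity of the equation satisfied by `r^{γ-1} |u'|^α u'`. -/
def radialNonlinearity (α γ : ℝ) (G : ℝ → ℝ → ℝ) (z k : ℝ) : ℝ :=
  (1 - γ) * z - (1 + α) * radialInverse G z k

/-- On the level set `G(m, z) = k`, raising `z` by `Δ` raises `G` by between `d lam Δ` and `d Lam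
Δ`, and lowering `m` compensates at a rate between `lam` and `Lam`. The inverse thus decreases in
`z` with slope between `d lam / Lam` and `d Lam / lam`. -/
lemma IsRadialOperator.isDissipative {α γ : ℝ} (hG : IsRadialOperator lam Lam d G)
    (hlam : 0 < lam) (hLam : 0 < Lam) (hd : 0 ≤ d) (hα : -1 < α) :
    IsDissipative ((1 - γ) + (1 + α) * (d * lam / Lam)) ((1 - γ) + (1 + α) * (d * Lam / lam))
      ((1 + α) / lam) (radialNonlinearity α γ G) := by
  have hH := hG.apply_radialInverse hlam hd
  set H := radialInverse G
  have h1α : 0 < 1 + α := by linarith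
  have hp : ∀ z₁ z₂ k, z₁ ≤ z₂ → d * lam / Lam * (z₂ - z₁) ≤ H z₁ k - H z₂ k ∧
      H z₁ k - H z₂ k ≤ d * Lam / lam * (z₂ - z₁) := by
    intro z₁ z₂ k h
    have h1 := hG.snd_lower (H z₂ k) z₁ z₂ h
    have h2 := hG.snd_upper (H z₂ k) z₁ z₂ h
    rw [hH] at h1 h2
    have hle : H z₂ k ≤ H z₁ k := by
      refine (hG.strictMono_fst hlam z₁).le_iff_le.1 ?_
      rw [hH]
      have := mul_nonneg (mul_nonneg hd hlam.le) (sub_nonneg.2 h)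
      linarith
    have h3 := hG.fst_lower _ _ z₁ hle
    have h4 := hG.fst_upper _ _ z₁ hle
    rw [hH] at h3 h4
    constructor
    · rw [div_mul_eq_mul_div, div_le_iff₀ hLam]; linarith
    · rw [div_mul_eq_mul_div, le_div_iff₀ hlam]; linarith
  have hk : ∀ z k₁ k₂, k₁ ≤ k₂ → lam * |H z k₂ - H z k₁| ≤ |k₂ - k₁| := by
    intro z k₁ k₂ h
    have hle : H z k₁ ≤ H z k₂ := (hG.strictMono_fst hlam z).le_iff_le.1 (by simpa [hH] using h)
    have h3 := hG.fst_lower _ _ z hle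
    rw [hH, hH] at h3
    rw [abs_of_nonneg (sub_nonneg.2 hle), abs_of_nonneg (sub_nonneg.2 h)]
    exact h3
  constructor
  · intro z₁ z₂ k h
    have := mul_le_mul_of_nonneg_left (hp z₁ z₂ k h).1 h1α.le
    simp only [radialNonlinearity]
    nlinarith
  · intro z₁ z₂ k h
    have := mul_le_mul_of_nonneg_left (hp z₁ z₂ k h).2 h1α.le
    simp only [radialNonlinearity]
    nlinarith
  · intro z k₁ k₂ h
    have hlt : H z k₁ < H z k₂ := (hG.strictMono_fst hlam z).lt_iff_lt.1 (by simpa [hH] using h)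
    have := mul_lt_mul_of_pos_left hlt h1α
    simp only [radialNonlinearity]
    linarith
  · intro z k₁ k₂
    simp only [radialNonlinearity]
    rw [show (1 - γ) * z - (1 + α) * H z k₁ - ((1 - γ) * z - (1 + α) * H z k₂) =
      (1 + α) * (H z k₂ - H z k₁) by ring, abs_mul, abs_of_pos h1α, div_mul_eq_mul_div,
      le_div_iff₀ hlam, mul_assoc]
    refine mul_le_mul_of_nonneg_left ?_ h1α.le
    rw [mul_comm]
    rcases le_total k₁ k₂ with h | h
    · rw [abs_sub_comm k₁]; exact hk z k₁ k₂ h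
    · rw [abs_sub_comm (H z k₂)]; exact hk z k₂ k₁ h
  · simp [radialNonlinearity, hG.radialInverse_eq hlam hd hG.zero]

/-- The equation for `w = |u'|^α u'` in terms of `z = r^{γ-1} w`. -/
lemma IsRadialOperator.hasDerivAt_z {α γ : ℝ} (hG : IsRadialOperator lam Lam d G)
    (hlam : 0 < lam) (hd : 0 ≤ d) (hα : -1 < α) {w : ℝ → ℝ} {w' r k : ℝ}
    (hr : 0 < r) (hw : HasDerivAt w w' r) (h : G (w' / (1 + α)) (w r / r) = r ^ (-γ) * k) :
    HasDerivAt (fun r => r ^ (γ - 1) * w r)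
      (-(radialNonlinearity α γ G (r ^ (γ - 1) * w r) k) / r) r := by
  have h1α : 1 + α ≠ 0 := by linarith
  have h1 := (Real.hasDerivAt_rpow_const (x := r) (p := γ - 1) (Or.inl hr.ne')).mul hw
  refine h1.congr_deriv ?_
  have hrγ : 0 < r ^ γ := Real.rpow_pos_of_pos hr _
  -- Scaling by `r^γ` removes the weight: `G(r^γ w'/(1+α), z) = k`.
  have h2 := hG.homogeneous (w' / (1 + α)) (w r / r) (r ^ γ) hrγ
  rw [h, ← mul_assoc, ← Real.rpow_add hr, add_neg_cancel, Real.rpow_zero, one_mul,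
    show r ^ γ * (w r / r) = r ^ (γ - 1) * w r by rw [Real.rpow_sub_one hr.ne']; ring] at h2
  rw [radialNonlinearity, hG.radialInverse_eq hlam hd h2, Real.rpow_sub_one hr.ne',
    Real.rpow_sub_one hr.ne']
  field_simp
  ring

lemma IsRadialOperator.hasDerivAt_w {α γ : ℝ} (hG : IsRadialOperator lam Lam d G)
    (hlam : 0 < lam) (hd : 0 ≤ d) (hα : -1 < α) {z : ℝ → ℝ} {r k : ℝ}
    (hr : 0 < r) (hz : HasDerivAt z (-(radialNonlinearity α γ G (z r) k) / r) r) :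
    HasDerivAt (fun r => r ^ (1 - γ) * z r) (r ^ (-γ) * ((1 + α) * radialInverse G (z r) k)) r ∧
      G (r ^ (-γ) * ((1 + α) * radialInverse G (z r) k) / (1 + α)) (r ^ (1 - γ) * z r / r) =
        r ^ (-γ) * k := by
  have h1α : 1 + α ≠ 0 := by linarith
  have hpow : r ^ (1 - γ) = r ^ (-γ) * r := by
    rw [← Real.rpow_add_one hr.ne']; congr 1; ring
  constructor
  · have h1 := (Real.hasDerivAt_rpow_const (x := r) (p := 1 - γ) (Or.inl hr.ne')).mul hz
    refine h1.congr_deriv ?_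
    rw [show 1 - γ - 1 = -γ by ring, hpow, radialNonlinearity]
    field_simp
    ring
  · rw [show r ^ (-γ) * ((1 + α) * radialInverse G (z r) k) / (1 + α) =
      r ^ (-γ) * radialInverse G (z r) k by field_simp,
      show r ^ (1 - γ) * z r / r = r ^ (-γ) * z r by rw [hpow]; field_simp,
      hG.homogeneous _ _ _ (Real.rpow_pos_of_pos hr _), hG.apply_radialInverse hlam hd]

end

/-! ### Calculus of radial functions -/

section
variable {N : ℕ}

lemma hasFDerivAt_norm_of_ne_zero {x : RN N} (hx : x ≠ 0) :
    HasFDerivAt (fun y : RN N => ‖y‖) (‖x‖⁻¹ • innerSL ℝ x) x := by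
  have hx' : ‖x‖ ^ 2 ≠ 0 := pow_ne_zero _ (norm_ne_zero_iff.2 hx)
  have h := (hasStrictFDerivAt_norm_sq x).hasFDerivAt.sqrt hx'
  simp only [Real.sqrt_sq (norm_nonneg _)] at h
  refine h.congr_fderiv ?_
  ext y
  simp only [smul_apply, smul_eq_mul, nsmul_eq_mul]
  have : ‖x‖ ≠ 0 := norm_ne_zero_iff.2 hx
  push_cast
  field_simp

lemma hasFDerivAt_radial {U : ℝ → ℝ} {U' : ℝ} {x : RN N} (hx : x ≠ 0)
    (hU : HasDerivAt U U' ‖x‖) :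
    HasFDerivAt (fun y : RN N => U ‖y‖) ((U' / ‖x‖) • innerSL ℝ x) x := by
  have h := hU.comp_hasFDerivAt x (hasFDerivAt_norm_of_ne_zero hx)
  rw [smul_smul] at h
  exact h

lemma norm_gradient (φ : RN N → ℝ) (x : RN N) : ‖gradient φ x‖ = ‖fderiv ℝ φ x‖ := by
  rw [gradient, LinearIsometryEquiv.norm_map]

lemma norm_gradient_radial {U : ℝ → ℝ} {U' : ℝ} {x : RN N} (hx : x ≠ 0)
    (hU : HasDerivAt U U' ‖x‖) : ‖gradient (fun y : RN N => U ‖y‖) x‖ = |U'| := by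
  have : ‖x‖ ≠ 0 := norm_ne_zero_iff.2 hx
  rw [norm_gradient, (hasFDerivAt_radial hx hU).fderiv, norm_smul, innerSL_apply_norm, norm_div,
    norm_norm, Real.norm_eq_abs]
  field_simp

/-- The gradient is `(V(|y|)/|y|) y`; differentiating this product separates the radial and the
tangential eigenvalue. -/
lemma hessianMatrix_radial {U V : ℝ → ℝ} {V' : ℝ} {x : RN N} (hx : x ≠ 0)
    (hU : ∀ᶠ r in 𝓝 ‖x‖, HasDerivAt U (V r) r) (hV : HasDerivAt V V' ‖x‖) :
    hessianMatrix (fun y : RN N => U ‖y‖) x =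
      radialMatrix (fun i => x i / ‖x‖) V' (V ‖x‖ / ‖x‖) := by
  have hx' : ‖x‖ ≠ 0 := norm_ne_zero_iff.2 hx
  have hev : fderiv ℝ (fun y : RN N => U ‖y‖) =ᶠ[𝓝 x]
      fun y => (V ‖y‖ / ‖y‖) • innerSL ℝ y := by
    filter_upwards [continuous_norm.continuousAt.eventually hU, isOpen_ne.mem_nhds hx]
      with y hy hy0
    exact (hasFDerivAt_radial hy0 hy).fderiv
  have h1 : HasDerivAt (fun r => V r / r) ((V' * ‖x‖ - V ‖x‖ * 1) / ‖x‖ ^ 2) ‖x‖ :=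
    hV.fun_div (hasDerivAt_id _) hx'
  have h2 := (hasFDerivAt_radial hx h1).fun_smul (innerSL ℝ (E := RN N)).hasFDerivAt
  ext i j
  rw [hessianMatrix, Matrix.of_apply, hev.fderiv_eq, h2.fderiv]
  have hs : ∀ i, innerSL ℝ x (EuclideanSpace.single i 1) = x i := fun i => by
    simp [innerSL_apply_apply, EuclideanSpace.inner_single_right]
  have hij : innerSL ℝ (EuclideanSpace.single i (1 : ℝ)) (EuclideanSpace.single j (1 : ℝ)) =
      (1 : Matrix (Fin N) (Fin N) ℝ) i j := by
    rw [innerSL_apply_apply, EuclideanSpace.inner_single_left]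
    simp [Matrix.one_apply]
  simp only [add_apply, smul_apply,
    ContinuousLinearMap.smulRight_apply, hs, hij, radialMatrix, Matrix.add_apply,
    Matrix.smul_apply, Matrix.vecMulVec_apply, smul_eq_mul]
  field_simp

lemma unit_dotProduct {x : RN N} (hx : x ≠ 0) :
    (fun i => x i / ‖x‖) ⬝ᵥ (fun i => x i / ‖x‖) = 1 := by
  have hx' : ‖x‖ ≠ 0 := norm_ne_zero_iff.2 hx
  have h := EuclideanSpace.real_norm_sq_eq x
  simp only [dotProduct, div_mul_div_comm]
  rw [← Finset.sum_div, div_eq_one_iff_eq (mul_ne_zero hx' hx'), ← pow_two, h]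
  exact Finset.sum_congr rfl fun i _ => (pow_two _).symm

/-- Second order necessary condition at a local minimum. -/
lemma IsLocalMin.fderiv_fderiv_nonneg {g : RN N → ℝ} {x : RN N} (hg : ContDiffAt ℝ 2 g x)
    (hmin : IsLocalMin g x) (h : RN N) : 0 ≤ fderiv ℝ (fderiv ℝ g) x h h := by
  by_contra! hneg
  let ℓ : ℝ → RN N := fun t => x + t • h
  have hℓ : ∀ t, HasDerivAt ℓ h t := fun t => by
    have h1 := ((hasDerivAt_id t).smul_const h).const_add x
    rw [one_smul] at h1
    exact h1
  have hℓ0 : ℓ 0 = x := by simp [ℓ]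
  have hℓc : Filter.Tendsto ℓ (𝓝 0) (𝓝 x) := by
    have := (hℓ 0).continuousAt.tendsto; rwa [hℓ0] at this
  have hdiff : ∀ᶠ y in 𝓝 x, DifferentiableAt ℝ g y := by
    filter_upwards [hg.eventually (by simp)] with y hy using hy.differentiableAt two_ne_zero
  have hd1 : ∀ᶠ t in 𝓝 (0 : ℝ), HasDerivAt (fun t => g (ℓ t)) (fderiv ℝ g (ℓ t) h) t := by
    filter_upwards [hℓc.eventually hdiff] with t ht
    exact ht.hasFDerivAt.comp_hasDerivAt t (hℓ t)
  have hd1' : deriv (fun t => g (ℓ t)) =ᶠ[𝓝 0] fun t => fderiv ℝ g (ℓ t) h :=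
    hd1.mono fun t ht => ht.deriv
  have hD : DifferentiableAt ℝ (fderiv ℝ g) x :=
    (hg.fderiv_right (m := 1) (by norm_num)).differentiableAt one_ne_zero
  have hd2 : HasDerivAt (fun t => fderiv ℝ g (ℓ t) h) (fderiv ℝ (fderiv ℝ g) x h h) 0 := by
    have h1 : HasFDerivAt (fderiv ℝ g) (fderiv ℝ (fderiv ℝ g) x) (ℓ 0) := by
      rw [hℓ0]; exact hD.hasFDerivAt
    have h2 := h1.comp_hasDerivAt 0 (hℓ 0)
    exact ((ContinuousLinearMap.apply ℝ ℝ h).hasFDerivAt (x := fderiv ℝ g (ℓ 0))).comp_hasDerivAt 0 h2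
  have hdd : deriv (deriv fun t => g (ℓ t)) 0 = fderiv ℝ (fderiv ℝ g) x h h := by
    rw [hd1'.deriv_eq, hd2.deriv]
  have hmin' : IsLocalMin (fun t => g (ℓ t)) 0 := by
    have := hℓc.eventually hmin
    filter_upwards [this] with t ht
    rw [hℓ0]; exact ht
  -- A negative second derivative would make the minimum along the line a maximum too, so `g` would
  -- be constant along it near `x`, with zero second derivative.
  have hmax : IsLocalMax (fun t => g (ℓ t)) 0 :=
    isLocalMax_of_deriv_deriv_neg (by rw [hdd]; exact hneg) hmin'.deriv_eq_zero
      hd1.self_of_nhds.continuousAt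
  have hconst : (fun t => g (ℓ t)) =ᶠ[𝓝 0] fun _ => g (ℓ 0) := by
    filter_upwards [hmin', hmax] with t h1 h2 using le_antisymm h2 h1
  have h3 : deriv (fun t => g (ℓ t)) =ᶠ[𝓝 0] fun _ => 0 := by
    filter_upwards [hconst.eventuallyEq_nhds] with t ht
    rw [ht.deriv_eq, deriv_const]
  rw [h3.deriv_eq, deriv_const] at hdd
  linarith

lemma isSymm_hessianMatrix {g : RN N → ℝ} {x : RN N} (hg : ContDiffAt ℝ 2 g x) :
    (hessianMatrix g x).IsSymm := by
  ext i j
  exact hg.isSymmSndFDerivAt (by simp) _ _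

lemma IsLocalMin.posSemidef_hessianMatrix {g : RN N → ℝ} {x : RN N} (hg : ContDiffAt ℝ 2 g x)
    (hmin : IsLocalMin g x) : (hessianMatrix g x).PosSemidef := by
  refine Matrix.PosSemidef.of_dotProduct_mulVec_nonneg ?_ fun v => ?_
  · rw [Matrix.IsHermitian, Matrix.conjTranspose_eq_transpose_of_trivial]
    exact isSymm_hessianMatrix hg
  · have h := hmin.fderiv_fderiv_nonneg hg (∑ i, v i • EuclideanSpace.single i 1)
    simp only [map_sum, map_smul, sum_apply,
      smul_apply, smul_eq_mul] at h
    refine h.trans_eq ?_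
    simp only [dotProduct, Matrix.mulVec, hessianMatrix, Matrix.of_apply, star_trivial,
      Finset.mul_sum]
    rw [Finset.sum_comm]
    refine Finset.sum_congr rfl fun i _ => Finset.sum_congr rfl fun j _ => by ring

lemma hessianMatrix_sub {g h : RN N → ℝ} {x : RN N} (hg : ContDiffAt ℝ 2 g x)
    (hh : ContDiffAt ℝ 2 h x) :
    hessianMatrix (fun y => g y - h y) x = hessianMatrix g x - hessianMatrix h x := by
  have hd : ∀ {g : RN N → ℝ}, ContDiffAt ℝ 2 g x → ∀ᶠ y in 𝓝 x, DifferentiableAt ℝ g y :=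
    fun hg => by
      filter_upwards [hg.eventually (by simp)] with y hy using hy.differentiableAt two_ne_zero
  have hev : fderiv ℝ (fun y => g y - h y) =ᶠ[𝓝 x] fun y => fderiv ℝ g y - fderiv ℝ h y := by
    filter_upwards [hd hg, hd hh] with y h1 h2 using fderiv_fun_sub h1 h2
  have hD : ∀ {g : RN N → ℝ}, ContDiffAt ℝ 2 g x → DifferentiableAt ℝ (fderiv ℝ g) x := fun hg =>
    (hg.fderiv_right (m := 1) (by norm_num)).differentiableAt one_ne_zero
  ext i j
  simp only [hessianMatrix, Matrix.of_apply, Matrix.sub_apply]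
  rw [hev.fderiv_eq, fderiv_fun_sub (hD hg) (hD hh)]
  rfl

lemma IsUniformlyElliptic.le_of_isLocalMin {lam Lam : ℝ} (hlam : 0 ≤ lam)
    {F : Matrix (Fin N) (Fin N) ℝ → ℝ} (hF : IsUniformlyElliptic lam Lam F) {g h : RN N → ℝ}
    {x : RN N} (hg : ContDiffAt ℝ 2 g x) (hh : ContDiffAt ℝ 2 h x)
    (hmin : IsLocalMin (fun y => g y - h y) x) :
    F (hessianMatrix h x) ≤ F (hessianMatrix g x) := by
  have hpos := hmin.posSemidef_hessianMatrix (hg.sub hh)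
  rw [hessianMatrix_sub hg hh] at hpos
  have h1 := (hF _ _ (isSymm_hessianMatrix hh) hpos).1
  rw [add_sub_cancel] at h1
  have h2 : 0 ≤ (hessianMatrix g x - hessianMatrix h x).trace :=
    Finset.sum_nonneg fun i _ => hpos.diag_nonneg
  have := mul_nonneg hlam h2
  linarith

end

/-! ### Viscosity solutions and the radial equation -/

/-- `U' = |w|^a w` on `(0,1)` with `w` of class `C¹`. -/
structure IsC1αProfile (a : ℝ) (U w : ℝ → ℝ) : Prop where
  hasDerivAt : ∀ r ∈ Ioo (0 : ℝ) 1, HasDerivAt U (signedPow a (w r)) r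
  contDiffOn : ContDiffOn ℝ 1 w (Ioo 0 1)

section
variable {a : ℝ} {U w : ℝ → ℝ}

lemma IsC1αProfile.differentiableAt (h : IsC1αProfile a U w) {r : ℝ} (hr : r ∈ Ioo (0 : ℝ) 1) :
    DifferentiableAt ℝ w r :=
  (h.contDiffOn.contDiffAt (isOpen_Ioo.mem_nhds hr)).differentiableAt one_ne_zero

lemma IsC1αProfile.continuousOn_deriv (h : IsC1αProfile a U w) :
    ContinuousOn (deriv w) (Ioo 0 1) :=
  h.contDiffOn.continuousOn_deriv_of_isOpen isOpen_Ioo le_rfl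

/-- The odd power is smooth away from `0`, so `U' = |w|^a w` is `C¹` on the open set where `w` does
not vanish. -/
lemma IsC1αProfile.contDiffAt_two (h : IsC1αProfile a U w) {r : ℝ} (hr : r ∈ Ioo (0 : ℝ) 1)
    (hw : w r ≠ 0) : ContDiffAt ℝ 2 U r := by
  have hO : IsOpen (Ioo (0 : ℝ) 1 ∩ w ⁻¹' {0}ᶜ) :=
    h.contDiffOn.continuousOn.isOpen_inter_preimage isOpen_Ioo isOpen_compl_singleton
  have h2 : ContDiffOn ℝ (1 + 1) U (Ioo (0 : ℝ) 1 ∩ w ⁻¹' {0}ᶜ) := by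
    rw [contDiffOn_succ_iff_deriv_of_isOpen hO]
    refine ⟨fun x hx => (h.hasDerivAt x hx.1).differentiableAt.differentiableWithinAt, by simp,
      ?_⟩
    refine ContDiffOn.congr (f := fun x => signedPow a (w x)) (fun x hx => ?_)
      fun x hx => (h.hasDerivAt x hx.1).deriv
    have h3 : ContDiffAt ℝ 1 (signedPow a) (w x) :=
      contDiffAt_signedPow (n := 1) hx.2
    exact (h3.comp x (h.contDiffOn.contDiffAt (isOpen_Ioo.mem_nhds hx.1))).contDiffWithinAt
  have h3 := h2.contDiffAt (hO.mem_nhds ⟨hr, hw⟩)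
  rwa [one_add_one_eq_two] at h3

end

section
variable {N : ℕ} {α a lam Lam : ℝ} {F : Matrix (Fin N) (Fin N) ℝ → ℝ} {U w : ℝ → ℝ}

lemma norm_mem_Ioo {x : RN N} (hx : x ∈ puncturedBall N) : ‖x‖ ∈ Ioo (0 : ℝ) 1 :=
  ⟨norm_pos_iff.2 hx.2, mem_ball_zero_iff.1 hx.1⟩

lemma isOpen_puncturedBall : IsOpen (puncturedBall N) :=
  isOpen_ball.sdiff isClosed_singleton

lemma IsC1αProfile.contDiffAt_radial (h : IsC1αProfile a U w) {x : RN N}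
    (hx : x ∈ puncturedBall N) (hw : w ‖x‖ ≠ 0) :
    ContDiffAt ℝ 2 (fun y : RN N => U ‖y‖) x :=
  (h.contDiffAt_two (norm_mem_Ioo hx) hw).comp x (contDiffAt_norm ℝ hx.2)

/-- The operator evaluated at a radial function with nonvanishing gradient. -/
lemma IsC1αProfile.operator_eq (h : IsC1αProfile a U w) (haα : (1 + a) * (1 + α) = 1)
    (hα : -1 < α) (hFrot : IsRotationInvariant F) (hFhom : IsPosHomogeneous F) (i : Fin N)
    {x : RN N} (hx : x ∈ puncturedBall N) (hw : w ‖x‖ ≠ 0) :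
    ‖gradient (fun y : RN N => U ‖y‖) x‖ ^ α * F (hessianMatrix (fun y : RN N => U ‖y‖) x) =
      F (axisMatrix i (deriv w ‖x‖ / (1 + α)) (w ‖x‖ / ‖x‖)) := by
  have hr := norm_mem_Ioo hx
  have hV : HasDerivAt (fun r => signedPow a (w r)) ((1 + a) * |w ‖x‖| ^ a * deriv w ‖x‖) ‖x‖ :=
    (hasDerivAt_signedPow hw).comp ‖x‖ (h.differentiableAt hr).hasDerivAt
  have ha : -1 < a := by
    have : 0 < 1 + a := pos_of_mul_pos_left (by rw [haα]; exact one_pos) (by linarith)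
    linarith
  have hw0 : 0 < |w ‖x‖| := abs_pos.2 hw
  rw [norm_gradient_radial hx.2 (h.hasDerivAt _ hr),
    hessianMatrix_radial (V := fun r => signedPow a (w r)) hx.2
      (Filter.mem_of_superset (Ioo_mem_nhds hr.1 hr.2) h.hasDerivAt) hV,
    hFrot.apply_radialMatrix i (unit_dotProduct hx.2)]
  have hpos : 0 < |signedPow a (w ‖x‖)| ^ α :=
    Real.rpow_pos_of_pos (abs_pos.2 (mt signedPow_eq_zero.1 hw)) _
  rw [← hFhom _ _ (isSymm_axisMatrix i _ _) hpos]
  congr 1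
  have h1 : |signedPow a (w ‖x‖)| ^ α * signedPow a (w ‖x‖) = w ‖x‖ :=
    signedPow_signedPow haα _
  -- The powers of `|w|` cancel because `(1+a)α + a = (1+a)(1+α) - 1 = 0`.
  have h2 : |signedPow a (w ‖x‖)| ^ α * ((1 + a) * |w ‖x‖| ^ a * deriv w ‖x‖) =
      deriv w ‖x‖ / (1 + α) := by
    rw [abs_signedPow ha, ← Real.rpow_mul hw0.le,
      show |w ‖x‖| ^ ((1 + a) * α) * ((1 + a) * |w ‖x‖| ^ a * deriv w ‖x‖) =
        (|w ‖x‖| ^ ((1 + a) * α) * |w ‖x‖| ^ a) * (1 + a) * deriv w ‖x‖ by ring,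
      ← Real.rpow_add hw0, show (1 + a) * α + a = 0 by linarith, Real.rpow_zero, one_mul,
      eq_div_iff (by linarith)]
    linear_combination deriv w ‖x‖ * haα
  simp only [axisMatrix, ← Matrix.diagonal_smul]
  congr 1; ext j
  simp only [Pi.smul_apply, smul_eq_mul]
  split_ifs
  · exact h2
  · rw [← mul_div_assoc, h1]

lemma IsC1αProfile.eventually_eq_zero (h : IsC1αProfile a U w) {u : RN N → ℝ}
    (hu : ∀ x ∈ puncturedBall N, u x = U ‖x‖) {x : RN N} (hx : x ∈ puncturedBall N)
    (hconst : ∀ᶠ y in 𝓝 x, u y = u x) : ∀ᶠ r in 𝓝 ‖x‖, w r = 0 := by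
  have hr := norm_mem_Ioo hx
  have hx' : ‖x‖ ≠ 0 := hr.1.ne'
  have hc : Filter.Tendsto (fun r : ℝ => (r / ‖x‖) • x) (𝓝 ‖x‖) (𝓝 x) := by
    have : Continuous fun r : ℝ => (r / ‖x‖) • x := by fun_prop
    have h1 := this.tendsto ‖x‖
    rwa [div_self hx', one_smul] at h1
  have hU : U =ᶠ[𝓝 ‖x‖] fun _ => u x := by
    filter_upwards [hc.eventually hconst, hc.eventually (isOpen_puncturedBall.mem_nhds hx),
      lt_mem_nhds hr.1] with r h1 h2 h3
    rw [hu _ h2, norm_smul, Real.norm_eq_abs, abs_of_pos (div_pos h3 hr.1),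
      div_mul_cancel₀ _ hx'] at h1
    exact h1
  filter_upwards [hU.eventuallyEq_nhds, Ioo_mem_nhds hr.1 hr.2] with r h1 h2
  have h3 := h1.deriv_eq
  rw [(h.hasDerivAt r h2).deriv, deriv_const] at h3
  exact signedPow_eq_zero.1 h3

/-- A profile of class `C_{1,α}` that solves the radial equation defines a viscosity solution. -/
lemma IsC1αProfile.isViscSolution (h : IsC1αProfile a U w) (haα : (1 + a) * (1 + α) = 1)
    (hα : -1 < α) (hlam : 0 ≤ lam) (hFell : IsUniformlyElliptic lam Lam F)
    (hFrot : IsRotationInvariant F) (hFhom : IsPosHomogeneous F) (i : Fin N) {u : RN N → ℝ}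
    (hu : ∀ x ∈ puncturedBall N, u x = U ‖x‖) {g : RN N → ℝ → ℝ}
    (hg : ∀ x ∈ puncturedBall N,
      F (axisMatrix i (deriv w ‖x‖ / (1 + α)) (w ‖x‖ / ‖x‖)) = g x (u x)) :
    IsViscSolution α F g (puncturedBall N) u := by
  have hF0 : F (axisMatrix i 0 0) = 0 := (isRadialOperator hFell hFhom i).zero
  have hcont : ContinuousOn u (puncturedBall N) := by
    refine ContinuousOn.congr (f := fun x => U ‖x‖) (fun x hx => ?_) hu
    exact ((h.hasDerivAt _ (norm_mem_Ioo hx)).continuousAt.comp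
      continuous_norm.continuousAt).continuousWithinAt
  have hconst : ∀ x₀ ∈ puncturedBall N, ∀ δ > 0, ball x₀ δ ⊆ puncturedBall N →
      (∀ x ∈ ball x₀ δ, u x = u x₀) → ∀ x ∈ ball x₀ δ, g x (u x₀) = 0 := by
    intro x₀ hx₀ δ hδ hsub hc x hx
    have hw := h.eventually_eq_zero hu (hsub hx) (by
      filter_upwards [isOpen_ball.mem_nhds hx] with y hy
      rw [hc y hy, hc x hx])
    have hw' : w =ᶠ[𝓝 ‖x‖] fun _ => 0 := hw
    rw [← hc x hx, ← hg x (hsub hx), hw'.deriv_eq, deriv_const, hw.self_of_nhds, zero_div,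
      zero_div, hF0]
  have hev : ∀ x₀ ∈ puncturedBall N, u =ᶠ[𝓝 x₀] fun x => U ‖x‖ := fun x₀ hx₀ => by
    filter_upwards [isOpen_puncturedBall.mem_nhds hx₀] with x hx using hu x hx
  -- Since `u` is differentiable, a touching function shares its gradient. Admissible tests
  -- therefore occur only where `w ≠ 0`, and there `U` is `C²` and Hessians can be compared.
  have htouch : ∀ x₀ ∈ puncturedBall N, ∀ φ : RN N → ℝ, ContDiffAt ℝ 2 φ x₀ →
      IsLocalExtr (fun x => u x - φ x) x₀ → gradient φ x₀ ≠ 0 →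
      gradient φ x₀ = gradient (fun y : RN N => U ‖y‖) x₀ ∧ w ‖x₀‖ ≠ 0 := by
    intro x₀ hx₀ φ hφ hext hne
    have hd := (hasFDerivAt_radial hx₀.2 (h.hasDerivAt _ (norm_mem_Ioo hx₀)))
    have hd' := hd.congr_of_eventuallyEq (hev x₀ hx₀)
    have h1 := hext.hasFDerivAt_eq_zero (hd'.fun_sub (hφ.differentiableAt two_ne_zero).hasFDerivAt)
    have h2 : gradient φ x₀ = gradient (fun y : RN N => U ‖y‖) x₀ := by
      rw [gradient, gradient, hd.fderiv, sub_eq_zero.1 h1]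
    refine ⟨h2, fun hw => hne ?_⟩
    rw [h2, ← norm_eq_zero, norm_gradient_radial hx₀.2 (h.hasDerivAt _ (norm_mem_Ioo hx₀)), hw,
      signedPow_zero, abs_zero]
  refine ⟨⟨hcont, fun x₀ hx₀ => ⟨fun δ hδ hsub hc x hx => (hconst x₀ hx₀ δ hδ hsub hc x hx).le,
    fun φ hφ hmax hne => ?_⟩⟩, ⟨hcont, fun x₀ hx₀ => ⟨fun δ hδ hsub hc x hx =>
    (hconst x₀ hx₀ δ hδ hsub hc x hx).ge, fun φ hφ hmin hne => ?_⟩⟩⟩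
  · obtain ⟨hgrad, hw⟩ := htouch x₀ hx₀ φ hφ (Or.inr hmax) hne
    rw [← hg x₀ hx₀, ← h.operator_eq haα hα hFrot hFhom i hx₀ hw, hgrad]
    refine mul_le_mul_of_nonneg_left ?_ (Real.rpow_nonneg (norm_nonneg _) _)
    refine hFell.le_of_isLocalMin hlam hφ (h.contDiffAt_radial hx₀ hw) ?_
    filter_upwards [hmax, hev x₀ hx₀] with x h1 h2
    rw [h2, hu x₀ hx₀] at h1
    linarith
  · obtain ⟨hgrad, hw⟩ := htouch x₀ hx₀ φ hφ (Or.inl hmin) hne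
    rw [← hg x₀ hx₀, ← h.operator_eq haα hα hFrot hFhom i hx₀ hw, hgrad]
    refine mul_le_mul_of_nonneg_left ?_ (Real.rpow_nonneg (norm_nonneg _) _)
    refine hFell.le_of_isLocalMin hlam (h.contDiffAt_radial hx₀ hw) hφ ?_
    filter_upwards [hmin, hev x₀ hx₀] with x h1 h2
    rw [h2, hu x₀ hx₀] at h1
    exact h1

/-- The profile of a viscosity solution of class `C_{1,α}` solves the radial equation. -/
lemma IsC1αProfile.equation_of_isViscSolution (h : IsC1αProfile a U w)
    (haα : (1 + a) * (1 + α) = 1) (hα : -1 < α) (hlam : 0 < lam) (hN : 1 ≤ N)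
    (hFell : IsUniformlyElliptic lam Lam F)
    (hFrot : IsRotationInvariant F) (hFhom : IsPosHomogeneous F) (i : Fin N) {u : RN N → ℝ}
    (hu : ∀ x ∈ puncturedBall N, u x = U ‖x‖) {g : RN N → ℝ → ℝ} {k : ℝ → ℝ}
    (hk : ContinuousOn k (Ioo 0 1))
    (hg : ∀ x ∈ puncturedBall N, g x (u x) = k ‖x‖)
    (hvisc : IsViscSolution α F g (puncturedBall N) u) :
    ∀ r ∈ Ioo (0 : ℝ) 1, F (axisMatrix i (deriv w r / (1 + α)) (w r / r)) = k r := by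
  have hG := isRadialOperator hFell hFhom i
  have hF0 : F (axisMatrix i 0 0) = 0 := hG.zero
  have hpt : ∀ r ∈ Ioo (0 : ℝ) 1, ∃ x ∈ puncturedBall N, ‖x‖ = r := fun r hr => by
    have hn : ‖(EuclideanSpace.single i r : RN N)‖ = r := by
      simp [abs_of_pos hr.1]
    refine ⟨EuclideanSpace.single i r, ⟨?_, ?_⟩, hn⟩
    · rw [mem_ball_zero_iff, hn]; exact hr.2
    · rw [mem_singleton_iff, ← norm_eq_zero, hn]; exact hr.1.ne'
  -- Where `w ≠ 0`, `u` is itself an admissible test function from both sides.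
  have hne : ∀ r ∈ Ioo (0 : ℝ) 1, w r ≠ 0 →
      F (axisMatrix i (deriv w r / (1 + α)) (w r / r)) = k r := by
    intro r hr hw
    obtain ⟨x, hx, rfl⟩ := hpt r hr
    have hC := h.contDiffAt_radial hx hw
    have hz : (fun y => u y - U ‖y‖) =ᶠ[𝓝 x] fun _ => 0 := by
      filter_upwards [isOpen_puncturedBall.mem_nhds hx] with y hy
      rw [hu y hy, sub_self]
    have hgr : gradient (fun y : RN N => U ‖y‖) x ≠ 0 := by
      rw [Ne, ← norm_eq_zero, norm_gradient_radial hx.2 (h.hasDerivAt _ hr), abs_eq_zero,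
        signedPow_eq_zero]
      exact hw
    have h1 := (hvisc.1.2 x hx).2 _ hC
      (hz.mono fun y hy => by simp only [hy, hz.self_of_nhds, le_refl]) hgr
    have h2 := (hvisc.2.2 x hx).2 _ hC
      (hz.mono fun y hy => by simp only [hy, hz.self_of_nhds, le_refl]) hgr
    rw [h.operator_eq haα hα hFrot hFhom i hx hw, hg x hx] at h1 h2
    exact le_antisymm h2 h1
  intro r hr
  by_cases hev : ∀ᶠ t in 𝓝 r, w t = 0
  -- Inside the zero set of `w`, `u` is constant on a ball and no test function is admissible; the
  -- clause on balls of constancy gives `k = 0`.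
  · obtain ⟨x, hx, rfl⟩ := hpt r hr
    have hw' : w =ᶠ[𝓝 ‖x‖] fun _ => 0 := hev
    rw [hw'.deriv_eq, deriv_const, hev.self_of_nhds, zero_div, zero_div, hF0]
    obtain ⟨ε, hε, hball⟩ := Metric.eventually_nhds_iff_ball.1
      (hev.and (Ioo_mem_nhds hr.1 hr.2))
    have hUc : ∀ t ∈ ball ‖x‖ ε, U t = U ‖x‖ := fun t ht => by
      have hd : ∀ t ∈ ball ‖x‖ ε, HasDerivAt U 0 t := fun t ht => by
        have := h.hasDerivAt t (hball t ht).2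
        rwa [(hball t ht).1, signedPow_zero] at this
      refine isOpen_ball.is_const_of_deriv_eq_zero (convex_ball _ _).isPreconnected
        (fun t ht => (hd t ht).differentiableAt.differentiableWithinAt)
        (fun t ht => (hd t ht).deriv) ht (mem_ball_self hε)
    obtain ⟨δ, hδ, hsub⟩ := Metric.isOpen_iff.1 isOpen_puncturedBall x hx
    have hsub' : ball x (min δ ε) ⊆ puncturedBall N := (ball_subset_ball (min_le_left _ _)).trans hsub
    have hc : ∀ y ∈ ball x (min δ ε), u y = u x := fun y hy => by
      rw [hu y (hsub' hy), hu x hx]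
      refine hUc _ ?_
      rw [mem_ball, Real.dist_eq]
      have := (abs_norm_sub_norm_le y x)
      rw [mem_ball, dist_eq_norm] at hy
      exact this.trans_lt (hy.trans_le (min_le_right _ _))
    have hmem : x ∈ ball x (min δ ε) := mem_ball_self (lt_min hδ hε)
    have h1 := (hvisc.1.2 x hx).1 _ (lt_min hδ hε) hsub' hc x hmem
    have h2 := (hvisc.2.2 x hx).1 _ (lt_min hδ hε) hsub' hc x hmem
    rw [hg x hx] at h1 h2
    exact le_antisymm h2 h1
  -- Otherwise `r` is a limit of points with `w ≠ 0`, and the equation passes to the limit because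
  -- `w` is `C¹`.
  · have hfreq : ∃ᶠ t in 𝓝 r, w t ≠ 0 := Filter.not_eventually.1 hev
    have hd : 0 ≤ (N : ℝ) - 1 := by
      have : (1 : ℝ) ≤ N := by exact_mod_cast hN
      linarith
    have hcont : ContinuousAt (fun t => F (axisMatrix i (deriv w t / (1 + α)) (w t / t)) - k t) r := by
      refine ContinuousAt.sub ?_ (hk.continuousAt (isOpen_Ioo.mem_nhds hr))
      have hp : ContinuousAt (fun t => (deriv w t / (1 + α), w t / t)) r :=
        ((h.continuousOn_deriv.continuousAt (isOpen_Ioo.mem_nhds hr)).div_const _).prodMk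
          ((h.differentiableAt hr).continuousAt.div continuousAt_id hr.1.ne')
      exact ContinuousAt.comp (g := fun x : ℝ × ℝ => F (axisMatrix i x.1 x.2))
        (hG.continuous hlam hd).continuousAt hp
    by_contra hcon
    have h1 := hcont.eventually_ne (sub_ne_zero.2 hcon)
    obtain ⟨t, ht1, ht2, ht3⟩ := (hfreq.and_eventually
      (h1.and (Ioo_mem_nhds hr.1 hr.2))).exists
    exact ht2 (sub_eq_zero.2 (hne t ht3 ht1))

end

/-! ### Bounded radial solutions -/

/-- `Q` is recovered from the Lipschitz map `z - Q / L`. -/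
lemma IsDissipative.continuous {q L C : ℝ} {Q : ℝ → ℝ → ℝ} (hQ : IsDissipative q L C Q)
    (hq : 0 < q) : Continuous fun p : ℝ × ℝ => Q p.1 p.2 := by
  have hL : 0 < L := hq.trans_le hQ.q_le_L
  have h1 := continuous_uncurry_of_lip (R := fun z k => z - Q z k / L)
    (hQ.contraction hL le_rfl)
  have h2 : (fun p : ℝ × ℝ => Q p.1 p.2) = fun p => L * (p.1 - (p.1 - Q p.1 p.2 / L)) := by
    ext p; field_simp; ring
  rw [h2]
  exact continuous_const.mul (continuous_fst.sub h1)

lemma contDiffOn_one_of_hasDerivAt {f f' : ℝ → ℝ} {S : Set ℝ} (hS : IsOpen S)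
    (hf : ∀ r ∈ S, HasDerivAt f (f' r) r) (hf' : ContinuousOn f' S) :
    ContDiffOn ℝ 1 f S := by
  have h : ContDiffOn ℝ (0 + 1) f S := by
    rw [contDiffOn_succ_iff_deriv_of_isOpen hS]
    refine ⟨fun r hr => (hf r hr).differentiableAt.differentiableWithinAt, by simp, ?_⟩
    rw [contDiffOn_zero]
    exact hf'.congr fun r hr => (hf r hr).deriv
  rwa [zero_add] at h

/-- The standing assumptions on the operator and the exponents. -/
structure IsRadialProblem {N : ℕ} (lam Lam α γ : ℝ) (F : Matrix (Fin N) (Fin N) ℝ → ℝ) :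
    Prop where
  lam_pos : 0 < lam
  lam_le : lam ≤ Lam
  dim : 2 < lam / Lam * ((N : ℝ) - 1) + 1
  neg_one_lt : -1 < α
  exponent : γ < 2 + α
  elliptic : IsUniformlyElliptic lam Lam F
  homogeneous : IsPosHomogeneous F
  rotation : IsRotationInvariant F

namespace IsRadialProblem

section
variable {N : ℕ} {lam Lam α γ : ℝ} {F : Matrix (Fin N) (Fin N) ℝ → ℝ}

lemma Lam_pos (h : IsRadialProblem lam Lam α γ F) : 0 < Lam := h.lam_pos.trans_le h.lam_le

lemma one_lt (h : IsRadialProblem lam Lam α γ F) : 1 < ((N : ℝ) - 1) * lam / Lam := by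
  have := h.dim
  rw [show ((N : ℝ) - 1) * lam / Lam = lam / Lam * ((N : ℝ) - 1) by ring]
  linarith

lemma sub_one_nonneg (h : IsRadialProblem lam Lam α γ F) : 0 ≤ (N : ℝ) - 1 := by
  have h1 := h.one_lt
  rw [lt_div_iff₀ h.Lam_pos, one_mul] at h1
  exact (pos_of_mul_pos_left (h.Lam_pos.trans h1) h.lam_pos.le).le

lemma one_le_dim (h : IsRadialProblem lam Lam α γ F) : 1 ≤ N := by
  have := h.sub_one_nonneg
  exact_mod_cast (by linarith : (1 : ℝ) ≤ N)

/-- A coordinate axis. -/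
def axis (h : IsRadialProblem lam Lam α γ F) : Fin N := ⟨0, h.one_le_dim⟩

/-- The operator on radial Hessians. -/
def op (h : IsRadialProblem lam Lam α γ F) (m p : ℝ) : ℝ := F (axisMatrix h.axis m p)

/-- The nonlinearity of the radial equation. -/
def nonlin (h : IsRadialProblem lam Lam α γ F) : ℝ → ℝ → ℝ := radialNonlinearity α γ h.op

lemma isRadialOperator_op (h : IsRadialProblem lam Lam α γ F) :
    IsRadialOperator lam Lam (N - 1) h.op :=
  isRadialOperator h.elliptic h.homogeneous h.axis

lemma one_add_pos (h : IsRadialProblem lam Lam α γ F) : 0 < 1 + α := by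
  have := h.neg_one_lt; linarith

lemma isDissipative (h : IsRadialProblem lam Lam α γ F) :
    IsDissipative ((1 - γ) + (1 + α) * (((N : ℝ) - 1) * lam / Lam))
      ((1 - γ) + (1 + α) * (((N : ℝ) - 1) * Lam / lam)) ((1 + α) / lam) h.nonlin :=
  h.isRadialOperator_op.isDissipative h.lam_pos h.Lam_pos h.sub_one_nonneg h.neg_one_lt

lemma q_pos (h : IsRadialProblem lam Lam α γ F) :
    0 < (1 - γ) + (1 + α) * (((N : ℝ) - 1) * lam / Lam) := by
  have h1 := mul_lt_mul_of_pos_left h.one_lt h.one_add_pos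
  have h2 := h.exponent
  linarith

lemma C_nonneg (h : IsRadialProblem lam Lam α γ F) : 0 ≤ (1 + α) / lam :=
  div_nonneg h.one_add_pos.le h.lam_pos.le

lemma root_gt (h : IsRadialProblem lam Lam α γ F) : -1 < (1 + α)⁻¹ - 1 := by
  have := inv_pos.2 h.one_add_pos; linarith

lemma root_mul (h : IsRadialProblem lam Lam α γ F) : (1 + ((1 + α)⁻¹ - 1)) * (1 + α) = 1 := by
  rw [add_sub_cancel, inv_mul_cancel₀ h.one_add_pos.ne']

lemma s_pos (h : IsRadialProblem lam Lam α γ F) : 0 < (2 + α - γ) / (1 + α) :=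
  div_pos (by linarith [h.exponent]) h.one_add_pos

/-- This amounts to `2 + α - γ ≤ q`, a consequence of `(N-1) lam / Lam > 1`. It is the threshold at
which an unbounded `z` makes `U'` at least as singular as `1/r`. -/
lemma s_le (h : IsRadialProblem lam Lam α γ F) : (2 + α - γ) / (1 + α) ≤
    ((1 - γ) + (1 + α) * (((N : ℝ) - 1) * lam / Lam)) * (1 + ((1 + α)⁻¹ - 1)) := by
  rw [add_sub_cancel, ← div_eq_mul_inv]
  refine div_le_div_of_nonneg_right ?_ h.one_add_pos.le
  have h1 := mul_lt_mul_of_pos_left h.one_lt h.one_add_pos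
  linarith

/-- Rewrites `u' = |w|^a w` with `w = r^{1-γ} z`; the exponent `s` comes from `(1-γ)/(1+α) = s - 1`.
-/
lemma signedPow_scale (h : IsRadialProblem lam Lam α γ F) {r : ℝ} (hr : 0 < r) (z : ℝ) :
    signedPow ((1 + α)⁻¹ - 1) (r ^ (1 - γ) * z) =
      r ^ ((2 + α - γ) / (1 + α) - 1) * signedPow ((1 + α)⁻¹ - 1) z := by
  rw [signedPow_mul (Real.rpow_pos_of_pos hr _), ← Real.rpow_mul hr.le]
  congr 2
  have := h.one_add_pos.ne'
  field_simp
  ring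

/-- `(V, z)` is the profile of a bounded radial solution. -/
structure IsSolutionProfile (h : IsRadialProblem lam Lam α γ F) (β b : ℝ) (f V z : ℝ → ℝ) :
    Prop where
  continuousOn : ContinuousOn V (Icc 0 1)
  boundary : V 1 = b
  isProfile : IsProfile ((1 + α)⁻¹ - 1) ((2 + α - γ) / (1 + α)) h.nonlin
    (fun r => β * signedPow α (V r) + f r) V z

lemma IsSolutionProfile.exists_bound {h : IsRadialProblem lam Lam α γ F} {β b : ℝ}
    {f V z : ℝ → ℝ} (hV : h.IsSolutionProfile β b f V z)
    (hf : ∃ B, ∀ r ∈ Ico (0 : ℝ) 1, |f r| ≤ B) :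
    ∃ Z K, (∀ r ∈ Ioo (0 : ℝ) 1, |z r| ≤ Z) ∧
      ∀ r ∈ Ioo (0 : ℝ) 1, |β * signedPow α (V r) + f r| ≤ K := by
  obtain ⟨B, hB⟩ := isCompact_Icc.exists_bound_of_continuousOn hV.continuousOn
  obtain ⟨B', hB'⟩ := isCompact_Icc.exists_bound_of_continuousOn
    (continuousOn_const.mul ((continuous_signedPow h.neg_one_lt).comp_continuousOn
      hV.continuousOn) : ContinuousOn (fun r => β * signedPow α (V r)) (Icc 0 1))
  obtain ⟨Kf, hKf⟩ := hf
  have hk : ∀ r ∈ Ioo (0 : ℝ) 1, |β * signedPow α (V r) + f r| ≤ B' + Kf := fun r hr =>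
    (abs_add_le _ _).trans (add_le_add (hB' r (Ioo_subset_Icc_self hr))
      (hKf r (Ioo_subset_Ico_self hr)))
  exact ⟨_, _, hV.isProfile.abs_le_of_bounded h.root_gt h.q_pos h.s_le h.isDissipative hk
    (fun r hr => hB r (Ioo_subset_Icc_self hr)) h.C_nonneg, hk⟩

lemma exists_isSolutionProfile (h : IsRadialProblem lam Lam α γ F) {β : ℝ} (hβ : 0 ≤ β) (b : ℝ)
    {f : ℝ → ℝ} (hf : ContinuousOn f (Ico 0 1)) (hfB : ∃ B, ∀ r ∈ Ico (0 : ℝ) 1, |f r| ≤ B) :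
    ∃ V z, h.IsSolutionProfile β b f V z := by
  obtain ⟨V, z, h1, h2, h3⟩ := exists_profile h.neg_one_lt hβ h.root_gt h.s_pos h.q_pos h.C_nonneg
    h.isDissipative hf hfB b
  exact ⟨V, z, h1, h2, h3⟩

/-- A solution profile defines a bounded radial solution. -/
lemma IsSolutionProfile.isBoundedRadialSolution {h : IsRadialProblem lam Lam α γ F} {β b : ℝ}
    {f : RN N → ℝ} {f₀ V z : ℝ → ℝ} (hV : h.IsSolutionProfile β b f₀ V z)
    (hf : ∀ x ∈ ball (0 : RN N) 1, f x = f₀ ‖x‖) (hf₀ : ContinuousOn f₀ (Ico 0 1)) :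
    IsBoundedRadialSolution α γ β b F f fun x => V ‖x‖ := by
  set a := (1 + α)⁻¹ - 1
  set k : ℝ → ℝ := fun r => β * signedPow α (V r) + f₀ r
  set w : ℝ → ℝ := fun r => r ^ (1 - γ) * z r
  have hzc : ContinuousOn z (Ioo 0 1) := fun r hr =>
    (hV.isProfile r hr).2.continuousAt.continuousWithinAt
  have hkc : ContinuousOn k (Ioo 0 1) :=
    (continuousOn_const.mul ((continuous_signedPow h.neg_one_lt).comp_continuousOn
      (hV.continuousOn.mono Ioo_subset_Icc_self))).add (hf₀.mono Ioo_subset_Ico_self)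
  have hpow : ∀ p : ℝ, ContinuousOn (fun r : ℝ => r ^ p) (Ioo 0 1) := fun p =>
    continuousOn_id.rpow_const fun r hr => Or.inl hr.1.ne'
  have hw := fun r (hr : r ∈ Ioo (0 : ℝ) 1) => h.isRadialOperator_op.hasDerivAt_w (γ := γ)
    h.lam_pos h.sub_one_nonneg h.neg_one_lt hr.1 (hV.isProfile r hr).2
  -- Continuity of the inverse is read off from that of `nonlin`, since `(1+α) H = (1-γ) z - Q`.
  have hHc : ContinuousOn (fun r => (1 + α) * radialInverse h.op (z r) (k r)) (Ioo 0 1) := by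
    have h1 := (h.isDissipative.continuous h.q_pos).comp_continuousOn (hzc.prodMk hkc)
    have h2 : ContinuousOn (fun r => (1 - γ) * z r - h.nonlin (z r) (k r)) (Ioo 0 1) :=
      (continuousOn_const.mul hzc).sub h1
    refine h2.congr fun r _ => ?_
    simp only [nonlin, radialNonlinearity]
    ring
  have hwC : ContDiffOn ℝ 1 w (Ioo 0 1) :=
    contDiffOn_one_of_hasDerivAt isOpen_Ioo (fun r hr => (hw r hr).1) ((hpow _).mul hHc)
  have hVd : ∀ r ∈ Ioo (0 : ℝ) 1, HasDerivAt V (signedPow a (w r)) r := fun r hr => by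
    simp only [w]
    rw [h.signedPow_scale hr.1]
    exact (hV.isProfile r hr).1
  have hprof : IsC1αProfile a V w := ⟨hVd, hwC⟩
  have hmaps : MapsTo (fun x : RN N => ‖x‖) (closedBall 0 1) (Icc 0 1) := fun x hx =>
    ⟨norm_nonneg _, mem_closedBall_zero_iff.1 hx⟩
  constructor
  · obtain ⟨B, hB⟩ := isCompact_Icc.exists_bound_of_continuousOn hV.continuousOn
    exact ⟨B, fun x hx => hB _ (hmaps hx)⟩
  · exact ⟨V, fun x _ => rfl⟩
  · exact hV.continuousOn.comp continuous_norm.continuousOn hmaps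
  · refine ⟨V, fun x _ => rfl, contDiffOn_one_of_hasDerivAt isOpen_Ioo hVd
      ((continuous_signedPow h.root_gt).comp_continuousOn hwC.continuousOn), ?_⟩
    refine hwC.congr fun r hr => ?_
    rw [(hVd r hr).deriv]
    exact signedPow_signedPow h.root_mul _
  · refine hprof.isViscSolution h.root_mul h.neg_one_lt h.lam_pos.le h.elliptic h.rotation
      h.homogeneous h.axis (fun x _ => rfl) fun x hx => ?_
    have hr := norm_mem_Ioo hx
    have h1 := (hw _ hr).2
    rw [← (hw _ hr).1.deriv] at h1
    rw [hf x hx.1]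
    refine h1.trans ?_
    simp only
    ring
  · intro x hx
    rw [mem_sphere_zero_iff_norm.1 hx, hV.boundary]

lemma norm_axis (h : IsRadialProblem lam Lam α γ F) {r : ℝ} (hr : 0 ≤ r) :
    ‖(EuclideanSpace.single h.axis r : RN N)‖ = r := by
  simp [abs_of_nonneg hr]

lemma continuous_axis (h : IsRadialProblem lam Lam α γ F) :
    Continuous fun r : ℝ => (EuclideanSpace.single h.axis r : RN N) := by
  have : (fun r : ℝ => (EuclideanSpace.single h.axis r : RN N)) =
      fun r => r • EuclideanSpace.single h.axis (1 : ℝ) := by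
    ext r j; simp
  rw [this]
  exact continuous_id.smul continuous_const

/-- The profile of a bounded radial solution. -/
lemma exists_profile_of_solution (h : IsRadialProblem lam Lam α γ F) {β b : ℝ}
    {f u : RN N → ℝ} {f₀ : ℝ → ℝ} (hu : IsBoundedRadialSolution α γ β b F f u)
    (hf : ∀ x ∈ ball (0 : RN N) 1, f x = f₀ ‖x‖) (hf₀ : ContinuousOn f₀ (Ico 0 1)) :
    ∃ V z, h.IsSolutionProfile β b f₀ V z ∧ ∀ x ∈ closedBall (0 : RN N) 1, u x = V ‖x‖ := by
  set a := (1 + α)⁻¹ - 1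
  -- Restriction to an axis gives a profile on all of `[0, 1]`, whereas the one supplied by
  -- `C_{1,α}` represents `u` only on `(0, 1)`.
  set V : ℝ → ℝ := fun r => u (EuclideanSpace.single h.axis r)
  have hmem : ∀ r ∈ Icc (0 : ℝ) 1, (EuclideanSpace.single h.axis r : RN N) ∈ closedBall 0 1 :=
    fun r hr => by rw [mem_closedBall_zero_iff, h.norm_axis hr.1]; exact hr.2
  have huV : ∀ x ∈ closedBall (0 : RN N) 1, u x = V ‖x‖ := by
    obtain ⟨U, hU⟩ := hu.radial
    intro x hx
    have hx' : ‖x‖ ∈ Icc (0 : ℝ) 1 := ⟨norm_nonneg _, mem_closedBall_zero_iff.1 hx⟩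
    simp only [V]
    rw [hU x hx, hU _ (hmem _ hx'), h.norm_axis hx'.1]
  have hVc : ContinuousOn V (Icc 0 1) :=
    hu.continuousOn.comp h.continuous_axis.continuousOn hmem
  have hV1 : V 1 = b := hu.boundary _ (by
    rw [mem_sphere_zero_iff_norm, h.norm_axis zero_le_one])
  obtain ⟨U, hU, hUd, hUw⟩ := hu.memC1α
  have hUV : EqOn V U (Ioo 0 1) := fun r hr => by
    simp only [V]
    rw [hU, h.norm_axis hr.1.le]
    refine ⟨by rw [mem_ball_zero_iff, h.norm_axis hr.1.le]; exact hr.2, ?_⟩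
    rw [mem_singleton_iff, ← norm_eq_zero, h.norm_axis hr.1.le]
    exact hr.1.ne'
  set w : ℝ → ℝ := fun r => signedPow α (deriv V r)
  have hprof : IsC1αProfile a V w := by
    constructor
    · intro r hr
      have h1 : DifferentiableAt ℝ V r :=
        (((hUd.congr hUV).contDiffAt (isOpen_Ioo.mem_nhds hr)).differentiableAt one_ne_zero)
      simp only [w]
      rw [signedPow_signedPow (by rw [mul_comm]; exact h.root_mul)]
      exact h1.hasDerivAt
    · refine hUw.congr fun r hr => ?_
      simp only [w]
      rw [(hUV.eventuallyEq_of_mem (isOpen_Ioo.mem_nhds hr)).deriv_eq]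
  set k : ℝ → ℝ := fun r => β * signedPow α (V r) + f₀ r
  have hkc : ContinuousOn (fun r => r ^ (-γ) * k r) (Ioo 0 1) := by
    refine (continuousOn_id.rpow_const fun r hr => Or.inl hr.1.ne').mul ?_
    exact (continuousOn_const.mul ((continuous_signedPow h.neg_one_lt).comp_continuousOn
      (hVc.mono Ioo_subset_Icc_self))).add (hf₀.mono Ioo_subset_Ico_self)
  have heq := hprof.equation_of_isViscSolution h.root_mul h.neg_one_lt h.lam_pos h.one_le_dim
    h.elliptic h.rotation h.homogeneous h.axis (fun x hx => huV x (ball_subset_closedBall hx.1))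
    hkc (fun x hx => by
      rw [huV x (ball_subset_closedBall hx.1), hf x hx.1]
      simp only [k]; ring) hu.solves
  refine ⟨V, fun r => r ^ (γ - 1) * w r, ⟨hVc, hV1, fun r hr => ⟨?_, ?_⟩⟩, huV⟩
  · rw [← h.signedPow_scale hr.1, ← mul_assoc, ← Real.rpow_add hr.1,
      show 1 - γ + (γ - 1) = 0 by ring, Real.rpow_zero, one_mul]
    exact hprof.hasDerivAt r hr
  · exact h.isRadialOperator_op.hasDerivAt_z h.lam_pos h.sub_one_nonneg h.neg_one_lt hr.1
      (hprof.differentiableAt hr).hasDerivAt (heq r hr)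

end
end IsRadialProblem

/-! ### Increments of profiles -/

lemma abs_sub_le_of_abs_deriv_le {V V' B B' : ℝ → ℝ} (hV : ContinuousOn V (Icc 0 1))
    (hB : ContinuousOn B (Icc 0 1)) (hVd : ∀ r ∈ Ioo (0 : ℝ) 1, HasDerivAt V (V' r) r)
    (hBd : ∀ r ∈ Ioo (0 : ℝ) 1, HasDerivAt B (B' r) r)
    (hle : ∀ r ∈ Ioo (0 : ℝ) 1, |V' r| ≤ B' r) {x y : ℝ} (hx : x ∈ Icc (0 : ℝ) 1)
    (hy : y ∈ Icc (0 : ℝ) 1) (hxy : x ≤ y) : |V y - V x| ≤ B y - B x := by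
  have h1 : MonotoneOn (fun r => B r - V r) (Icc 0 1) := by
    refine monotoneOn_of_deriv_nonneg (convex_Icc 0 1) (hB.sub hV) (fun r hr => ?_) fun r hr => ?_
    all_goals rw [interior_Icc] at hr
    · exact ((hBd r hr).sub (hVd r hr)).differentiableAt.differentiableWithinAt
    · rw [((hBd r hr).fun_sub (hVd r hr)).deriv]
      linarith [(abs_le.1 (hle r hr)).2]
  have h2 : MonotoneOn (fun r => B r + V r) (Icc 0 1) := by
    refine monotoneOn_of_deriv_nonneg (convex_Icc 0 1) (hB.add hV) (fun r hr => ?_) fun r hr => ?_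
    all_goals rw [interior_Icc] at hr
    · exact ((hBd r hr).add (hVd r hr)).differentiableAt.differentiableWithinAt
    · rw [((hBd r hr).fun_add (hVd r hr)).deriv]
      linarith [(abs_le.1 (hle r hr)).1]
  have h3 := h1 hx hy hxy
  have h4 := h2 hx hy hxy
  simp only at h3 h4
  exact abs_le.2 ⟨by linarith, by linarith⟩

lemma eqOn_of_deriv_eq {V₁ V₂ V' : ℝ → ℝ} (h₁ : ContinuousOn V₁ (Icc 0 1))
    (h₂ : ContinuousOn V₂ (Icc 0 1)) (hd₁ : ∀ r ∈ Ioo (0 : ℝ) 1, HasDerivAt V₁ (V' r) r)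
    (hd₂ : ∀ r ∈ Ioo (0 : ℝ) 1, HasDerivAt V₂ (V' r) r) (hb : V₁ 1 = V₂ 1) :
    EqOn V₁ V₂ (Icc 0 1) := by
  intro r hr
  have h := abs_sub_le_of_abs_deriv_le (V := fun r => V₁ r - V₂ r) (B := fun _ => 0)
    (V' := fun _ => 0) (B' := fun _ => 0) (h₁.sub h₂) continuousOn_const
    (fun r hr => ((hd₁ r hr).fun_sub (hd₂ r hr)).congr_deriv (sub_self _))
    (fun r _ => hasDerivAt_const _ _) (by simp) hr (right_mem_Icc.2 zero_le_one) hr.2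
  simp only [hb, sub_self, zero_sub, abs_neg] at h
  exact sub_eq_zero.1 (abs_eq_zero.1 (le_antisymm h (abs_nonneg _)))

namespace IsRadialProblem
section
variable {N : ℕ} {lam Lam α γ : ℝ} {F : Matrix (Fin N) (Fin N) ℝ → ℝ}

/-- For `β = 0` both profiles have the same data, so `z` and hence `V'` coincide. For `β > 0` the
zero order term is strictly increasing in `V` and the maximum principle applies in both directions.
-/
lemma IsSolutionProfile.eqOn {h : IsRadialProblem lam Lam α γ F} {β b : ℝ}
    {f V₁ z₁ V₂ z₂ : ℝ → ℝ} (hβ : 0 ≤ β) (h₁ : h.IsSolutionProfile β b f V₁ z₁)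
    (h₂ : h.IsSolutionProfile β b f V₂ z₂) (hf : ∃ B, ∀ r ∈ Ico (0 : ℝ) 1, |f r| ≤ B) :
    EqOn V₁ V₂ (Icc 0 1) := by
  obtain ⟨Z₁, _, hZ₁, -⟩ := h₁.exists_bound hf
  obtain ⟨Z₂, _, hZ₂, -⟩ := h₂.exists_bound hf
  have hZ₁' : ∀ r ∈ Ioo (0 : ℝ) 1, |z₁ r| ≤ max Z₁ Z₂ := fun r hr =>
    (hZ₁ r hr).trans (le_max_left _ _)
  have hZ₂' : ∀ r ∈ Ioo (0 : ℝ) 1, |z₂ r| ≤ max Z₁ Z₂ := fun r hr =>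
    (hZ₂ r hr).trans (le_max_right _ _)
  rcases hβ.eq_or_lt with rfl | hβ
  · have hz : ∀ r ∈ Ioo (0 : ℝ) 1, z₁ r = z₂ r := fun r hr => le_antisymm
      (h₂.isProfile.z_mono h.q_pos h.isDissipative h₁.isProfile hZ₂' hZ₁' hr fun x _ => by simp)
      (h₁.isProfile.z_mono h.q_pos h.isDissipative h₂.isProfile hZ₁' hZ₂' hr fun x _ => by simp)
    refine eqOn_of_deriv_eq h₁.continuousOn h₂.continuousOn (fun r hr => (h₁.isProfile r hr).1)
      (fun r hr => ?_) (h₁.boundary.trans h₂.boundary.symm)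
    rw [hz r hr]
    exact (h₂.isProfile r hr).1
  · have key : ∀ {V₁ V₂ : ℝ → ℝ} (r : ℝ), V₂ r < V₁ r →
        β * signedPow α (V₂ r) + f r < β * signedPow α (V₁ r) + f r := fun r hlt =>
      add_lt_add_left (mul_lt_mul_of_pos_left (strictMono_signedPow h.neg_one_lt hlt) hβ) _
    intro r hr
    exact le_antisymm
      (h₁.isProfile.le_of_le h.root_gt h.q_pos h.isDissipative h₂.isProfile hZ₁' hZ₂'
        h₁.continuousOn h₂.continuousOn (h₁.boundary.trans h₂.boundary.symm).le
        (fun r _ hlt => key r hlt) r hr)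
      (h₂.isProfile.le_of_le h.root_gt h.q_pos h.isDissipative h₁.isProfile hZ₂' hZ₁'
        h₂.continuousOn h₁.continuousOn (h₂.boundary.trans h₁.boundary.symm).le
        (fun r _ hlt => key r hlt) r hr)

end
end IsRadialProblem

/-! ### Regularity up to the boundary -/

/-- A radial function whose profile is `C¹` on the line with vanishing derivative at `0` is `C¹`. -/
lemma contDiff_one_radial {N : ℕ} {U v : ℝ → ℝ} (hU : ∀ r, HasDerivAt U (v r) r)
    (hv : Continuous v) (hv0 : v 0 = 0) : ContDiff ℝ 1 fun x : RN N => U ‖x‖ := by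
  have hd : ∀ x : RN N, HasFDerivAt (fun x : RN N => U ‖x‖) ((v ‖x‖ / ‖x‖) • innerSL ℝ x) x := by
    intro x
    by_cases hx : x = 0
    · subst hx
      rw [norm_zero, div_zero, zero_smul]
      have h0 := hU 0
      rw [hv0, hasDerivAt_iff_isLittleO] at h0
      rw [hasFDerivAt_iff_isLittleO]
      have h1 : Filter.Tendsto (fun x : RN N => ‖x‖) (𝓝 0) (𝓝 0) := by
        simpa using (continuous_norm (E := RN N)).tendsto 0
      have h2 := h0.comp_tendsto h1
      simp only [Function.comp_def, sub_zero, smul_zero] at h2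
      simpa using Asymptotics.isLittleO_norm_right.1 h2
    · exact hasFDerivAt_radial hx (hU _)
  refine contDiff_one_iff_fderiv.2 ⟨fun x => (hd x).differentiableAt, ?_⟩
  have hf : fderiv ℝ (fun x : RN N => U ‖x‖) = fun x => (v ‖x‖ / ‖x‖) • innerSL ℝ x := by
    ext1 x; exact (hd x).fderiv
  rw [hf, continuous_iff_continuousAt]
  intro x
  by_cases hx : x = 0
  · subst hx
    rw [ContinuousAt, norm_zero, div_zero, zero_smul]
    have h1 : Filter.Tendsto (fun x : RN N => |v ‖x‖|) (𝓝 0) (𝓝 0) := by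
      have : Continuous fun x : RN N => |v ‖x‖| := (hv.comp continuous_norm).abs
      simpa [hv0] using this.tendsto 0
    -- The factor `1/|x|` is cancelled by the norm of `innerSL ℝ x`, leaving `|v(|x|)| → v 0 = 0`.
    refine squeeze_zero_norm (fun x => ?_) h1
    rw [norm_smul, innerSL_apply_norm, norm_div, norm_norm, Real.norm_eq_abs]
    rw [div_mul_eq_mul_div]
    exact div_le_of_le_mul₀ (norm_nonneg _) (abs_nonneg _) le_rfl
  · exact ((hv.comp continuous_norm).continuousAt.div continuous_norm.continuousAt
      (norm_ne_zero_iff.2 hx)).smul (innerSL ℝ (E := RN N)).continuous.continuousAt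

/-- Continuous extension of a function on `(0,1)` with one-sided limits at the end points. -/
lemma exists_continuous_extension {v : ℝ → ℝ} (hv : ContinuousOn v (Ioo 0 1)) {la lb : ℝ}
    (ha : Filter.Tendsto v (𝓝[>] 0) (𝓝 la)) (hb : Filter.Tendsto v (𝓝[<] 1) (𝓝 lb)) :
    ∃ v' : ℝ → ℝ, Continuous v' ∧ v' 0 = la ∧ EqOn v' v (Ioo 0 1) := by
  have hc := continuousOn_Icc_extendFrom_Ioo hv ha hb
  refine ⟨fun r => extendFrom (Ioo 0 1) v (clamp01 r),
    hc.comp_continuous continuous_clamp01 clamp01_mem, ?_, fun r hr => ?_⟩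
  · simp only
    rw [clamp01_of_mem (left_mem_Icc.2 zero_le_one)]
    exact eq_lim_at_left_extendFrom_Ioo zero_lt_one ha
  · simp only
    rw [clamp01_of_mem (Ioo_subset_Icc_self hr)]
    exact extendFrom_eq (subset_closure hr) (hv r hr)

namespace IsRadialProblem
section
variable {N : ℕ} {lam Lam α γ : ℝ} {F : Matrix (Fin N) (Fin N) ℝ → ℝ}

lemma IsSolutionProfile.abs_deriv_le {h : IsRadialProblem lam Lam α γ F} {β b : ℝ}
    {f V z : ℝ → ℝ} (hV : h.IsSolutionProfile β b f V z)
    (hf : ∃ B, ∀ r ∈ Ico (0 : ℝ) 1, |f r| ≤ B) :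
    ∃ C, 0 ≤ C ∧ ∀ r ∈ Ioo (0 : ℝ) 1,
      |r ^ ((2 + α - γ) / (1 + α) - 1) * signedPow ((1 + α)⁻¹ - 1) (z r)| ≤
        C * r ^ ((2 + α - γ) / (1 + α) - 1) := by
  obtain ⟨Z, _, hZ, -⟩ := hV.exists_bound hf
  have hZ0 : 0 ≤ Z := (abs_nonneg _).trans (hZ (1 / 2) ⟨by norm_num, by norm_num⟩)
  refine ⟨Z ^ (1 + ((1 + α)⁻¹ - 1)), Real.rpow_nonneg hZ0 _, fun r hr => ?_⟩
  rw [abs_mul, abs_of_pos (Real.rpow_pos_of_pos hr.1 _), mul_comm, abs_signedPow h.root_gt]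
  refine mul_le_mul_of_nonneg_right ?_ (Real.rpow_nonneg hr.1.le _)
  exact Real.rpow_le_rpow (abs_nonneg _) (hZ r hr) (by linarith [h.root_gt])

lemma IsSolutionProfile.lipschitz {h : IsRadialProblem lam Lam α γ F} {β b : ℝ}
    {f V z : ℝ → ℝ} (hV : h.IsSolutionProfile β b f V z)
    (hf : ∃ B, ∀ r ∈ Ico (0 : ℝ) 1, |f r| ≤ B) (hγ : γ ≤ 1) :
    ∃ C, 0 ≤ C ∧ ∀ x ∈ Icc (0 : ℝ) 1, ∀ y ∈ Icc (0 : ℝ) 1, |V x - V y| ≤ C * |x - y| := by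
  obtain ⟨C, hC, hd⟩ := hV.abs_deriv_le hf
  have hs : 0 ≤ (2 + α - γ) / (1 + α) - 1 := by
    rw [sub_nonneg, one_le_div h.one_add_pos]; linarith
  have key : ∀ x ∈ Icc (0 : ℝ) 1, ∀ y ∈ Icc (0 : ℝ) 1, x ≤ y → |V y - V x| ≤ C * y - C * x :=
    fun x hx y hy hxy => abs_sub_le_of_abs_deriv_le (B := fun r => C * r) (B' := fun _ => C)
      hV.continuousOn (by fun_prop) (fun r hr => (hV.isProfile r hr).1)
      (fun r _ => by simpa using (hasDerivAt_id r).const_mul C)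
      (fun r hr => (hd r hr).trans
        (mul_le_of_le_one_right hC (Real.rpow_le_one hr.1.le hr.2.le hs))) hx hy hxy
  refine ⟨C, hC, fun x hx y hy => ?_⟩
  rcases le_total x y with hxy | hxy
  · rw [abs_sub_comm (V x), abs_sub_comm x, abs_of_nonneg (sub_nonneg.2 hxy), mul_sub]
    exact key x hx y hy hxy
  · rw [abs_of_nonneg (sub_nonneg.2 hxy), mul_sub]
    exact key y hy x hx hxy

lemma IsSolutionProfile.holder {h : IsRadialProblem lam Lam α γ F} {β b : ℝ}
    {f V z : ℝ → ℝ} (hV : h.IsSolutionProfile β b f V z)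
    (hf : ∃ B, ∀ r ∈ Ico (0 : ℝ) 1, |f r| ≤ B) (hγ : 1 < γ) :
    ∃ C, 0 ≤ C ∧ ∀ x ∈ Icc (0 : ℝ) 1, ∀ y ∈ Icc (0 : ℝ) 1,
      |V x - V y| ≤ C * |x - y| ^ ((2 + α - γ) / (1 + α)) := by
  obtain ⟨C, hC, hd⟩ := hV.abs_deriv_le hf
  have hs0 := h.s_pos
  have hs1 : (2 + α - γ) / (1 + α) ≤ 1 := by
    rw [div_le_one h.one_add_pos]; linarith
  set s := (2 + α - γ) / (1 + α)
  have key : ∀ x ∈ Icc (0 : ℝ) 1, ∀ y ∈ Icc (0 : ℝ) 1, x ≤ y →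
      |V y - V x| ≤ C / s * (y - x) ^ s := fun x hx y hy hxy => by
    have h1 := abs_sub_le_of_abs_deriv_le (B := fun r => C / s * r ^ s)
      (B' := fun r => C * r ^ (s - 1)) hV.continuousOn
      (continuousOn_const.mul (continuousOn_id.rpow_const fun _ _ => Or.inr hs0.le))
      (fun r hr => (hV.isProfile r hr).1)
      (fun r hr => ((Real.hasDerivAt_rpow_const (Or.inl hr.1.ne')).const_mul (C / s)).congr_deriv
        (by field_simp)) hd hx hy hxy
    -- For `0 < s ≤ 1` the power is subadditive, so `y^s - x^s ≤ (y - x)^s`.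
    have h2 := Real.rpow_add_le_add_rpow hx.1 (sub_nonneg.2 hxy) hs0.le hs1
    rw [add_sub_cancel] at h2
    have h3 := mul_le_mul_of_nonneg_left h2 (div_nonneg hC hs0.le)
    rw [mul_add] at h3
    linarith
  refine ⟨C / s, div_nonneg hC hs0.le, fun x hx y hy => ?_⟩
  rcases le_total x y with hxy | hxy
  · rw [abs_sub_comm (V x), abs_sub_comm x, abs_of_nonneg (sub_nonneg.2 hxy)]
    exact key x hx y hy hxy
  · rw [abs_of_nonneg (sub_nonneg.2 hxy)]
    exact key y hy x hx hxy

/-- The function `z` has a limit at the outer boundary. -/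
lemma IsSolutionProfile.exists_tendsto_z {h : IsRadialProblem lam Lam α γ F} {β b : ℝ}
    {f V z : ℝ → ℝ} (hV : h.IsSolutionProfile β b f V z)
    (hf : ∃ B, ∀ r ∈ Ico (0 : ℝ) 1, |f r| ≤ B) :
    ∃ l, Filter.Tendsto z (𝓝[<] 1) (𝓝 l) := by
  obtain ⟨Z, K, hZ, hK⟩ := hV.exists_bound hf
  have hQ := h.isDissipative
  have hsub : Ioo (1 / 2 : ℝ) 1 ⊆ Ioo 0 1 := Ioo_subset_Ioo_left (by norm_num)
  obtain ⟨M, hM⟩ : ∃ M, ∀ z k, |z| ≤ Z → |k| ≤ K → |h.nonlin z k| ≤ M := by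
    obtain ⟨M, hM⟩ := ((isCompact_Icc (a := -Z) (b := Z)).prod
      (isCompact_Icc (a := -K) (b := K))).exists_bound_of_continuousOn
      (hQ.continuous h.q_pos).continuousOn
    exact ⟨M, fun z k hz hk => hM (z, k) ⟨abs_le.1 hz, abs_le.1 hk⟩⟩
  -- The right-hand side `Q / r` is bounded by `2M` on `(1/2, 1)`. This gives a limit of `z` at `1`
  -- even if the source has none.
  have hlip : LipschitzOnWith (Real.toNNReal (2 * M)) z (Ioo (1 / 2) 1) := by
    refine (convex_Ioo _ _).lipschitzOnWith_of_nnnorm_hasDerivWithin_le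
      (fun r hr => (hV.isProfile r (hsub hr)).2.hasDerivWithinAt) fun r hr => ?_
    have h1 := hM _ _ (hZ r (hsub hr)) (hK r (hsub hr))
    rw [← NNReal.coe_le_coe, coe_nnnorm, norm_div, norm_neg, Real.norm_eq_abs, Real.norm_eq_abs,
      abs_of_pos (hsub hr).1, Real.coe_toNNReal _ (by linarith [abs_nonneg (h.nonlin (z r)
        (β * signedPow α (V r) + f r))]), div_le_iff₀ (hsub hr).1]
    have h2 : 0 ≤ M := (abs_nonneg _).trans h1
    have h3 := hr.1
    nlinarith
  obtain ⟨g, hg, hgz⟩ := hlip.extend_real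
  refine ⟨g 1, ?_⟩
  have h1 : Filter.Tendsto g (𝓝[<] 1) (𝓝 (g 1)) := hg.continuous.continuousAt.continuousWithinAt
  refine h1.congr' ?_
  filter_upwards [Ioo_mem_nhdsLT (show (1 / 2 : ℝ) < 1 by norm_num)] with r hr using (hgz hr).symm

lemma IsSolutionProfile.exists_contDiff {h : IsRadialProblem lam Lam α γ F} {β b : ℝ}
    {f V z : ℝ → ℝ} (hV : h.IsSolutionProfile β b f V z)
    (hf : ∃ B, ∀ r ∈ Ico (0 : ℝ) 1, |f r| ≤ B) (hγ : γ < 1) :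
    ContDiffOn ℝ 1 (fun x : RN N => V ‖x‖) (closedBall 0 1) := by
  obtain ⟨C, hC, hd⟩ := hV.abs_deriv_le hf
  have hs : 0 < (2 + α - γ) / (1 + α) - 1 := by
    rw [sub_pos, one_lt_div h.one_add_pos]; linarith
  set s := (2 + α - γ) / (1 + α)
  set v : ℝ → ℝ := fun r => r ^ (s - 1) * signedPow ((1 + α)⁻¹ - 1) (z r)
  have hzc : ContinuousOn z (Ioo 0 1) := fun r hr =>
    (hV.isProfile r hr).2.continuousAt.continuousWithinAt
  have hvc : ContinuousOn v (Ioo 0 1) :=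
    (continuousOn_id.rpow_const fun r _ => Or.inr hs.le).mul
      ((continuous_signedPow h.root_gt).comp_continuousOn hzc)
  -- For `γ < 1` one has `s > 1`, so `|V'| ≤ C r^{s-1}` forces the derivative to vanish at the
  -- origin, as a `C¹` radial function requires.
  have h0 : Filter.Tendsto v (𝓝[>] 0) (𝓝 0) := by
    have h1 : Filter.Tendsto (fun r : ℝ => C * r ^ (s - 1)) (𝓝[>] 0) (𝓝 0) := by
      have : Continuous fun r : ℝ => C * r ^ (s - 1) :=
        continuous_const.mul (continuous_id.rpow_const fun _ => Or.inr hs.le)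
      have h2 := this.tendsto 0
      rw [Real.zero_rpow hs.ne', mul_zero] at h2
      exact h2.mono_left nhdsWithin_le_nhds
    refine squeeze_zero_norm' ?_ h1
    filter_upwards [Ioo_mem_nhdsGT zero_lt_one] with r hr using hd r hr
  obtain ⟨l, hl⟩ := hV.exists_tendsto_z hf
  have h1 : Filter.Tendsto v (𝓝[<] 1) (𝓝 (1 ^ (s - 1) * signedPow ((1 + α)⁻¹ - 1) l)) := by
    refine Filter.Tendsto.mul ?_ (((continuous_signedPow h.root_gt).tendsto l).comp hl)
    exact ((continuous_id.rpow_const fun _ => Or.inr hs.le : Continuous fun r : ℝ =>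
      r ^ (s - 1)).tendsto 1).mono_left nhdsWithin_le_nhds
  obtain ⟨v', hv', hv'0, hvv'⟩ := exists_continuous_extension hvc h0 h1
  -- A primitive of the extended derivative is `C¹` on the whole line, so smoothness up to the
  -- sphere follows from that of a function on all of space.
  set U : ℝ → ℝ := fun r => V 1 + ∫ ρ in (1 : ℝ)..r, v' ρ
  have hU : ∀ r, HasDerivAt U (v' r) r := fun r =>
    (hv'.integral_hasStrictDerivAt 1 r).hasDerivAt.const_add _
  have hUV : EqOn V U (Icc 0 1) := by
    refine eqOn_of_deriv_eq hV.continuousOn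
      (fun r _ => (hU r).continuousAt.continuousWithinAt) (fun r hr => (hV.isProfile r hr).1)
      (fun r hr => (hU r).congr_deriv (hvv' hr)) (by simp [U])
  refine (contDiff_one_radial (N := N) hU hv' hv'0).contDiffOn.congr fun x hx => ?_
  exact hUV ⟨norm_nonneg _, mem_closedBall_zero_iff.1 hx⟩

/-- The profile of the source term. -/
lemma exists_source_profile (h : IsRadialProblem lam Lam α γ F) {f : RN N → ℝ}
    (hfcont : ContinuousOn f (ball 0 1)) (hfrad : IsRadialOn f (ball 0 1))
    (hfbdd : ∃ C : ℝ, ∀ x ∈ ball (0 : RN N) 1, |f x| ≤ C) :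
    ∃ f₀ : ℝ → ℝ, (∀ x ∈ ball (0 : RN N) 1, f x = f₀ ‖x‖) ∧ ContinuousOn f₀ (Ico 0 1) ∧
      ∃ B, ∀ r ∈ Ico (0 : ℝ) 1, |f₀ r| ≤ B := by
  have hmem : ∀ r ∈ Ico (0 : ℝ) 1, (EuclideanSpace.single h.axis r : RN N) ∈ ball 0 1 :=
    fun r hr => by rw [mem_ball_zero_iff, h.norm_axis hr.1]; exact hr.2
  obtain ⟨U, hU⟩ := hfrad
  obtain ⟨C, hC⟩ := hfbdd
  refine ⟨fun r => f (EuclideanSpace.single h.axis r), fun x hx => ?_,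
    hfcont.comp h.continuous_axis.continuousOn hmem, C, fun r hr => hC _ (hmem r hr)⟩
  simp only
  rw [hU x hx, hU _ (hmem _ ⟨norm_nonneg _, mem_ball_zero_iff.1 hx⟩), h.norm_axis (norm_nonneg _)]

end
end IsRadialProblem

end

/-! ### Existence, uniqueness and regularity from the radial profiles -/

theorem mainTheorem12 (N : ℕ) (lam Lam α γ : ℝ)
    (hlam : 0 < lam) (hLam : lam ≤ Lam)
    (hN : 2 < lam / Lam * ((N : ℝ) - 1) + 1)
    (hα : -1 < α) (hγ0 : 0 < γ) (hγ : γ < 2 + α)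
    (F : Matrix (Fin N) (Fin N) ℝ → ℝ)
    (hFcont : ContinuousOn F {M | M.IsSymm})
    (hFell : IsUniformlyElliptic lam Lam F)
    (hFhom : IsPosHomogeneous F)
    (hFrot : IsRotationInvariant F)
    (f : RN N → ℝ)
    (hfcont : ContinuousOn f (ball 0 1))
    (hfrad : IsRadialOn f (ball 0 1))
    (hfbdd : ∃ C : ℝ, ∀ x ∈ ball (0 : RN N) 1, |f x| ≤ C)
    (β b : ℝ) (hβ : 0 ≤ β) :
    (∃ u : RN N → ℝ, IsBoundedRadialSolution α γ β b F f u) ∧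
    ((0 < β ∨
        (β = 0 ∧
          ((∀ x ∈ ball (0 : RN N) 1, 0 ≤ f x) ∨ (∀ x ∈ ball (0 : RN N) 1, f x ≤ 0)))) →
      ∀ u v : RN N → ℝ, IsBoundedRadialSolution α γ β b F f u →
        IsBoundedRadialSolution α γ β b F f v → EqOn u v (closedBall 0 1)) ∧
    (∀ u : RN N → ℝ, IsBoundedRadialSolution α γ β b F f u →
      (γ < 1 → ContDiffOn ℝ 1 u (closedBall 0 1)) ∧
      (γ ≤ 1 → ∃ K : NNReal, LipschitzOnWith K u (closedBall 0 1)) ∧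
      (1 < γ → ∃ C : ℝ, ∀ x ∈ closedBall (0 : RN N) 1, ∀ y ∈ closedBall (0 : RN N) 1,
        |u x - u y| ≤ C * ‖x - y‖ ^ ((2 + α - γ) / (1 + α)))) := by
  have h : IsRadialProblem lam Lam α γ F := ⟨hlam, hLam, hN, hα, hγ, hFell, hFhom, hFrot⟩
  obtain ⟨f₀, hf, hf₀, hfB⟩ := h.exists_source_profile hfcont hfrad hfbdd
  have hmem : ∀ x ∈ closedBall (0 : RN N) 1, ‖x‖ ∈ Icc (0 : ℝ) 1 := fun x hx =>
    ⟨norm_nonneg _, mem_closedBall_zero_iff.1 hx⟩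
  refine ⟨?_, fun _ u v hu hv => ?_, fun u hu => ?_⟩
  · obtain ⟨V, z, hV⟩ := h.exists_isSolutionProfile hβ b hf₀ hfB
    exact ⟨_, hV.isBoundedRadialSolution hf hf₀⟩
  · obtain ⟨U, z, hU, huU⟩ := h.exists_profile_of_solution hu hf hf₀
    obtain ⟨V, z', hV, hvV⟩ := h.exists_profile_of_solution hv hf hf₀
    intro x hx
    rw [huU x hx, hvV x hx, hU.eqOn hβ hV hfB (hmem x hx)]
  · obtain ⟨V, z, hV, huV⟩ := h.exists_profile_of_solution hu hf hf₀
    refine ⟨fun hγ1 => (hV.exists_contDiff hfB hγ1).congr huV, fun hγ1 => ?_, fun hγ1 => ?_⟩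
    · obtain ⟨C, hC, hlip⟩ := hV.lipschitz hfB hγ1
      refine ⟨C.toNNReal, LipschitzOnWith.of_dist_le_mul fun x hx y hy => ?_⟩
      rw [Real.coe_toNNReal _ hC, Real.dist_eq, dist_eq_norm, huV x hx, huV y hy]
      exact (hlip _ (hmem x hx) _ (hmem y hy)).trans
        (mul_le_mul_of_nonneg_left (abs_norm_sub_norm_le x y) hC)
    · obtain ⟨C, hC, hhol⟩ := hV.holder hfB hγ1
      refine ⟨C, fun x hx y hy => ?_⟩
      rw [huV x hx, huV y hy]
      exact (hhol _ (hmem x hx) _ (hmem y hy)).trans (mul_le_mul_of_nonneg_left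
        (Real.rpow_le_rpow (abs_nonneg _) (abs_norm_sub_norm_le x y) h.s_pos.le) hC)
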